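/- For $m_1,m_2,m_3>0$ and $Q:\mathbb C\times\mathbb C\to\mathbb C$ consider, for $u=(u_1,u_2,u_3):[0,T)\times\mathbb R\to\mathbb C^3$, the initial value problem $$\Bigl(i\partial_t+\tfrac{1}{2m_j}\partial_x^2\Bigr)u_j=N_j\quad(t>0,\ x\in\mathbb R),\qquad u_j(0,x)=\varphi_j(x),\qquad j=1,2,3,$$ $$N_1=0,\qquad N_2=u_1^2,\qquad N_3=(\partial_xu_3)^2+Q(u_1,u_2)\,\frac{e^{2m_3u_3}}{2m_3}.\tag{NLS}$$ For an integer $s\ge1$ let $H^s(\mathbb R)$ be the space of functions (here $\mathbb C^3$-valued) whose weak derivatives $\partial_x^k\psi$, $0\le k\le s$, are in $L^2(\mathbb R)$, with the norm $\|\psi\|_{H^s}=\sum_{k=0}^s\|\partial_x^k\psi\|_{L^2}$. A solution on $[0,T)$ is a function $u\in C([0,T);H^s(\mathbb R))$ with $u(0)=\varphi$ such that for every $\eta\in C_c^\infty(\mathbb R)$, every $j$ and every $t\in(0,T)$ the function $t\mapsto\int u_j\eta\,dx$ is differentiable and $i\frac{d}{dt}\int u_j\eta\,dx+\frac1{2m_j}\int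 u_j\eta''\,dx=\int N_j\eta\,dx$. We say that the solution with data $\varphi$ blows up in $H^s$ at time $T$ if there is a solution $u$ on $[0,T)$ with data $\varphi$, every solution with data $\varphi$ on an interval $[0,T')$, $T'\le T$, coincides with $u$ on $[0,T')$, and $\lim_{t\to T-0}\|u(t,\cdot)\|_{H^s}=\infty$. **Theorem.** (1) Let $Q=u_2^2$ and $m_1:m_2:m_3=1:2:4$. For every integer $s\ge1$ there are constants $\kappa,K>0$ such that for every $\varepsilon\in(0,1]$ there is $\varphi\in H^s(\mathbb R)$ with $\|\varphi\|_{H^s}=\varepsilon$ for which the solution of (NLS) blows up in $H^s$ at a time $T_\varepsilon\in(\kappa\varepsilon^{-4},K\varepsilon^{-4})$. (2) Let $Q=u_1u_2$ and $m_1:m_2:m_3=1:2:3$. For every integer $s\ge1$ there are constants $\kappa,K>0$ such that for every $\varepsilon\in(0,1]$ there is $\varphi\in H^s(\mathbb R)$ with $\|\varphi\|_{H^s}=\varepsilon$ for which the solution of (NLS) blows up in $H^s$ at a time $T_\varepsilon\in(\kappa\varepsilon^{-6},K\varepsilon^{-6})$. (3) Let $Q=\overline{u_1}u_2$ and $m_1:m_2:m_3=1:2:1$.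 For every integer $s\ge1$ there are constants $\kappa,K>0$ such that for every $\varepsilon\in(0,1]$ there is $\varphi\in H^s(\mathbb R)$ with $\|\varphi\|_{H^s}=\varepsilon$ for which the solution of (NLS) blows up in $H^s$ at a time $T_\varepsilon\in(\kappa\varepsilon^{-6},K\varepsilon^{-6})$. (4) Let $Q=|u_2|u_2$ and $m_1:m_2:m_3=1:2:2$. There are constants $\kappa,K>0$ such that for every $\varepsilon\in(0,1]$ there is $\varphi\in H^1(\mathbb R)$ with $\|\varphi\|_{H^1}=\varepsilon$ for which the solution of (NLS) blows up in $H^1$ at a time $T_\varepsilon\in(\kappa\varepsilon^{-4},K\varepsilon^{-4})$. -/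

import Mathlib

open MeasureTheory Filter Set
open scoped Topology ContDiff

noncomputable section

/-- `g` is the weak (distributional) derivative of order `k` of `f` on the real line:
`∫ f η^(k) = (-1)^k ∫ g η` for every smooth compactly supported `η`. -/
def HasWeakDeriv {E : Type*} [NormedAddCommGroup E] [NormedSpace ℝ E]
    (k : ℕ) (f g : ℝ → E) : Prop :=
  LocallyIntegrable f volume ∧ LocallyIntegrable g volume ∧
    ∀ η : ℝ → ℝ, ContDiff ℝ ∞ η → HasCompactSupport η →
      ∫ x, iteratedDeriv k η x • f x = (-1 : ℝ) ^ k • ∫ x, η x • g x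

open Classical in
/-- A representative of the weak derivative `∂ₓᵏ f` (unique up to null sets; it is `0` if there is
no locally integrable weak derivative). -/
def weakDeriv {E : Type*} [NormedAddCommGroup E] [NormedSpace ℝ E]
    (k : ℕ) (f : ℝ → E) : ℝ → E :=
  if h : ∃ g, HasWeakDeriv k f g then h.choose else 0

/-- `f ∈ Hˢ(ℝ)`: for every `k ≤ s` the weak derivative `∂ₓᵏ f` exists and lies in `L²(ℝ)`. -/
def MemHs {E : Type*} [NormedAddCommGroup E] [NormedSpace ℝ E] (s : ℕ) (f : ℝ → E) : Prop :=
  ∀ k ≤ s, ∃ g, HasWeakDeriv k f g ∧ MemLp g 2 volume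

/-- The norm `∑_{k ≤ s} ‖∂ₓᵏ f‖_{L²}` of `Hˢ(ℝ)` (meaningful for `f ∈ Hˢ(ℝ)`). -/
def normHs {E : Type*} [NormedAddCommGroup E] [NormedSpace ℝ E] (s : ℕ) (f : ℝ → E) : ℝ :=
  ∑ k ∈ Finset.range (s + 1), (eLpNorm (weakDeriv k f) 2 volume).toReal

/-- The nonlinearity `N(u, q)`, with `q` in the place of `∂ₓu`:
`N₁ = 0`, `N₂ = u₁²`, `N₃ = q₃² + Q(u₁, u₂) exp(2 m₃ u₃) / (2 m₃)`. Indices start at `0`. -/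
def nonlinearity (m : Fin 3 → ℝ) (Q : ℂ → ℂ → ℂ) (u q : EuclideanSpace ℂ (Fin 3)) :
    Fin 3 → ℂ :=
  ![0, (u 0) ^ 2,
    (q 2) ^ 2 + Q (u 0) (u 1) * (Complex.exp (2 * (m 2 : ℂ) * u 2) / (2 * (m 2 : ℂ)))]

/-- `u ∈ C([0, T); Hˢ(ℝ; ℂ³))` solves
`(i ∂ₜ + (1 / (2 mⱼ)) ∂ₓ²) uⱼ = Nⱼ(u, ∂ₓu)` for `0 < t < T`, with `u(0) = φ`.
The equation is understood in the sense of distributions in `x`: for every real test function `η`,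
`i d/dt ∫ uⱼ η dx + (1 / (2 mⱼ)) ∫ uⱼ η'' dx = ∫ Nⱼ(u, ∂ₓu) η dx`. -/
structure IsSolution (s : ℕ) (m : Fin 3 → ℝ) (Q : ℂ → ℂ → ℂ) (T : ℝ)
    (φ : ℝ → EuclideanSpace ℂ (Fin 3)) (u : ℝ → ℝ → EuclideanSpace ℂ (Fin 3)) : Prop where
  memHs : ∀ t ∈ Ico 0 T, MemHs s (u t)
  continuous : ∀ t₀ ∈ Ico 0 T,
    Tendsto (fun t => normHs s (u t - u t₀)) (𝓝[Ico 0 T] t₀) (𝓝 0)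
  initial : u 0 =ᵐ[volume] φ
  equation : ∀ η : ℝ → ℝ, ContDiff ℝ ∞ η → HasCompactSupport η →
    ∀ j : Fin 3, ∀ t ∈ Ioo 0 T,
      HasDerivAt (fun τ => Complex.I * ∫ x, η x • u τ x j)
        ((∫ x, η x • nonlinearity m Q (u t x) (weakDeriv 1 (u t) x) j)
          - 1 / (2 * (m j : ℂ)) * ∫ x, iteratedDeriv 2 η x • u t x j) t

/-- `u` is *the* solution on `[0, T)` with data `φ`: it is a solution, and every solution with the
same data on an interval `[0, T')` with `T' ≤ T` coincides with it there. -/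
def IsUniqueSolution (s : ℕ) (m : Fin 3 → ℝ) (Q : ℂ → ℂ → ℂ) (T : ℝ)
    (φ : ℝ → EuclideanSpace ℂ (Fin 3)) (u : ℝ → ℝ → EuclideanSpace ℂ (Fin 3)) : Prop :=
  IsSolution s m Q T φ u ∧
    ∀ T' ≤ T, ∀ w : ℝ → ℝ → EuclideanSpace ℂ (Fin 3), IsSolution s m Q T' φ w →
      ∀ t ∈ Ico 0 T', w t =ᵐ[volume] u t

/-- The solution with data `φ` exists on `[0, T)` and its `Hˢ` norm tends to infinity as
`t → T - 0`. -/
def SolutionBlowsUpAt (s : ℕ) (m : Fin 3 → ℝ) (Q : ℂ → ℂ → ℂ)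
    (φ : ℝ → EuclideanSpace ℂ (Fin 3)) (T : ℝ) : Prop :=
  ∃ u : ℝ → ℝ → EuclideanSpace ℂ (Fin 3), IsUniqueSolution s m Q T φ u ∧
    Tendsto (fun t => normHs s (u t)) (𝓝[<] T) atTop

end

/-! The Cole–Hopf substitution `w = e^{-2 m₃ u₃}` removes the derivative nonlinearity: the third
equation becomes `(i ∂ₜ + ∂ₓ² / (2 m₃)) w = -Q(u₁, u₂)`. For data with vanishing third component, `w
= 1 + z`, where `z` is the Duhamel integral of `Q(u₁, u₂)`, and `u₃ = -log(1 + z) / (2 m₃)`. This is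
regular while `|z| < 1` and becomes infinite where `z` reaches `-1`.

Everything is explicit for the data `A • gaussData`. The first component is a spreading Gaussian.
Since `m₂ = 2 m₁`, its square is a multiple of a free Gaussian of the second equation, so the
forcing is resonant: `u₂` is a free Gaussian times `A² gain(t)`, and `gain` grows like `t^{1/2}`,
which exactly offsets the dispersive decay. The value of `m₃` makes `Q(u₁, u₂)` a Gaussian again, `B
c(t) gaussK m₃ (p t)` with `|B| = |A|^d` and `p(t) ~ i t`. The contributions to the Duhamel integral
then add up coherently: at `x = 0` the function `z` grows like `|A|^d t^{1-β}`, and nowhere does it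
grow faster (`exists_growth_bounds`). In cases (1) and (4) `d = 4`, `β = 0`; in cases (2) and (3) `d
= 3`, `β = 1/2`. Hence `|z|` reaches `1` at a time of order `|A|^{-4}`, respectively `|A|^{-6}`.

To reach the value `-1` exactly, let `T` be the first time at which `|z| = 1` somewhere, say at `x₀`
(`exists_first_time`). This time depends on `|A|` only, so the phase of `A` is still free and can be
chosen to rotate `z(T, x₀)` to `-1` (`exists_blowUp`). Before `T` one has `|z| < 1`; as `t → T` the
real part of `log(1 + z(t, x₀))` tends to `-∞`, and the Sobolev inequality carries the divergence
over to the `Hˢ` norm (`solutionBlowsUpAt_of_eq_neg_one`).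

That the explicit functions are solutions in `C([0, T); Hˢ)` follows from bounds by the weight `1 /
(1 + x²)`, locally uniform in time, on all derivatives needed (`Tame`, `isSolution_of_tame`).
Uniqueness must cover every weak solution (`IsSolution.unique`). The differences of the first two
components solve the free equation and vanish by conservation of the `L²` norm. For the third, the
Cole–Hopf substitution is justified for weak `H¹` solutions (`WeakSchrodinger.coleHopf`), which
requires testing the equation with `H¹` functions, hence the density of test functions in `H¹`. -/

noncomputable section

/-! ### The `L²` norm on the line -/

/-- The `L²` norm of a complex function on the line. -/
def l2norm (f : ℝ → ℂ) : ℝ := (eLpNorm f 2 volume).toReal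

lemma l2norm_nonneg (f : ℝ → ℂ) : 0 ≤ l2norm f := ENNReal.toReal_nonneg

lemma l2norm_eq_norm_toLp {f : ℝ → ℂ} (hf : MemLp f 2 volume) : l2norm f = ‖hf.toLp f‖ :=
  (Lp.norm_toLp f hf).symm

lemma l2norm_congr {f g : ℝ → ℂ} (h : f =ᵐ[volume] g) : l2norm f = l2norm g := by
  rw [l2norm, l2norm, eLpNorm_congr_ae h]

lemma l2norm_add_le {f g : ℝ → ℂ} (hf : MemLp f 2 volume) (hg : MemLp g 2 volume) :
    l2norm (f + g) ≤ l2norm f + l2norm g := by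
  rw [l2norm_eq_norm_toLp hf, l2norm_eq_norm_toLp hg, l2norm_eq_norm_toLp (hf.add hg),
    MemLp.toLp_add]
  exact norm_add_le _ _

lemma l2norm_sub_le {f g : ℝ → ℂ} (hf : MemLp f 2 volume) (hg : MemLp g 2 volume) :
    l2norm (f - g) ≤ l2norm f + l2norm g := by
  rw [l2norm_eq_norm_toLp hf, l2norm_eq_norm_toLp hg, l2norm_eq_norm_toLp (hf.sub hg),
    MemLp.toLp_sub]
  exact norm_sub_le _ _

lemma abs_l2norm_sub_le {f g : ℝ → ℂ} (hf : MemLp f 2 volume) (hg : MemLp g 2 volume) :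
    |l2norm f - l2norm g| ≤ l2norm (f - g) := by
  rw [l2norm_eq_norm_toLp hf, l2norm_eq_norm_toLp hg, l2norm_eq_norm_toLp (hf.sub hg),
    MemLp.toLp_sub]
  exact abs_norm_sub_norm_le _ _

lemma l2norm_mono {f g : ℝ → ℂ} (hg : MemLp g 2 volume) {C : ℝ} (hC : 0 ≤ C)
    (h : ∀ᵐ x, ‖f x‖ ≤ C * ‖g x‖) : l2norm f ≤ C * l2norm g := by
  have h1 := eLpNorm_le_mul_eLpNorm_of_ae_le_mul h 2
  have h2 := ENNReal.toReal_mono (ENNReal.mul_ne_top ENNReal.ofReal_ne_top hg.eLpNorm_ne_top) h1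
  rwa [ENNReal.toReal_mul, ENNReal.toReal_ofReal hC] at h2

lemma eq_zero_ae_of_l2norm {f : ℝ → ℂ} (hf : MemLp f 2 volume) (h : l2norm f = 0) :
    f =ᵐ[volume] 0 := by
  rw [l2norm, ENNReal.toReal_eq_zero_iff] at h
  exact (eLpNorm_eq_zero_iff hf.1 (by norm_num)).1 (h.resolve_right hf.eLpNorm_ne_top)

lemma memLp_conj {f : ℝ → ℂ} (hf : MemLp f 2 volume) :
    MemLp (fun x => (starRingEnd ℂ) (f x)) 2 volume :=
  (memLp_congr_norm (Complex.continuous_conj.comp_aestronglyMeasurable hf.1) hf.1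
    (Eventually.of_forall fun x => by simp)).2 hf

lemma l2norm_conj (f : ℝ → ℂ) : l2norm (fun x => (starRingEnd ℂ) (f x)) = l2norm f := by
  rw [l2norm, l2norm, eLpNorm_congr_norm_ae (g := f) (Eventually.of_forall fun x => by simp)]

lemma integral_conj_mul_eq_inner {f g : ℝ → ℂ} (hf : MemLp f 2 volume) (hg : MemLp g 2 volume) :
    ∫ x, (starRingEnd ℂ) (f x) * g x = inner ℂ (hf.toLp f) (hg.toLp g) := by
  rw [L2.inner_def]
  refine integral_congr_ae ?_
  filter_upwards [hf.coeFn_toLp, hg.coeFn_toLp] with x h1 h2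
  rw [h1, h2, RCLike.inner_apply, mul_comm]

lemma norm_integral_mul_le {f g : ℝ → ℂ} (hf : MemLp f 2 volume) (hg : MemLp g 2 volume) :
    ‖∫ x, f x * g x‖ ≤ l2norm f * l2norm g := by
  have h := integral_conj_mul_eq_inner (memLp_conj hf) hg
  simp only [Complex.conj_conj] at h
  rw [h, ← l2norm_conj f, l2norm_eq_norm_toLp (memLp_conj hf), l2norm_eq_norm_toLp hg]
  exact norm_inner_le_norm _ _

lemma integrable_mul_two {f g : ℝ → ℂ} (hf : MemLp f 2 volume) (hg : MemLp g 2 volume) :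
    Integrable (fun x => f x * g x) volume :=
  MemLp.integrable_mul hf hg

lemma integral_norm_mul_le {f g : ℝ → ℂ} (hf : MemLp f 2 volume) (hg : MemLp g 2 volume) :
    ∫ x, ‖f x * g x‖ ≤ l2norm f * l2norm g := by
  have hf' : MemLp (fun x => ((‖f x‖ : ℝ) : ℂ)) 2 volume :=
    (memLp_congr_norm (Complex.continuous_ofReal.comp_aestronglyMeasurable hf.1.norm) hf.1
      (Eventually.of_forall fun x => by simp)).2 hf
  have hg' : MemLp (fun x => ((‖g x‖ : ℝ) : ℂ)) 2 volume :=
    (memLp_congr_norm (Complex.continuous_ofReal.comp_aestronglyMeasurable hg.1.norm) hg.1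
      (Eventually.of_forall fun x => by simp)).2 hg
  have h := norm_integral_mul_le hf' hg'
  have e1 : l2norm (fun x => ((‖f x‖ : ℝ) : ℂ)) = l2norm f := by
    rw [l2norm, l2norm, eLpNorm_congr_norm_ae (g := f) (Eventually.of_forall fun x => by simp)]
  have e2 : l2norm (fun x => ((‖g x‖ : ℝ) : ℂ)) = l2norm g := by
    rw [l2norm, l2norm, eLpNorm_congr_norm_ae (g := g) (Eventually.of_forall fun x => by simp)]
  rw [e1, e2] at h
  refine le_trans (le_of_eq ?_) h
  have : ∀ x, ((‖f x‖ : ℝ) : ℂ) * ((‖g x‖ : ℝ) : ℂ) = ((‖f x * g x‖ : ℝ) : ℂ) := fun x => by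
    simp
  simp_rw [this]
  rw [integral_complex_ofReal, Complex.norm_real, Real.norm_of_nonneg]
  exact integral_nonneg fun x => norm_nonneg _

lemma l2norm_sq {f : ℝ → ℂ} (hf : MemLp f 2 volume) :
    ((l2norm f ^ 2 : ℝ) : ℂ) = ∫ x, (starRingEnd ℂ) (f x) * f x := by
  rw [integral_conj_mul_eq_inner hf hf, inner_self_eq_norm_sq_to_K, ← l2norm_eq_norm_toLp]
  simp

/-! ### Test functions and weak derivatives in `L²` -/

/-- Complex-valued smooth compactly supported functions. -/
structure IsTest (η : ℝ → ℂ) : Prop where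
  smooth : ContDiff ℝ ∞ η
  supp : HasCompactSupport η

namespace IsTest

variable {η θ : ℝ → ℂ}

lemma differentiable (h : IsTest η) : Differentiable ℝ η := h.smooth.differentiable (by simp)

lemma continuous (h : IsTest η) : Continuous η := h.smooth.continuous

lemma deriv (h : IsTest η) : IsTest (deriv η) :=
  ⟨(contDiff_infty_iff_deriv.1 h.smooth).2, h.supp.deriv⟩

lemma add (h : IsTest η) (k : IsTest θ) : IsTest (η + θ) := ⟨h.smooth.add k.smooth, h.supp.add k.supp⟩

lemma const_mul (h : IsTest η) (c : ℂ) : IsTest (fun x => c * η x) :=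
  ⟨contDiff_const.mul h.smooth, h.supp.mul_left⟩

lemma smooth_mul (h : IsTest η) (k : ContDiff ℝ ∞ θ) : IsTest (fun x => η x * θ x) :=
  ⟨h.smooth.mul k, h.supp.mul_right⟩

lemma conj (h : IsTest η) : IsTest (fun x => (starRingEnd ℂ) (η x)) :=
  ⟨Complex.conjCLE.contDiff.comp h.smooth, h.supp.comp_left (g := starRingEnd ℂ) (by simp)⟩

lemma memLp (h : IsTest η) : MemLp η 2 volume := h.continuous.memLp_of_hasCompactSupport h.supp

lemma integrable (h : IsTest η) : Integrable η volume :=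
  h.continuous.integrable_of_hasCompactSupport h.supp

lemma exists_bound (h : IsTest η) : ∃ C, 0 ≤ C ∧ ∀ x, ‖η x‖ ≤ C := by
  obtain ⟨C, hC⟩ := h.supp.exists_bound_of_continuous h.continuous
  exact ⟨C, (norm_nonneg _).trans (hC 0), hC⟩

lemma ofReal {η : ℝ → ℝ} (h : ContDiff ℝ ∞ η) (hs : HasCompactSupport η) :
    IsTest (fun x => (η x : ℂ)) :=
  ⟨Complex.ofRealCLM.contDiff.comp h, hs.comp_left (g := fun y : ℝ => (y : ℂ)) (by simp)⟩

lemma deriv_conj (h : IsTest η) (x : ℝ) :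
    _root_.deriv (fun x => (starRingEnd ℂ) (η x)) x = (starRingEnd ℂ) (_root_.deriv η x) :=
  (Complex.conjCLE.toContinuousLinearMap.hasFDerivAt.comp_hasDerivAt x
    (h.differentiable x).hasDerivAt).deriv

end IsTest

/-- `f` and `g` are in `L²` and `g` is the weak derivative of `f`. -/
structure H1Pair (f g : ℝ → ℂ) : Prop where
  memLp : MemLp f 2 volume
  memLp' : MemLp g 2 volume
  weak : ∀ η, IsTest η → ∫ x, deriv η x * f x = -∫ x, η x * g x

lemma IsTest.integral_deriv_mul {η θ : ℝ → ℂ} (hη : IsTest η) (hθ : ContDiff ℝ ∞ θ) :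
    ∫ x, _root_.deriv η x * θ x = -∫ x, η x * _root_.deriv θ x := by
  have hd : Continuous (_root_.deriv θ) := (contDiff_infty_iff_deriv.1 hθ).2.continuous
  have h := integral_mul_deriv_eq_deriv_mul_of_integrable (u := η) (v := θ) (u' := _root_.deriv η)
    (v' := _root_.deriv θ) (fun x _ => (hη.differentiable x).hasDerivAt)
    (fun x _ => (hθ.differentiable (by simp) x).hasDerivAt)
    ((hη.continuous.mul hd).integrable_of_hasCompactSupport hη.supp.mul_right)
    ((hη.deriv.continuous.mul hθ.continuous).integrable_of_hasCompactSupport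
      hη.deriv.supp.mul_right)
    ((hη.continuous.mul hθ.continuous).integrable_of_hasCompactSupport hη.supp.mul_right)
  rw [h, neg_neg]

lemma IsTest.h1Pair {η : ℝ → ℂ} (h : IsTest η) : H1Pair η (_root_.deriv η) :=
  ⟨h.memLp, h.deriv.memLp, fun _ hθ => hθ.integral_deriv_mul h.smooth⟩

namespace H1Pair

variable {f g f₁ g₁ f₂ g₂ : ℝ → ℂ}

lemma sub (h₁ : H1Pair f₁ g₁) (h₂ : H1Pair f₂ g₂) : H1Pair (f₁ - f₂) (g₁ - g₂) := by
  refine ⟨h₁.memLp.sub h₂.memLp, h₁.memLp'.sub h₂.memLp', fun η hη => ?_⟩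
  simp only [Pi.sub_apply, mul_sub]
  rw [integral_sub (integrable_mul_two hη.deriv.memLp h₁.memLp)
    (integrable_mul_two hη.deriv.memLp h₂.memLp),
    integral_sub (integrable_mul_two hη.memLp h₁.memLp')
    (integrable_mul_two hη.memLp h₂.memLp'), h₁.weak η hη, h₂.weak η hη]
  ring

lemma congr (h : H1Pair f₁ g₁) (hf : f₁ =ᵐ[volume] f₂) (hg : g₁ =ᵐ[volume] g₂) :
    H1Pair f₂ g₂ := by
  refine ⟨(memLp_congr_ae hf).1 h.memLp, (memLp_congr_ae hg).1 h.memLp', fun η hη => ?_⟩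
  have := h.weak η hη
  rwa [integral_congr_ae (g := fun x => deriv η x * f₂ x) (hf.mono fun x hx => by simp only [hx]),
    integral_congr_ae (f := fun x => η x * g₁ x) (g := fun x => η x * g₂ x) (hg.mono fun x hx => by simp only [hx])] at this

lemma const_mul (h : H1Pair f g) (c : ℂ) : H1Pair (fun x => c * f x) (fun x => c * g x) := by
  refine ⟨h.memLp.const_mul c, h.memLp'.const_mul c, fun η hη => ?_⟩
  simp only [mul_left_comm _ c]
  rw [integral_const_mul, integral_const_mul, h.weak η hη, mul_neg]

lemma conj (h : H1Pair f g) :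
    H1Pair (fun x => (starRingEnd ℂ) (f x)) (fun x => (starRingEnd ℂ) (g x)) := by
  refine ⟨memLp_conj h.memLp, memLp_conj h.memLp', fun η hη => ?_⟩
  have := congrArg (starRingEnd ℂ) (h.weak _ hη.conj)
  rw [map_neg, ← integral_conj, ← integral_conj] at this
  simpa only [map_mul, hη.deriv_conj, Complex.conj_conj] using this

lemma test_mul {θ : ℝ → ℂ} (h : H1Pair f g) (hθ : IsTest θ) :
    H1Pair (fun x => θ x * f x) (fun x => deriv θ x * f x + θ x * g x) := by
  obtain ⟨C, hC, hb⟩ := hθ.exists_bound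
  obtain ⟨C', hC', hb'⟩ := hθ.deriv.exists_bound
  have m1 : MemLp (fun x => θ x * f x) 2 volume :=
    h.memLp.of_le_mul (c := C) (hθ.continuous.aestronglyMeasurable.mul h.memLp.1)
      (Eventually.of_forall fun x => by rw [norm_mul]; gcongr; exact hb x)
  have m2 : MemLp (fun x => θ x * g x) 2 volume :=
    h.memLp'.of_le_mul (c := C) (hθ.continuous.aestronglyMeasurable.mul h.memLp'.1)
      (Eventually.of_forall fun x => by rw [norm_mul]; gcongr; exact hb x)
  have m3 : MemLp (fun x => deriv θ x * f x) 2 volume :=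
    h.memLp.of_le_mul (c := C') (hθ.deriv.continuous.aestronglyMeasurable.mul h.memLp.1)
      (Eventually.of_forall fun x => by rw [norm_mul]; gcongr; exact hb' x)
  refine ⟨m1, m3.add m2, fun η hη => ?_⟩
  have hp := h.weak _ (hη.smooth_mul hθ.smooth)
  have e : ∀ x, deriv (fun x => η x * θ x) x = deriv η x * θ x + η x * deriv θ x := fun x =>
    deriv_fun_mul (hη.differentiable x) (hθ.differentiable x)
  simp only [e, add_mul, mul_assoc] at hp
  rw [integral_add (integrable_mul_two hη.deriv.memLp m1) (integrable_mul_two hη.memLp m3)] at hp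
  simp only [mul_add]
  rw [integral_add (integrable_mul_two hη.memLp m3) (integrable_mul_two hη.memLp m2)]
  linear_combination hp

end H1Pair

/-! ### Density of test functions -/

/-- Solving the equation `η' + η = ζ`, adjoint to `c' = c`, with integrating factor `eˣ` and
starting to the left of the support of `ζ`. The solution need not have compact support: to the right
a multiple of `e^{-x}` remains. -/
lemma exists_test_deriv_add_eq {ζ : ℝ → ℂ} (hζ : IsTest ζ) :
    ∃ η : ℝ → ℂ, ContDiff ℝ ∞ η ∧ (∀ x, deriv η x + η x = ζ x) ∧
      ∃ a b : ℝ, ∃ c : ℂ, 0 ≤ b ∧ (∀ x ≤ a, η x = 0) ∧ (∀ x, b ≤ x → η x = c * Complex.exp (-x)) := by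
  obtain ⟨R, hR⟩ := hζ.supp.isBounded.subset_closedBall 0
  have hout : ∀ x, R < |x| → ζ x = 0 := fun x hx => by
    by_contra h
    have := hR (subset_tsupport _ h)
    rw [mem_closedBall_zero_iff, Real.norm_eq_abs] at this
    linarith
  set h : ℝ → ℂ := fun y => Complex.exp y * ζ y with hh
  have hexp : ContDiff ℝ ∞ (fun y : ℝ => Complex.exp y) :=
    Complex.contDiff_exp.comp Complex.ofRealCLM.contDiff
  have hexp' : ContDiff ℝ ∞ (fun y : ℝ => Complex.exp (-y)) :=
    Complex.contDiff_exp.comp Complex.ofRealCLM.contDiff.neg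
  have hsm : ContDiff ℝ ∞ h := hexp.mul hζ.smooth
  set H : ℝ → ℂ := fun x => ∫ y in (-|R| - 1)..x, h y with hH
  have hHd : ∀ x, HasDerivAt H (h x) x := fun x =>
    hsm.continuous.integral_hasStrictDerivAt _ x |>.hasDerivAt
  have hHsm : ContDiff ℝ ∞ H := by
    rw [contDiff_infty_iff_deriv]
    refine ⟨fun x => (hHd x).differentiableAt, ?_⟩
    have : deriv H = h := funext fun x => (hHd x).deriv
    rwa [this]
  have hRR := le_abs_self R
  refine ⟨fun x => Complex.exp (-x) * H x, hexp'.mul hHsm, fun x => ?_, -|R| - 1, |R| + 1,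
    H (|R| + 1), by positivity, fun x hx => ?_, fun x hx => ?_⟩
  · have h1 : HasDerivAt (fun y : ℝ => Complex.exp (-y)) (-Complex.exp (-x)) x := by
      have := ((Complex.ofRealCLM.hasDerivAt (x := x)).neg).cexp
      simpa using this
    have h2 : deriv (fun x : ℝ => Complex.exp (-x) * H x) x = _ := (h1.mul (hHd x)).deriv
    rw [h2, hh]
    have : Complex.exp (-(x : ℂ)) * Complex.exp x = 1 := by rw [← Complex.exp_add]; simp
    simp only
    linear_combination ζ x * this
  · have : H x = 0 := by
      rw [hH]
      simp only
      rw [intervalIntegral.integral_congr (g := fun _ => (0 : ℂ)), intervalIntegral.integral_zero]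
      intro y hy
      rw [uIcc_of_ge hx] at hy
      simp only [hh]
      rw [hout y, mul_zero]
      rw [abs_of_nonpos (by linarith [hy.2, abs_nonneg R])]
      linarith [hy.2]
    simp [this]
  · have : H x = H (|R| + 1) := by
      have hi : ∀ a b, IntervalIntegrable h volume a b := fun a b =>
        hsm.continuous.intervalIntegrable a b
      rw [hH]
      simp only
      rw [← intervalIntegral.integral_add_adjacent_intervals (hi _ (|R| + 1)) (hi _ x)]
      rw [add_eq_left, intervalIntegral.integral_congr (g := fun _ => (0 : ℂ)),
        intervalIntegral.integral_zero]
      intro y hy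
      rw [uIcc_of_le hx] at hy
      simp only [hh]
      rw [hout y, mul_zero]
      rw [abs_of_nonneg (by linarith [hy.1, abs_nonneg R])]
      linarith [hy.1]
    simp only [this, mul_comm]

end

noncomputable section

lemma integrable_inv_one_add_sq' (C : ℝ) : Integrable (fun x : ℝ => C / (1 + x ^ 2)) volume := by
  simpa [div_eq_mul_inv] using integrable_inv_one_add_sq.const_mul C

section Decay

variable {E : Type*} [NormedAddCommGroup E] {f : ℝ → E} {C : ℝ}

lemma memLp_two_of_decay (hf : AEStronglyMeasurable f volume)
    (h : ∀ x, ‖f x‖ ≤ C / (1 + x ^ 2)) : MemLp f 2 volume := by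
  have hC : 0 ≤ C := by have := (norm_nonneg _).trans (h 0); simpa using this
  rw [memLp_two_iff_integrable_sq_norm hf]
  refine ((integrable_inv_one_add_sq' C).const_mul C).mono' (hf.norm.pow 2)
    (Eventually.of_forall fun x => ?_)
  rw [Real.norm_of_nonneg (by positivity), sq]
  refine mul_le_mul ((h x).trans ?_) (h x) (norm_nonneg _) hC
  exact div_le_self hC (by nlinarith [sq_nonneg x])

end Decay

lemma exists_decay_bound {η : ℝ → ℂ} (hη : Continuous η) {a b : ℝ} {c : ℂ} (hb : 0 ≤ b)
    (h1 : ∀ x ≤ a, η x = 0) (h2 : ∀ x, b ≤ x → η x = c * Complex.exp (-x)) :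
    ∃ C, ∀ x, ‖η x‖ ≤ C / (1 + x ^ 2) := by
  have hc : Continuous fun x : ℝ => (((1 + x ^ 2 : ℝ)) : ℂ) * η x := by fun_prop
  obtain ⟨B, hB⟩ := (isCompact_Icc (a := a) (b := b)).exists_bound_of_continuousOn hc.continuousOn
  refine ⟨max (max B 0) (2 * ‖c‖), fun x => ?_⟩
  rw [le_div_iff₀ (by positivity), mul_comm]
  have e : (1 + x ^ 2) * ‖η x‖ = ‖(((1 + x ^ 2 : ℝ)) : ℂ) * η x‖ := by
    rw [norm_mul, Complex.norm_real, Real.norm_of_nonneg (by positivity)]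
  rcases le_total x a with hx | hx
  · rw [h1 x hx]; simp
  rcases le_total x b with hx' | hx'
  · rw [e]; exact (hB x ⟨hx, hx'⟩).trans ((le_max_left _ _).trans (le_max_left _ _))
  · refine le_trans ?_ (le_max_right _ _)
    rw [h2 x hx', norm_mul, Complex.norm_exp]
    have hx0 : 0 ≤ x := hb.trans hx'
    have hq := Real.quadratic_le_exp_of_nonneg hx0
    have : (1 + x ^ 2) * Real.exp (-x) ≤ 2 := by
      rw [Real.exp_neg, ← div_eq_mul_inv, div_le_iff₀ (Real.exp_pos x)]
      nlinarith
    have e2 : (-(x : ℂ)).re = -x := by simp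
    rw [e2]
    nlinarith [norm_nonneg c]

lemma ae_eq_zero_of_test {c : ℝ → ℂ} (hc : MemLp c 2 volume)
    (h : ∀ η, IsTest η → ∫ x, η x * c x = 0) : c =ᵐ[volume] 0 := by
  refine ae_eq_zero_of_integral_contDiff_smul_eq_zero (hc.locallyIntegrable (by norm_num))
    fun g hg hs => ?_
  simpa using h _ (IsTest.ofReal hg hs)

/-- A square integrable function that is its own weak derivative vanishes. -/
lemma ae_eq_zero_of_weak_deriv_self {c : ℝ → ℂ} (hc : MemLp c 2 volume)
    (h : ∀ η, IsTest η → ∫ x, deriv η x * c x = -∫ x, η x * c x) : c =ᵐ[volume] 0 := by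
  refine ae_eq_zero_of_test hc fun ζ hζ => ?_
  obtain ⟨η, hη, hode, a, b, k, hb, h1, h2⟩ := exists_test_deriv_add_eq hζ
  obtain ⟨C, hC⟩ := exists_decay_bound hη.continuous hb h1 h2
  have hηL : MemLp η 2 volume := memLp_two_of_decay hη.continuous.aestronglyMeasurable hC
  -- The cutoff `S (n - x)` equals `1` for `x ≤ n - 1` and `0` for `x ≥ n`; it removes the
  -- exponential tail of `η`, which already vanishes far to the left.
  set S : ℝ → ℂ := fun x => ((Real.smoothTransition x : ℝ) : ℂ) with hS
  have hSs : ContDiff ℝ ∞ S := Complex.ofRealCLM.contDiff.comp Real.smoothTransition.contDiff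
  have hS1 : ∀ x, 1 ≤ x → S x = 1 := fun x hx => by
    simp [hS, Real.smoothTransition.one_of_one_le hx]
  have hS0 : ∀ x, x ≤ 0 → S x = 0 := fun x hx => by
    simp [hS, Real.smoothTransition.zero_of_nonpos hx]
  have hSb : ∀ x, ‖S x‖ ≤ 1 := fun x => by
    simp only [hS, Complex.norm_real]
    rw [Real.norm_of_nonneg (Real.smoothTransition.nonneg x)]
    exact Real.smoothTransition.le_one x
  have hS'c : Continuous (deriv S) := (contDiff_infty_iff_deriv.1 hSs).2.continuous
  obtain ⟨B, hB⟩ := (isCompact_Icc (a := (0 : ℝ)) (b := 1)).exists_bound_of_continuousOn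
    hS'c.continuousOn
  have hS'1 : ∀ x, 1 < x → deriv S x = 0 := fun x hx => by
    have : S =ᶠ[𝓝 x] fun _ => 1 := by
      filter_upwards [lt_mem_nhds hx] with y hy using hS1 y hy.le
    rw [this.deriv_eq]; simp
  have hS'0 : ∀ x, x < 0 → deriv S x = 0 := fun x hx => by
    have : S =ᶠ[𝓝 x] fun _ => 0 := by
      filter_upwards [gt_mem_nhds hx] with y hy using hS0 y hy.le
    rw [this.deriv_eq]; simp
  have hBb : ∀ x, ‖deriv S x‖ ≤ max B 0 := fun x => by
    rcases lt_or_ge x 0 with hx | hx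
    · rw [hS'0 x hx]; simp
    rcases lt_or_ge 1 x with hx' | hx'
    · rw [hS'1 x hx']; simp
    · exact (hB x ⟨hx, hx'⟩).trans (le_max_left _ _)
  have hχs : ∀ n : ℕ, ContDiff ℝ ∞ fun x : ℝ => S (n - x) := fun n =>
    hSs.comp (contDiff_const.sub contDiff_id)
  have hχd : ∀ (n : ℕ) (x : ℝ), HasDerivAt (fun x : ℝ => S (n - x)) (-deriv S (n - x)) x :=
    fun n x => by
      have := (hSs.differentiable (by simp) (n - x)).hasDerivAt.scomp x
        ((hasDerivAt_id x).const_sub (n : ℝ))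
      simpa [Function.comp_def] using this
  have hT : ∀ n : ℕ, IsTest fun x => S (n - x) * η x := fun n => by
    refine ⟨(hχs n).mul hη, HasCompactSupport.intro (isCompact_Icc (a := a) (b := n)) ?_⟩
    intro x hx
    simp only [mem_Icc, not_and_or, not_le] at hx
    rcases hx with hx | hx
    · rw [h1 x hx.le, mul_zero]
    · rw [hS0 _ (by linarith), zero_mul]
  -- The hypothesis for the truncated `η`, simplified by `η' + η = ζ`. The error term carries `S' (n
  -- - x)`, which is zero at each fixed `x` once `n > x + 1`, so it disappears in the limit.
  have key : ∀ n : ℕ, ∫ x, (S (n - x) * ζ x * c x - deriv S (n - x) * η x * c x) = 0 := fun n => by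
    have h3 := h _ (hT n)
    have e : ∀ x, deriv (fun x : ℝ => S (n - x) * η x) x
        = -deriv S (n - x) * η x + S (n - x) * deriv η x := fun x =>
      ((hχd n x).mul (hη.differentiable (by simp) x).hasDerivAt).deriv
    have h4 : ∫ x, (deriv (fun x : ℝ => S (n - x) * η x) x * c x + S (n - x) * η x * c x) = 0 := by
      rw [integral_add (integrable_mul_two (hT n).deriv.memLp hc)
        (integrable_mul_two (hT n).memLp hc), h3]
      ring
    rw [← h4]
    refine integral_congr_ae (Eventually.of_forall fun x => ?_)
    simp only [e, ← hode x]
    ring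
  have lim : Tendsto (fun n : ℕ => ∫ x, (S (n - x) * ζ x * c x - deriv S (n - x) * η x * c x))
      atTop (𝓝 (∫ x, ζ x * c x)) := by
    refine tendsto_integral_of_dominated_convergence
      (fun x => ‖ζ x * c x‖ + max B 0 * ‖η x * c x‖) (fun n => ?_) ?_ (fun n => ?_) ?_
    · have c1 : Continuous fun x : ℝ => S (n - x) * ζ x :=
        (hχs n).continuous.mul hζ.continuous
      have c2 : Continuous fun x : ℝ => deriv S (n - x) * η x :=
        (hS'c.comp (continuous_const.sub continuous_id)).mul hη.continuous
      exact (c1.aestronglyMeasurable.mul hc.1).sub (c2.aestronglyMeasurable.mul hc.1)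
    · exact (integrable_mul_two hζ.memLp hc).norm.add
        ((integrable_mul_two hηL hc).norm.const_mul _)
    · refine Eventually.of_forall fun x => (norm_sub_le _ _).trans (add_le_add ?_ ?_)
      · rw [mul_assoc, norm_mul]
        exact mul_le_of_le_one_left (norm_nonneg _) (hSb _)
      · rw [mul_assoc, norm_mul]
        gcongr
        exact hBb _
    · refine Eventually.of_forall fun x => tendsto_const_nhds.congr' ?_
      obtain ⟨N, hN⟩ := exists_nat_gt (x + 1)
      filter_upwards [eventually_ge_atTop N] with n hn
      have : (N : ℝ) ≤ n := by exact_mod_cast hn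
      rw [hS1 _ (by linarith), hS'1 _ (by linarith)]
      ring
  simp only [key] at lim
  exact (tendsto_nhds_unique lim tendsto_const_nhds)

/-- The reflection `x ↦ -x` exchanges the equations `c' = -c` and `c' = c`. -/
lemma ae_eq_zero_of_weak_deriv_neg_self {c : ℝ → ℂ} (hc : MemLp c 2 volume)
    (h : ∀ η, IsTest η → ∫ x, deriv η x * c x = ∫ x, η x * c x) : c =ᵐ[volume] 0 := by
  have mp : MeasurePreserving (fun x : ℝ => -x) volume volume := Measure.measurePreserving_neg volume
  have hc' : MemLp (fun x => c (-x)) 2 volume := hc.comp_measurePreserving mp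
  have key : (fun x => c (-x)) =ᵐ[volume] 0 := by
    refine ae_eq_zero_of_weak_deriv_self hc' fun η hη => ?_
    have hη' : IsTest fun x => η (-x) :=
      ⟨hη.smooth.comp contDiff_neg, hη.supp.comp_homeomorph (Homeomorph.neg ℝ)⟩
    have e : ∀ x, deriv (fun x => η (-x)) x = -deriv η (-x) := fun x => deriv_comp_neg η x
    have := h _ hη'
    simp only [e] at this
    rw [← integral_neg_eq_self (fun x => deriv η x * c (-x)),
      ← integral_neg_eq_self (fun x => η x * c (-x))]
    simp only [neg_neg]
    rw [← this, ← integral_neg]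
    simp
  have := mp.quasiMeasurePreserving.ae_eq_comp key
  simp only [Function.comp_def, neg_neg] at this
  exact this

end

noncomputable section

/-- The test functions as a subspace of `L² × L²`, through `η ↦ (η, η')`. -/
def testGraph : Submodule ℂ (WithLp 2 (Lp ℂ 2 (volume : Measure ℝ) × Lp ℂ 2 (volume : Measure ℝ))) where
  carrier := {v | ∃ (η : ℝ → ℂ) (h : IsTest η),
    v = WithLp.toLp 2 (h.memLp.toLp η, h.deriv.memLp.toLp (deriv η))}
  add_mem' := by
    rintro _ _ ⟨η, h, rfl⟩ ⟨θ, k, rfl⟩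
    refine ⟨η + θ, h.add k, ?_⟩
    rw [← WithLp.toLp_add, Prod.mk_add_mk, ← MemLp.toLp_add, ← MemLp.toLp_add]
    congr 3
    funext x
    exact (deriv_add (h.differentiable x) (k.differentiable x)).symm
  zero_mem' := by
    refine ⟨0, ⟨contDiff_const, HasCompactSupport.zero⟩, ?_⟩
    have : deriv (0 : ℝ → ℂ) = 0 := by funext x; exact deriv_const x (0 : ℂ)
    simp only [this, MemLp.toLp_zero]
    rfl
  smul_mem' := by
    rintro c _ ⟨η, h, rfl⟩
    refine ⟨fun x => c * η x, h.const_mul c, ?_⟩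
    rw [← WithLp.toLp_smul, Prod.smul_mk, ← MemLp.toLp_const_smul, ← MemLp.toLp_const_smul]
    congr 3
    funext x
    exact (deriv_const_mul c (h.differentiable x)).symm

/-- Orthogonality to the graph says that `a` is the weak derivative of `b`. The inner product
conjugates its first argument, so the graph point of the conjugate of `η` is used. -/
lemma mem_testGraph_orthogonal {a b : Lp ℂ 2 (volume : Measure ℝ)}
    (h : WithLp.toLp 2 (a, b) ∈ testGraphᗮ) (η : ℝ → ℂ) (hη : IsTest η) :
    (∫ x, η x * a x) + ∫ x, deriv η x * b x = 0 := by
  have h1 := (Submodule.mem_orthogonal _ _).1 h _ ⟨_, hη.conj, rfl⟩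
  rw [WithLp.prod_inner_apply] at h1
  have ha := Lp.memLp a
  have hb := Lp.memLp b
  have e1 := integral_conj_mul_eq_inner hη.conj.memLp ha
  have e2 := integral_conj_mul_eq_inner hη.conj.deriv.memLp hb
  simp only [Lp.toLp_coeFn, Complex.conj_conj, hη.deriv_conj] at e1 e2
  rw [e1, e2]
  exact h1

namespace H1Pair

variable {f g : ℝ → ℂ}

/-- Test functions are dense in `H¹`. -/
lemma mem_closure (h : H1Pair f g) :
    WithLp.toLp 2 (h.memLp.toLp f, h.memLp'.toLp g) ∈ testGraph.topologicalClosure := by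
  set K := testGraph.topologicalClosure with hK
  set v := WithLp.toLp 2 (h.memLp.toLp f, h.memLp'.toLp g) with hv
  have : CompleteSpace K := testGraph.isClosed_topologicalClosure.completeSpace_coe
  -- That the second entry is the weak derivative of the first is, for each `η`, a closed linear
  -- condition; it therefore passes from test functions to the closure.
  have hw : ∀ u ∈ K, ∀ η, IsTest η →
      (∫ x, deriv η x * u.fst x) + ∫ x, η x * u.snd x = 0 := by
    intro u hu η hη
    have key : ∀ u : WithLp 2 (Lp ℂ 2 (volume : Measure ℝ) × Lp ℂ 2 (volume : Measure ℝ)),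
        (∫ x, deriv η x * u.fst x) + ∫ x, η x * u.snd x
        = inner ℂ (WithLp.toLp 2 (hη.conj.deriv.memLp.toLp _, hη.conj.memLp.toLp _)) u := by
      intro u
      have e1 := integral_conj_mul_eq_inner hη.conj.deriv.memLp (Lp.memLp u.fst)
      have e2 := integral_conj_mul_eq_inner hη.conj.memLp (Lp.memLp u.snd)
      simp only [Lp.toLp_coeFn, Complex.conj_conj, hη.deriv_conj] at e1 e2
      rw [WithLp.prod_inner_apply, e1, e2]
      rfl
    have hcl : IsClosed {u : WithLp 2 (Lp ℂ 2 (volume : Measure ℝ) × Lp ℂ 2 (volume : Measure ℝ)) |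
        inner ℂ (WithLp.toLp 2 (hη.conj.deriv.memLp.toLp _, hη.conj.memLp.toLp _)) u = 0} :=
      isClosed_eq (by fun_prop) continuous_const
    rw [key]
    refine closure_minimal ?_ hcl hu
    rintro _ ⟨θ, hθ, rfl⟩
    rw [Set.mem_ofPred_eq, ← key]
    have e1 : ∫ x, deriv η x * (hθ.memLp.toLp θ) x = ∫ x, deriv η x * θ x :=
      integral_congr_ae (hθ.memLp.coeFn_toLp.mono fun x hx => by simp only [hx])
    have e2 : ∫ x, η x * (hθ.deriv.memLp.toLp (deriv θ)) x = ∫ x, η x * deriv θ x :=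
      integral_congr_ae (hθ.deriv.memLp.coeFn_toLp.mono fun x hx => by simp only [hx])
    change (∫ x, deriv η x * (hθ.memLp.toLp θ) x) + ∫ x, η x * (hθ.deriv.memLp.toLp (deriv θ)) x = 0
    rw [e1, e2, hη.integral_deriv_mul hθ.smooth]
    ring
  set w := v - K.starProjection v with hwdef
  have hwo : w ∈ testGraphᗮ := by
    have : w ∈ Kᗮ := Submodule.sub_starProjection_mem_orthogonal v
    exact Submodule.orthogonal_le testGraph.le_topologicalClosure this
  have hww : ∀ η, IsTest η → (∫ x, deriv η x * w.fst x) + ∫ x, η x * w.snd x = 0 := by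
    intro η hη
    have h1 := hw _ (K.starProjection_apply_mem v) η hη
    have h2 := h.weak η hη
    set p := K.starProjection v
    have e1 : ∫ x, deriv η x * w.fst x = (∫ x, deriv η x * f x) - ∫ x, deriv η x * p.fst x := by
      rw [← integral_sub (integrable_mul_two hη.deriv.memLp h.memLp)
        (integrable_mul_two hη.deriv.memLp (Lp.memLp p.fst))]
      refine integral_congr_ae ?_
      filter_upwards [Lp.coeFn_sub (h.memLp.toLp f) p.fst, h.memLp.coeFn_toLp] with x h3 h4
      change deriv η x * (h.memLp.toLp f - p.fst : Lp ℂ 2 volume) x = _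
      rw [h3, Pi.sub_apply, h4, mul_sub]
    have e2 : ∫ x, η x * w.snd x = (∫ x, η x * g x) - ∫ x, η x * p.snd x := by
      rw [← integral_sub (integrable_mul_two hη.memLp h.memLp')
        (integrable_mul_two hη.memLp (Lp.memLp p.snd))]
      refine integral_congr_ae ?_
      filter_upwards [Lp.coeFn_sub (h.memLp'.toLp g) p.snd, h.memLp'.coeFn_toLp] with x h3 h4
      change η x * (h.memLp'.toLp g - p.snd : Lp ℂ 2 volume) x = _
      rw [h3, Pi.sub_apply, h4, mul_sub]
    rw [e1, e2]
    linear_combination h2 - h1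
  -- The part `w = (a, b)` of `v` orthogonal to the closure satisfies `a' = b` because it is a
  -- difference of weak pairs, and `b' = a` by orthogonality. So `a + b` is its own derivative and
  -- `a - b` is minus its own derivative; neither can be a nonzero `L²` function.
  have hwz : w = 0 := by
    have ho : ∀ η, IsTest η → (∫ x, η x * w.fst x) + ∫ x, deriv η x * w.snd x = 0 :=
      fun η hη => mem_testGraph_orthogonal hwo η hη
    have ma := Lp.memLp w.fst
    have mb := Lp.memLp w.snd
    have s1 : (fun x => w.fst x + w.snd x) =ᵐ[volume] 0 := by
      refine ae_eq_zero_of_weak_deriv_self (ma.add mb) fun η hη => ?_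
      simp only [mul_add]
      rw [integral_add (integrable_mul_two hη.deriv.memLp ma)
        (integrable_mul_two hη.deriv.memLp mb), integral_add (integrable_mul_two hη.memLp ma)
        (integrable_mul_two hη.memLp mb)]
      linear_combination hww η hη + ho η hη
    have s2 : (fun x => w.fst x - w.snd x) =ᵐ[volume] 0 := by
      refine ae_eq_zero_of_weak_deriv_neg_self (ma.sub mb) fun η hη => ?_
      simp only [mul_sub]
      rw [integral_sub (integrable_mul_two hη.deriv.memLp ma)
        (integrable_mul_two hη.deriv.memLp mb), integral_sub (integrable_mul_two hη.memLp ma)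
        (integrable_mul_two hη.memLp mb)]
      linear_combination hww η hη - ho η hη
    have z1 : w.fst = 0 := by
      rw [Lp.eq_zero_iff_ae_eq_zero]
      filter_upwards [s1, s2] with x h1 h2
      simp only [Pi.zero_apply] at *
      linear_combination (h1 + h2) / 2
    have z2 : w.snd = 0 := by
      rw [Lp.eq_zero_iff_ae_eq_zero]
      filter_upwards [s1, s2] with x h1 h2
      simp only [Pi.zero_apply] at *
      linear_combination (h1 - h2) / 2
    exact (WithLp.ofLp_injective 2) (Prod.ext z1 z2)
  have : v = K.starProjection v := by rwa [hwdef, sub_eq_zero] at hwz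
  rw [this]
  exact K.starProjection_apply_mem v

/-- Approximation of an `H¹` function by test functions, in `H¹` and almost everywhere. -/
lemma exists_seq (h : H1Pair f g) : ∃ ψ : ℕ → ℝ → ℂ, (∀ n, IsTest (ψ n)) ∧
    Tendsto (fun n => l2norm (ψ n - f)) atTop (𝓝 0) ∧
    Tendsto (fun n => l2norm (deriv (ψ n) - g)) atTop (𝓝 0) ∧
    ∀ᵐ x, Tendsto (fun n => ψ n x) atTop (𝓝 (f x)) := by
  obtain ⟨u, hu, hlim⟩ := mem_closure_iff_seq_limit.1 h.mem_closure
  choose ψ hψ hu' using hu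
  have hl := tendsto_iff_norm_sub_tendsto_zero.1 hlim
  have l1 : Tendsto (fun n => l2norm (ψ n - f)) atTop (𝓝 0) := by
    refine squeeze_zero (fun n => l2norm_nonneg _) (fun n => ?_) hl
    rw [l2norm_eq_norm_toLp ((hψ n).memLp.sub h.memLp), MemLp.toLp_sub (hψ n).memLp h.memLp]
    have := WithLp.norm_fst_le _ (u n - WithLp.toLp 2 (h.memLp.toLp f, h.memLp'.toLp g))
    rwa [hu' n] at this ⊢
  have l2 : Tendsto (fun n => l2norm (deriv (ψ n) - g)) atTop (𝓝 0) := by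
    refine squeeze_zero (fun n => l2norm_nonneg _) (fun n => ?_) hl
    rw [l2norm_eq_norm_toLp ((hψ n).deriv.memLp.sub h.memLp'),
      MemLp.toLp_sub (hψ n).deriv.memLp h.memLp']
    have := WithLp.norm_snd_le _ (u n - WithLp.toLp 2 (h.memLp.toLp f, h.memLp'.toLp g))
    rwa [hu' n] at this ⊢
  have l3 : TendstoInMeasure volume ψ atTop f := by
    refine tendstoInMeasure_of_tendsto_eLpNorm (p := 2) (by norm_num)
      (fun n => (hψ n).memLp.1) h.memLp.1 ?_
    rw [← ENNReal.tendsto_toReal_zero_iff fun n => ((hψ n).memLp.sub h.memLp).eLpNorm_ne_top]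
    exact l1
  obtain ⟨ns, hns, hae⟩ := l3.exists_seq_tendsto_ae
  exact ⟨fun n => ψ (ns n), fun n => hψ _, l1.comp hns.tendsto_atTop, l2.comp hns.tendsto_atTop, hae⟩

end H1Pair

/-! ### The one-dimensional Sobolev inequality -/

lemma tendsto_l2norm {ψ : ℕ → ℝ → ℂ} {f : ℝ → ℂ} (hψ : ∀ n, MemLp (ψ n) 2 volume)
    (hf : MemLp f 2 volume) (h : Tendsto (fun n => l2norm (ψ n - f)) atTop (𝓝 0)) :
    Tendsto (fun n => l2norm (ψ n)) atTop (𝓝 (l2norm f)) := by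
  rw [tendsto_iff_norm_sub_tendsto_zero]
  exact squeeze_zero (fun _ => norm_nonneg _) (fun n => abs_l2norm_sub_le (hψ n) hf) h

/-- The one-dimensional Sobolev inequality for test functions. -/
lemma IsTest.norm_sq_le {η : ℝ → ℂ} (h : IsTest η) (x : ℝ) :
    ‖η x‖ ^ 2 ≤ 2 * (l2norm η * l2norm (_root_.deriv η)) := by
  have hm : IsTest fun y => (starRingEnd ℂ) (η y) * η y := h.conj.smooth_mul h.smooth
  have hd : ∀ y, _root_.deriv (fun y => (starRingEnd ℂ) (η y) * η y) y
      = (starRingEnd ℂ) (_root_.deriv η y) * η y + (starRingEnd ℂ) (η y) * _root_.deriv η y :=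
    fun y => by
      rw [deriv_fun_mul (h.conj.differentiable y) (h.differentiable y), h.deriv_conj]
  have e := integral_Iic_of_hasDerivAt_of_tendsto' (a := x) (m := 0)
    (f := fun y => (starRingEnd ℂ) (η y) * η y)
    (fun y _ => (hm.differentiable y).hasDerivAt) hm.deriv.integrable.integrableOn
    (hm.supp.is_zero_at_infty.mono_left atBot_le_cocompact)
  rw [sub_zero] at e
  have e2 : ‖η x‖ ^ 2 = ‖(starRingEnd ℂ) (η x) * η x‖ := by simp [sq]
  rw [e2, ← e]
  have i1 := (integrable_mul_two h.deriv.conj.memLp h.memLp)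
  have i2 := (integrable_mul_two h.conj.memLp h.deriv.memLp)
  calc _ ≤ ∫ y in Iic x, ‖_root_.deriv (fun y => (starRingEnd ℂ) (η y) * η y) y‖ :=
        norm_integral_le_integral_norm _
    _ ≤ ∫ y, ‖_root_.deriv (fun y => (starRingEnd ℂ) (η y) * η y) y‖ :=
        setIntegral_le_integral hm.deriv.integrable.norm
          (Eventually.of_forall fun _ => norm_nonneg _)
    _ ≤ ∫ y, (‖(starRingEnd ℂ) (_root_.deriv η y) * η y‖
          + ‖(starRingEnd ℂ) (η y) * _root_.deriv η y‖) := by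
        refine integral_mono hm.deriv.integrable.norm (i1.norm.add i2.norm) fun y => ?_
        simp only [hd]
        exact norm_add_le _ _
    _ ≤ _ := by
        rw [integral_add i1.norm i2.norm]
        have j1 := integral_norm_mul_le h.deriv.conj.memLp h.memLp
        have j2 := integral_norm_mul_le h.conj.memLp h.deriv.memLp
        rw [l2norm_conj] at j1 j2
        linarith

namespace H1Pair

variable {f g : ℝ → ℂ}

/-- The one-dimensional Sobolev inequality. -/
lemma norm_sq_le (h : H1Pair f g) : ∀ᵐ x, ‖f x‖ ^ 2 ≤ 2 * (l2norm f * l2norm g) := by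
  obtain ⟨ψ, hψ, l1, l2, l3⟩ := h.exists_seq
  have t1 := tendsto_l2norm (fun n => (hψ n).memLp) h.memLp l1
  have t2 := tendsto_l2norm (fun n => (hψ n).deriv.memLp) h.memLp' l2
  filter_upwards [l3] with x hx
  exact le_of_tendsto_of_tendsto' (hx.norm.pow 2) ((t1.mul t2).const_mul 2)
    fun n => (hψ n).norm_sq_le x

lemma norm_le (h : H1Pair f g) : ∀ᵐ x, ‖f x‖ ≤ l2norm f + l2norm g := by
  filter_upwards [h.norm_sq_le] with x hx
  have := l2norm_nonneg f
  have := l2norm_nonneg g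
  refine abs_le_of_sq_le_sq' ?_ (by positivity) |>.2
  nlinarith [sq_nonneg (l2norm f), sq_nonneg (l2norm g)]

/-- The product form of the Sobolev inequality is essential: its right-hand side vanishes with the
derivative alone. -/
lemma ae_eq_zero_of_deriv (h : H1Pair f g) (hg : g =ᵐ[volume] 0) : f =ᵐ[volume] 0 := by
  filter_upwards [h.norm_sq_le] with x hx
  have : l2norm g = 0 := by rw [l2norm_congr hg]; simp [l2norm]
  rw [this, mul_zero, mul_zero] at hx
  simpa using le_antisymm hx (by positivity)

end H1Pair

end

/-! ### Exponentials of `H¹` functions and of `H¹` curves -/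

noncomputable section

lemma norm_exp_sub_one_le_mul (z : ℂ) : ‖Complex.exp z - 1‖ ≤ ‖z‖ * Real.exp ‖z‖ := by
  simpa using Complex.norm_exp_sub_sum_le_norm_mul_exp z 1

lemma norm_exp_sub_one_sub_le_mul (z : ℂ) :
    ‖Complex.exp z - 1 - z‖ ≤ ‖z‖ ^ 2 * Real.exp ‖z‖ := by
  have := Complex.norm_exp_sub_sum_le_norm_mul_exp z 2
  simpa [Finset.sum_range_succ, sub_sub] using this

lemma norm_exp_mul_le {l z : ℂ} {M : ℝ} (h : ‖z‖ ≤ M) :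
    ‖Complex.exp (l * z)‖ ≤ Real.exp (‖l‖ * M) := by
  rw [Complex.norm_exp]
  refine Real.exp_le_exp.2 ((Complex.re_le_norm _).trans ?_)
  rw [norm_mul]
  gcongr

lemma integrable_mul_of_ae_bound {f g : ℝ → ℂ} {C : ℝ} (hf : AEStronglyMeasurable f volume)
    (hb : ∀ᵐ x, ‖f x‖ ≤ C) (hg : Integrable g volume) :
    Integrable (fun x => f x * g x) volume :=
  hg.bdd_mul hf hb

lemma norm_integral_mul_le_of_bound {f g : ℝ → ℂ} {C : ℝ}
    (hb : ∀ᵐ x, ‖f x‖ ≤ C) (hg : Integrable g volume) :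
    ‖∫ x, f x * g x‖ ≤ C * ∫ x, ‖g x‖ := by
  rw [← integral_const_mul]
  refine norm_integral_le_of_norm_le (hg.norm.const_mul C) ?_
  filter_upwards [hb] with x hx
  rw [norm_mul]
  gcongr

lemma memLp_mul_of_ae_bound {f g : ℝ → ℂ} {C : ℝ} (hf : AEStronglyMeasurable f volume)
    (hb : ∀ᵐ x, ‖f x‖ ≤ C) (hg : MemLp g 2 volume) : MemLp (fun x => f x * g x) 2 volume :=
  hg.of_le_mul (c := C) (hf.mul hg.1) (hb.mono fun x hx => by rw [norm_mul]; gcongr)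

namespace H1Pair

variable {f g f₁ g₁ f₂ g₂ : ℝ → ℂ}

lemma add (h₁ : H1Pair f₁ g₁) (h₂ : H1Pair f₂ g₂) : H1Pair (f₁ + f₂) (g₁ + g₂) := by
  have := h₁.sub (h₂.const_mul (-1))
  refine this.congr ?_ ?_ <;> refine Eventually.of_forall fun x => ?_ <;> simp

/-- The chain rule for the exponential of an `H¹` function. -/
lemma exp_sub_one (h : H1Pair f g) (l : ℂ) :
    H1Pair (fun x => Complex.exp (l * f x) - 1) (fun x => l * Complex.exp (l * f x) * g x) := by
  set M := l2norm f + l2norm g with hM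
  have hfb : ∀ᵐ x, ‖f x‖ ≤ M := h.norm_le
  have hmE : AEStronglyMeasurable (fun x => Complex.exp (l * f x)) volume :=
    Complex.continuous_exp.comp_aestronglyMeasurable (h.memLp.1.const_mul l)
  have hEb : ∀ᵐ x, ‖l * Complex.exp (l * f x)‖ ≤ ‖l‖ * Real.exp (‖l‖ * M) := by
    filter_upwards [hfb] with x hx
    rw [norm_mul]
    gcongr
    exact norm_exp_mul_le hx
  refine ⟨?_, memLp_mul_of_ae_bound (hmE.const_mul l) hEb h.memLp', fun η hη => ?_⟩
  · refine h.memLp.of_le_mul (c := ‖l‖ * Real.exp (‖l‖ * M))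
      (hmE.sub aestronglyMeasurable_const) ?_
    filter_upwards [hfb] with x hx
    refine (norm_exp_sub_one_le_mul _).trans ?_
    rw [norm_mul, mul_right_comm]
    gcongr
  obtain ⟨ψ, hψ, l1, l2, l3⟩ := h.exists_seq
  have t1 := tendsto_l2norm (fun n => (hψ n).memLp) h.memLp l1
  have t2 := tendsto_l2norm (fun n => (hψ n).deriv.memLp) h.memLp' l2
  obtain ⟨B, hB⟩ := (t1.add t2).bddAbove_range
  have hψB : ∀ n x, ‖ψ n x‖ ≤ B := fun n x => by
    refine le_trans ?_ (hB ⟨n, rfl⟩)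
    have h1 := (hψ n).norm_sq_le x
    have := l2norm_nonneg (ψ n)
    have := l2norm_nonneg (deriv (ψ n))
    refine abs_le_of_sq_le_sq' ?_ (by positivity) |>.2
    nlinarith [sq_nonneg (l2norm (ψ n)), sq_nonneg (l2norm (deriv (ψ n)))]
  have hsm : ∀ n, ContDiff ℝ ∞ fun x => Complex.exp (l * ψ n x) := fun n =>
    (Complex.contDiff_exp (𝕜 := ℝ)).comp (contDiff_const.mul (hψ n).smooth)
  have hder : ∀ n x, deriv (fun x => Complex.exp (l * ψ n x) - 1) x
      = l * Complex.exp (l * ψ n x) * deriv (ψ n) x := fun n x => by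
    have := ((((hψ n).differentiable x).hasDerivAt.const_mul l).cexp).sub_const 1
    rw [this.deriv]; ring
  have hid : ∀ n, ∫ x, deriv η x * (Complex.exp (l * ψ n x) - 1)
      = -∫ x, η x * (l * Complex.exp (l * ψ n x) * deriv (ψ n) x) := fun n => by
    rw [hη.integral_deriv_mul ((hsm n).sub contDiff_const)]
    simp only [hder]
  have L1 : Tendsto (fun n => ∫ x, deriv η x * (Complex.exp (l * ψ n x) - 1)) atTop
      (𝓝 (∫ x, deriv η x * (Complex.exp (l * f x) - 1))) := by
    refine tendsto_integral_of_dominated_convergence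
      (fun x => ‖deriv η x‖ * (Real.exp (‖l‖ * B) + 1)) (fun n => ?_)
      (hη.deriv.integrable.norm.mul_const _) (fun n => Eventually.of_forall fun x => ?_) ?_
    · exact (hη.deriv.continuous.mul ((hsm n).continuous.sub continuous_const)).aestronglyMeasurable
    · rw [norm_mul]
      gcongr
      refine (norm_sub_le _ _).trans (add_le_add (norm_exp_mul_le (hψB n x)) (by simp))
    · filter_upwards [l3] with x hx
      exact (((Complex.continuous_exp.tendsto _).comp (hx.const_mul l)).sub_const 1).const_mul _
  -- The factor `e^{l ψₙ}` converges only almost everywhere and boundedly, `ψₙ'` only in `L²`. Hence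
  -- two limits: here with the fixed `g` in place of `ψₙ'`, by dominated convergence; in `L3` the
  -- error of that replacement, by Cauchy–Schwarz.
  have L2 : Tendsto (fun n => ∫ x, η x * (l * Complex.exp (l * ψ n x) * g x)) atTop
      (𝓝 (∫ x, η x * (l * Complex.exp (l * f x) * g x))) := by
    refine tendsto_integral_of_dominated_convergence
      (fun x => ‖l‖ * Real.exp (‖l‖ * B) * ‖η x * g x‖) (fun n => ?_)
      ((integrable_mul_two hη.memLp h.memLp').norm.const_mul _)
      (fun n => Eventually.of_forall fun x => ?_) ?_
    · exact hη.continuous.aestronglyMeasurable.mul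
        (((hsm n).continuous.aestronglyMeasurable.const_mul l).mul h.memLp'.1)
    · rw [mul_left_comm, norm_mul, norm_mul l]
      gcongr
      exact norm_exp_mul_le (hψB n x)
    · filter_upwards [l3] with x hx
      exact ((((Complex.continuous_exp.tendsto _).comp (hx.const_mul l)).const_mul l).mul_const
        _).const_mul _
  have L3 : Tendsto (fun n => (∫ x, η x * (l * Complex.exp (l * ψ n x) * deriv (ψ n) x))
      - ∫ x, η x * (l * Complex.exp (l * ψ n x) * g x)) atTop (𝓝 0) := by
    have hm1 : ∀ n, MemLp (fun x => η x * (l * Complex.exp (l * ψ n x))) 2 volume := fun n =>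
      (hη.smooth_mul (contDiff_const.mul (hsm n))).memLp
    have hle : ∀ n, l2norm (fun x => η x * (l * Complex.exp (l * ψ n x)))
        ≤ ‖l‖ * Real.exp (‖l‖ * B) * l2norm η := fun n => by
      refine l2norm_mono hη.memLp (by positivity) (Eventually.of_forall fun x => ?_)
      rw [norm_mul, norm_mul, mul_comm]
      gcongr
      exact norm_exp_mul_le (hψB n x)
    refine squeeze_zero_norm (fun n => ?_) (a := fun n =>
      ‖l‖ * Real.exp (‖l‖ * B) * l2norm η * l2norm (deriv (ψ n) - g)) ?_
    · simp only [← mul_assoc (η _) (l * _)]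
      rw [← integral_sub (integrable_mul_two (hm1 n) (hψ n).deriv.memLp)
        (integrable_mul_two (hm1 n) h.memLp')]
      simp only [← mul_sub]
      refine (norm_integral_mul_le (hm1 n) ((hψ n).deriv.memLp.sub h.memLp')).trans ?_
      exact mul_le_mul_of_nonneg_right (hle n) (l2norm_nonneg _)
    · simpa using l2.const_mul (‖l‖ * Real.exp (‖l‖ * B) * l2norm η)
  have L4 := (L3.add L2).neg
  simp only [sub_add_cancel, zero_add, ← hid] at L4
  exact tendsto_nhds_unique L1 L4

end H1Pair

/-! ### Continuous curves in `H¹` and the weak Schrödinger equation -/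

/-- A curve `d` in `H¹` over `[0, T)`, continuous, with weak `x`-derivative `d'`. -/
structure H1Curve (T : ℝ) (d d' : ℝ → ℝ → ℂ) : Prop where
  pair : ∀ t ∈ Ico 0 T, H1Pair (d t) (d' t)
  cont : ∀ t₀ ∈ Ico 0 T, Tendsto (fun t => l2norm (d t - d t₀)) (𝓝[Ico 0 T] t₀) (𝓝 0)
  cont' : ∀ t₀ ∈ Ico 0 T, Tendsto (fun t => l2norm (d' t - d' t₀)) (𝓝[Ico 0 T] t₀) (𝓝 0)

/-- `∂ₜ d = κ ∂ₓ² d + F` on `(0, T)`, in the sense of distributions in `x`. -/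
structure WeakSchrodinger (T : ℝ) (κ : ℂ) (d F : ℝ → ℝ → ℂ) : Prop where
  integrable : ∀ t ∈ Ioo 0 T, Integrable (F t) volume
  bounded : ∀ t ∈ Ioo 0 T, ∃ M, ∀ᶠ τ in 𝓝 t, ∫ x, ‖F τ x‖ ≤ M
  eq : ∀ η, IsTest η → ∀ t ∈ Ioo 0 T, HasDerivAt (fun τ => ∫ x, η x * d τ x)
    ((∫ x, η x * F t x) + κ * ∫ x, deriv (deriv η) x * d t x) t

namespace H1Curve

variable {T : ℝ} {d d' : ℝ → ℝ → ℂ} {e e' : ℝ → ℝ → ℂ}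

lemma sub (h : H1Curve T d d') (k : H1Curve T e e') :
    H1Curve T (fun t => d t - e t) (fun t => d' t - e' t) := by
  refine ⟨fun t ht => (h.pair t ht).sub (k.pair t ht), fun t₀ h₀ => ?_, fun t₀ h₀ => ?_⟩
  · refine squeeze_zero' (Eventually.of_forall fun _ => l2norm_nonneg _) ?_
      (by simpa using (h.cont t₀ h₀).add (k.cont t₀ h₀))
    filter_upwards [self_mem_nhdsWithin] with t ht
    rw [sub_sub_sub_comm]
    exact l2norm_sub_le ((h.pair t ht).memLp.sub (h.pair t₀ h₀).memLp)
      ((k.pair t ht).memLp.sub (k.pair t₀ h₀).memLp)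
  · refine squeeze_zero' (Eventually.of_forall fun _ => l2norm_nonneg _) ?_
      (by simpa using (h.cont' t₀ h₀).add (k.cont' t₀ h₀))
    filter_upwards [self_mem_nhdsWithin] with t ht
    rw [sub_sub_sub_comm]
    exact l2norm_sub_le ((h.pair t ht).memLp'.sub (h.pair t₀ h₀).memLp')
      ((k.pair t ht).memLp'.sub (k.pair t₀ h₀).memLp')

lemma tendsto_l2norm (h : H1Curve T d d') {t₀ : ℝ} (h₀ : t₀ ∈ Ico 0 T) :
    Tendsto (fun t => l2norm (d t)) (𝓝[Ico 0 T] t₀) (𝓝 (l2norm (d t₀))) := by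
  rw [tendsto_iff_norm_sub_tendsto_zero]
  refine squeeze_zero' (Eventually.of_forall fun _ => norm_nonneg _) ?_ (h.cont t₀ h₀)
  filter_upwards [self_mem_nhdsWithin] with t ht
  exact abs_l2norm_sub_le (h.pair t ht).memLp (h.pair t₀ h₀).memLp

lemma tendsto_l2norm' (h : H1Curve T d d') {t₀ : ℝ} (h₀ : t₀ ∈ Ico 0 T) :
    Tendsto (fun t => l2norm (d' t)) (𝓝[Ico 0 T] t₀) (𝓝 (l2norm (d' t₀))) := by
  rw [tendsto_iff_norm_sub_tendsto_zero]
  refine squeeze_zero' (Eventually.of_forall fun _ => norm_nonneg _) ?_ (h.cont' t₀ h₀)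
  filter_upwards [self_mem_nhdsWithin] with t ht
  exact abs_l2norm_sub_le (h.pair t ht).memLp' (h.pair t₀ h₀).memLp'

lemma nhds_eq {t : ℝ} (ht : t ∈ Ioo 0 T) : 𝓝[Ico 0 T] t = 𝓝 t :=
  nhdsWithin_eq_nhds.2 (Ico_mem_nhds ht.1 ht.2)

/-- The curve of `e^{l d} - 1` is again a continuous curve in `H¹`. -/
lemma exp_sub_one (h : H1Curve T d d') (l : ℂ) :
    H1Curve T (fun t x => Complex.exp (l * d t x) - 1)
      (fun t x => l * Complex.exp (l * d t x) * d' t x) := by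
  -- Near `t₀` the Sobolev inequality bounds all `d t` uniformly by `M`, and on that disc `z ↦ e^{l
  -- z}` is bounded and Lipschitz; `C` serves both purposes.
  have key : ∀ t₀ ∈ Ico 0 T, ∃ C, 0 ≤ C ∧ ∀ᶠ t in 𝓝[Ico 0 T] t₀,
      (∀ᵐ x, ‖Complex.exp (l * d t x) - Complex.exp (l * d t₀ x)‖ ≤ C * ‖d t x - d t₀ x‖) ∧
      (∀ᵐ x, ‖l * Complex.exp (l * d t x)‖ ≤ C) := by
    intro t₀ h₀
    set M := l2norm (d t₀) + l2norm (d' t₀) + 1 with hM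
    have hM0 : 0 ≤ M := by have := l2norm_nonneg (d t₀); have := l2norm_nonneg (d' t₀); positivity
    refine ⟨max (Real.exp (‖l‖ * M) * (‖l‖ * Real.exp (‖l‖ * (2 * M))))
      (‖l‖ * Real.exp (‖l‖ * M)), le_max_of_le_right (by positivity), ?_⟩
    have hlt := ((h.tendsto_l2norm h₀).add (h.tendsto_l2norm' h₀)).eventually_lt_const
      (u := M) (by rw [hM]; linarith)
    filter_upwards [hlt, self_mem_nhdsWithin] with t ht hti
    have b1 := (h.pair t hti).norm_le
    have b0 := (h.pair t₀ h₀).norm_le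
    constructor
    · filter_upwards [b1, b0] with x h1 h0
      have h1' : ‖d t x‖ ≤ M := by linarith
      have h0' : ‖d t₀ x‖ ≤ M := by linarith
      have e : Complex.exp (l * d t x) - Complex.exp (l * d t₀ x)
          = Complex.exp (l * d t₀ x) * (Complex.exp (l * (d t x - d t₀ x)) - 1) := by
        rw [mul_sub, mul_one, ← Complex.exp_add]; ring_nf
      rw [e, norm_mul]
      calc _ ≤ Real.exp (‖l‖ * M) * (‖l * (d t x - d t₀ x)‖ * Real.exp ‖l * (d t x - d t₀ x)‖) := by
            gcongr
            · exact norm_exp_mul_le h0'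
            · exact norm_exp_sub_one_le_mul _
        _ ≤ Real.exp (‖l‖ * M) * ((‖l‖ * ‖d t x - d t₀ x‖) * Real.exp (‖l‖ * (2 * M))) := by
            rw [norm_mul]
            gcongr
            exact (norm_sub_le _ _).trans (by linarith)
        _ = Real.exp (‖l‖ * M) * (‖l‖ * Real.exp (‖l‖ * (2 * M))) * ‖d t x - d t₀ x‖ := by ring
        _ ≤ _ := by gcongr; exact le_max_left _ _
    · filter_upwards [b1] with x h1
      refine le_trans ?_ (le_max_right _ _)
      rw [norm_mul]
      gcongr
      exact norm_exp_mul_le (by linarith)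
  refine ⟨fun t ht => (h.pair t ht).exp_sub_one l, ?_, ?_⟩
  · intro t₀ h₀
    obtain ⟨C, hC, hev⟩ := key t₀ h₀
    refine squeeze_zero' (Eventually.of_forall fun _ => l2norm_nonneg _) ?_
      (by simpa using (h.cont t₀ h₀).const_mul C)
    filter_upwards [hev, self_mem_nhdsWithin] with t ht hti
    refine l2norm_mono ((h.pair t hti).memLp.sub (h.pair t₀ h₀).memLp) hC ?_
    filter_upwards [ht.1] with x hx
    simpa using hx
  · intro t₀ h₀
    obtain ⟨C, hC, hev⟩ := key t₀ h₀
    have p0 := h.pair t₀ h₀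
    -- The increment of `e^{l d} d'` splits into `e^{l d} (d' t - d' t₀)` and `(e^{l d t} - e^{l d
    -- t₀}) d' t₀`. In the second term `d' t₀` is only in `L²`, so the increment of `d` is needed in
    -- the sup norm; the square root is its Sobolev bound.
    have lim : Tendsto (fun t => C * l2norm (d' t - d' t₀) + ‖l‖ * C *
        √(2 * (l2norm (d t - d t₀) * l2norm (d' t - d' t₀))) * l2norm (d' t₀))
        (𝓝[Ico 0 T] t₀) (𝓝 0) := by
      have l1 := (h.cont' t₀ h₀).const_mul C
      have l2 := (((h.cont t₀ h₀).mul (h.cont' t₀ h₀)).const_mul 2).sqrt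
      have l3 := ((l2.const_mul (‖l‖ * C)).mul_const (l2norm (d' t₀)))
      simpa using l1.add l3
    refine squeeze_zero' (Eventually.of_forall fun _ => l2norm_nonneg _) ?_ lim
    filter_upwards [hev, self_mem_nhdsWithin] with t ht hti
    have p := h.pair t hti
    have hmE : ∀ t ∈ Ico 0 T, AEStronglyMeasurable (fun x => Complex.exp (l * d t x)) volume :=
      fun t ht => Complex.continuous_exp.comp_aestronglyMeasurable ((h.pair t ht).memLp.1.const_mul l)
    have m1 : MemLp (fun x => l * Complex.exp (l * d t x) * (d' t - d' t₀) x) 2 volume :=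
      memLp_mul_of_ae_bound ((hmE t hti).const_mul l) ht.2 (p.memLp'.sub p0.memLp')
    set S := √(2 * (l2norm (d t - d t₀) * l2norm (d' t - d' t₀))) with hS
    have hsup : ∀ᵐ x, ‖l * (Complex.exp (l * d t x) - Complex.exp (l * d t₀ x))‖ ≤ ‖l‖ * C * S := by
      filter_upwards [ht.1, (p.sub p0).norm_sq_le] with x h1 h2
      rw [norm_mul, mul_assoc]
      gcongr
      refine h1.trans ?_
      gcongr
      exact Real.le_sqrt_of_sq_le h2
    have m2 : MemLp (fun x => l * (Complex.exp (l * d t x) - Complex.exp (l * d t₀ x)) * d' t₀ x)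
        2 volume :=
      memLp_mul_of_ae_bound (((hmE t hti).sub (hmE t₀ h₀)).const_mul l) hsup p0.memLp'
    have e : (fun x => l * Complex.exp (l * d t x) * d' t x)
        - (fun x => l * Complex.exp (l * d t₀ x) * d' t₀ x)
        = (fun x => l * Complex.exp (l * d t x) * (d' t - d' t₀) x)
        + (fun x => l * (Complex.exp (l * d t x) - Complex.exp (l * d t₀ x)) * d' t₀ x) := by
      funext x; simp only [Pi.sub_apply, Pi.add_apply]; ring
    rw [e]
    refine (l2norm_add_le m1 m2).trans (add_le_add ?_ ?_)
    · refine l2norm_mono (p.memLp'.sub p0.memLp') hC ?_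
      filter_upwards [ht.2] with x hx
      rw [norm_mul]
      gcongr
    · refine l2norm_mono p0.memLp' (by positivity) ?_
      filter_upwards [hsup] with x hx
      rw [norm_mul]
      gcongr

end H1Curve

end

/-! ### Weak Schrödinger equation: `H¹` test functions, uniqueness, Cole–Hopf -/

noncomputable section

namespace WeakSchrodinger

variable {T : ℝ} {κ : ℂ} {d d' F : ℝ → ℝ → ℂ}

lemma eq' (hW : WeakSchrodinger T κ d F) (hC : H1Curve T d d') {η : ℝ → ℂ} (hη : IsTest η) {t : ℝ}
    (ht : t ∈ Ioo 0 T) : HasDerivAt (fun τ => ∫ x, η x * d τ x)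
      ((∫ x, η x * F t x) - κ * ∫ x, deriv η x * d' t x) t := by
  have := hW.eq η hη t ht
  rwa [(hC.pair t (Ioo_subset_Ico_self ht)).weak _ hη.deriv, mul_neg, ← sub_eq_add_neg] at this

/-- Bound for the right-hand side of the equation, as a functional on `H¹`. -/
lemma norm_functional_le {f g ψ ψ' : ℝ → ℂ} (hf : Integrable f volume) (hg : MemLp g 2 volume)
    (h : H1Pair ψ ψ') (κ : ℂ) :
    ‖(∫ x, ψ x * f x) - κ * ∫ x, ψ' x * g x‖
      ≤ ((∫ x, ‖f x‖) + ‖κ‖ * l2norm g) * (l2norm ψ + l2norm ψ') := by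
  have h1 := norm_integral_mul_le_of_bound h.norm_le hf
  have h2 := norm_integral_mul_le h.memLp' hg
  have h0 := l2norm_nonneg ψ
  have h0' := l2norm_nonneg g
  refine (norm_sub_le _ _).trans ?_
  rw [norm_mul, add_mul]
  refine add_le_add (by linarith) ?_
  rw [mul_assoc]
  gcongr
  nlinarith [l2norm_nonneg ψ']

/-- Local Lipschitz continuity in the dual of `H¹`. -/
lemma lipschitz (hW : WeakSchrodinger T κ d F) (hC : H1Curve T d d') {t : ℝ} (ht : t ∈ Ioo 0 T) :
    ∃ M, 0 ≤ M ∧ ∀ᶠ τ in 𝓝 t, ∀ ψ ψ', H1Pair ψ ψ' →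
      ‖∫ x, ψ x * (d τ x - d t x)‖ ≤ M * |τ - t| * (l2norm ψ + l2norm ψ') := by
  obtain ⟨M₁, hM₁⟩ := hW.bounded t ht
  have hlt := (hC.tendsto_l2norm' (Ioo_subset_Ico_self ht)).eventually_le_const
    (u := l2norm (d' t) + 1) (by linarith)
  rw [H1Curve.nhds_eq ht] at hlt
  obtain ⟨δ, hδ, hball⟩ := Metric.eventually_nhds_iff_ball.1
    (hM₁.and (hlt.and (Ioo_mem_nhds ht.1 ht.2)))
  set M := M₁ + ‖κ‖ * (l2norm (d' t) + 1) with hM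
  have hM₁0 : 0 ≤ M₁ := (integral_nonneg fun x => norm_nonneg _).trans hM₁.self_of_nhds
  have hM0 : 0 ≤ M := by have := l2norm_nonneg (d' t); positivity
  refine ⟨M, hM0, ?_⟩
  filter_upwards [Metric.ball_mem_nhds t hδ] with τ hτ
  have pt := hC.pair t (Ioo_subset_Ico_self ht)
  have pτ := hC.pair τ (Ioo_subset_Ico_self (hball τ hτ).2.2)
  have htest : ∀ η, IsTest η → ‖∫ x, η x * (d τ x - d t x)‖
      ≤ M * |τ - t| * (l2norm η + l2norm (deriv η)) := by
    intro η hη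
    -- Mean value inequality in time for one test function. The constant depends on it only through
    -- its `H¹` norm, so density extends the estimate to all of `H¹`.
    have hb := (convex_ball t δ).norm_image_sub_le_of_norm_hasDerivWithin_le
      (f := fun τ => ∫ x, η x * d τ x) (C := M * (l2norm η + l2norm (deriv η)))
      (fun y hy => (hW.eq' hC hη (hball y hy).2.2).hasDerivWithinAt)
      (fun y hy => by
        have hy2 := (hball y hy).2.2
        refine (norm_functional_le (hW.integrable y hy2) (hC.pair y (Ioo_subset_Ico_self hy2)).memLp'
          hη.h1Pair κ).trans ?_
        have := l2norm_nonneg η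
        have := l2norm_nonneg (deriv η)
        rw [hM]
        gcongr
        · exact (hball y hy).1
        · exact (hball y hy).2.1) (Metric.mem_ball_self hδ) hτ
    simp only [mul_sub]
    rw [integral_sub (integrable_mul_two hη.memLp pτ.memLp) (integrable_mul_two hη.memLp pt.memLp)]
    rw [Real.norm_eq_abs] at hb
    linarith
  intro ψ ψ' hψ
  obtain ⟨θ, hθ, l1, l2, -⟩ := hψ.exists_seq
  have t1 := tendsto_l2norm (fun n => (hθ n).memLp) hψ.memLp l1
  have t2 := tendsto_l2norm (fun n => (hθ n).deriv.memLp) hψ.memLp' l2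
  have hΔ : MemLp (fun x => d τ x - d t x) 2 volume := pτ.memLp.sub pt.memLp
  have L : Tendsto (fun n => ∫ x, θ n x * (d τ x - d t x)) atTop
      (𝓝 (∫ x, ψ x * (d τ x - d t x))) := by
    rw [tendsto_iff_norm_sub_tendsto_zero]
    refine squeeze_zero (fun _ => norm_nonneg _) (fun n => ?_)
      (by simpa using l1.mul_const (l2norm (d τ - d t)))
    rw [← integral_sub (integrable_mul_two (hθ n).memLp hΔ) (integrable_mul_two hψ.memLp hΔ)]
    simp only [← sub_mul]
    exact norm_integral_mul_le ((hθ n).memLp.sub hψ.memLp) hΔ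
  exact le_of_tendsto_of_tendsto' L.norm ((t1.add t2).const_mul _) fun n => htest _ (hθ n)

/-- The equation may be tested against `H¹` functions. -/
lemma hasDerivAt (hW : WeakSchrodinger T κ d F) (hC : H1Curve T d d') {t : ℝ} (ht : t ∈ Ioo 0 T)
    {ψ ψ' : ℝ → ℂ} (hψ : H1Pair ψ ψ') :
    HasDerivAt (fun τ => ∫ x, ψ x * d τ x)
      ((∫ x, ψ x * F t x) - κ * ∫ x, ψ' x * d' t x) t := by
  obtain ⟨M, hM, hlip⟩ := hW.lipschitz hC ht
  obtain ⟨θ, hθ, l1, l2, -⟩ := hψ.exists_seq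
  have pt := hC.pair t (Ioo_subset_Ico_self ht)
  have hFi := hW.integrable t ht
  set M' := (∫ x, ‖F t x‖) + ‖κ‖ * l2norm (d' t) with hM'
  have hM'0 : 0 ≤ M' := add_nonneg (integral_nonneg fun _ => norm_nonneg _)
    (mul_nonneg (norm_nonneg _) (l2norm_nonneg _))
  rw [hasDerivAt_iff_isLittleO, Asymptotics.isLittleO_iff]
  intro c hc
  -- Replacing `ψ` by `θ n` changes the increment by at most `M |τ - t|` and the proposed derivative
  -- by at most `M'`, each times the `H¹` distance. This `n` makes the total change at most `c / 2 ·
  -- |τ - t|`, the other half being left for the differentiability with `θ n`.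
  have hsmall : ∃ n, (M + M') * (l2norm (θ n - ψ) + l2norm (deriv (θ n) - ψ')) < c / 2 := by
    have : Tendsto (fun n => (M + M') * (l2norm (θ n - ψ) + l2norm (deriv (θ n) - ψ'))) atTop
        (𝓝 0) := by simpa using (l1.add l2).const_mul (M + M')
    exact (this.eventually_lt_const (half_pos hc)).exists
  obtain ⟨n, hn⟩ := hsmall
  have hder := hW.eq' hC (hθ n) ht
  rw [hasDerivAt_iff_isLittleO, Asymptotics.isLittleO_iff] at hder
  filter_upwards [hder (half_pos hc), hlip, Ioo_mem_nhds ht.1 ht.2] with τ h1 h2 hτ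
  have pτ := hC.pair τ (Ioo_subset_Ico_self hτ)
  have hp := (hθ n).h1Pair.sub hψ
  have h3 := h2 _ _ hp
  have h4 := norm_functional_le hFi pt.memLp' hp κ
  rw [← hM'] at h4
  have iψ : ∀ {u : ℝ → ℂ}, MemLp u 2 volume → Integrable (fun x => ψ x * u x) volume := fun hu =>
    integrable_mul_two hψ.memLp hu
  have iθ : ∀ {u : ℝ → ℂ}, MemLp u 2 volume → Integrable (fun x => θ n x * u x) volume := fun hu =>
    integrable_mul_two (hθ n).memLp hu
  have e1 : ∫ x, (θ n - ψ) x * (d τ x - d t x) = (∫ x, θ n x * d τ x) - (∫ x, θ n x * d t x)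
      - ((∫ x, ψ x * d τ x) - ∫ x, ψ x * d t x) := by
    have j1 : Integrable (fun x => θ n x * d τ x - θ n x * d t x) volume :=
      (iθ pτ.memLp).sub (iθ pt.memLp)
    have j2 : Integrable (fun x => ψ x * d τ x - ψ x * d t x) volume :=
      (iψ pτ.memLp).sub (iψ pt.memLp)
    rw [← integral_sub (iθ pτ.memLp) (iθ pt.memLp), ← integral_sub (iψ pτ.memLp) (iψ pt.memLp),
      ← integral_sub j1 j2]
    congr 1; funext x; simp only [Pi.sub_apply]; ring
  have e2 : ∫ x, (θ n - ψ) x * F t x = (∫ x, θ n x * F t x) - ∫ x, ψ x * F t x := by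
    rw [← integral_sub (integrable_mul_of_ae_bound (hθ n).memLp.1 (hθ n).h1Pair.norm_le hFi)
      (integrable_mul_of_ae_bound hψ.memLp.1 hψ.norm_le hFi)]
    simp only [Pi.sub_apply, sub_mul]
  have e3 : ∫ x, (deriv (θ n) - ψ') x * d' t x
      = (∫ x, deriv (θ n) x * d' t x) - ∫ x, ψ' x * d' t x := by
    rw [← integral_sub (integrable_mul_two (hθ n).deriv.memLp pt.memLp')
      (integrable_mul_two hψ.memLp' pt.memLp')]
    simp only [Pi.sub_apply, sub_mul]
  rw [e1] at h3
  rw [e2, e3] at h4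
  set A := ∫ x, θ n x * d τ x
  set B := ∫ x, θ n x * d t x
  set A' := ∫ x, ψ x * d τ x
  set B' := ∫ x, ψ x * d t x
  set D := (∫ x, θ n x * F t x) - κ * ∫ x, deriv (θ n) x * d' t x with hD
  set D' := (∫ x, ψ x * F t x) - κ * ∫ x, ψ' x * d' t x with hD'
  have h4' : ‖D - D'‖ ≤ M' * (l2norm (θ n - ψ) + l2norm (deriv (θ n) - ψ')) := by
    convert h4 using 2
    rw [hD, hD']; ring
  have e : A' - B' - (τ - t) • D' = (A - B - (τ - t) • D) - (A - B - (A' - B'))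
      + (τ - t) • (D - D') := by simp only [smul_sub]; ring
  change ‖A' - B' - (τ - t) • D'‖ ≤ _
  rw [e]
  have h5 : ‖(τ - t) • (D - D')‖
      ≤ |τ - t| * (M' * (l2norm (θ n - ψ) + l2norm (deriv (θ n) - ψ'))) := by
    rw [norm_smul, Real.norm_eq_abs]
    gcongr
  have h6 := (norm_add_le _ _).trans (add_le_add (norm_sub_le (A - B - (τ - t) • D)
    (A - B - (A' - B'))) h5)
  refine h6.trans ?_
  rw [Real.norm_eq_abs] at h1 ⊢
  have h7 : |τ - t| * ((M + M') * (l2norm (θ n - ψ) + l2norm (deriv (θ n) - ψ')))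
      ≤ |τ - t| * (c / 2) := mul_le_mul_of_nonneg_left hn.le (abs_nonneg _)
  nlinarith [h1, h3, h7]

/-- The square of the `L²` norm of an increment is of higher order. -/
lemma l2norm_sub_sq_isLittleO (hW : WeakSchrodinger T κ d F) (hC : H1Curve T d d') {t : ℝ}
    (ht : t ∈ Ioo 0 T) : (fun τ => l2norm (d τ - d t) ^ 2) =o[𝓝 t] fun τ => τ - t := by
  obtain ⟨M, hM, hlip⟩ := hW.lipschitz hC ht
  have ht' := Ioo_subset_Ico_self ht
  rw [Asymptotics.isLittleO_iff]
  intro c hc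
  have lim : Tendsto (fun τ => M * (l2norm (d τ - d t) + l2norm (d' τ - d' t))) (𝓝 t) (𝓝 0) := by
    have := ((hC.cont t ht').add (hC.cont' t ht')).const_mul M
    rw [H1Curve.nhds_eq ht] at this
    simpa using this
  filter_upwards [hlip, Ioo_mem_nhds ht.1 ht.2, lim.eventually_le_const hc] with τ h1 hτ h2
  have hp := (hC.pair τ (Ioo_subset_Ico_self hτ)).sub (hC.pair t ht')
  -- The increment is tested with its own conjugate: the Lipschitz bound in the dual supplies a
  -- factor `|τ - t|`, and continuity in `H¹` supplies a further factor tending to zero.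
  have h3 := h1 _ _ hp.conj
  rw [l2norm_conj, l2norm_conj] at h3
  have h4 := l2norm_sq hp.memLp
  have h5 : l2norm (d τ - d t) ^ 2 ≤ M * |τ - t| * (l2norm (d τ - d t) + l2norm (d' τ - d' t)) := by
    refine le_trans (le_of_eq ?_) h3
    have h6 : ‖((l2norm (d τ - d t) ^ 2 : ℝ) : ℂ)‖ = l2norm (d τ - d t) ^ 2 := by
      rw [Complex.norm_real, Real.norm_of_nonneg (by positivity)]
    rw [← h6, h4]
    rfl
  rw [Real.norm_of_nonneg (by positivity), Real.norm_eq_abs]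
  refine h5.trans ?_
  nlinarith [abs_nonneg (τ - t)]

/-- Uniqueness for the free Schrödinger equation in `C([0, T); H¹)`. -/
theorem eq_zero {k : ℝ} (hW : WeakSchrodinger T (Complex.I * k) d 0) (hC : H1Curve T d d')
    (h0 : d 0 =ᵐ[volume] 0) : ∀ t ∈ Ico 0 T, d t =ᵐ[volume] 0 := by
  -- `‖d τ‖² = 2 Re ⟨d t, d τ⟩ + ‖d τ - d t‖² - ‖d t‖²`. The first term has derivative `2 Re (-i k
  -- ‖d' t‖²) = 0` at `t`, and the second is `o(τ - t)`. No equation tested with a moving function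
  -- is needed.
  have hder : ∀ t ∈ Ioo 0 T, HasDerivAt (fun τ => l2norm (d τ) ^ 2) 0 t := by
    intro t ht
    have pt := hC.pair t (Ioo_subset_Ico_self ht)
    have h1 := hW.hasDerivAt hC ht pt.conj
    have h2 : HasDerivAt (fun τ => (∫ x, (starRingEnd ℂ) (d t x) * d τ x).re) 0 t := by
      have := Complex.reCLM.hasFDerivAt.comp_hasDerivAt t h1
      refine this.congr_deriv ?_
      rw [← l2norm_sq pt.memLp']
      simp only [Pi.zero_apply, mul_zero, integral_zero, zero_sub, Complex.reCLM_apply,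
        Complex.neg_re, Complex.mul_re, Complex.mul_im, Complex.ofReal_re, Complex.ofReal_im,
        Complex.I_re, Complex.I_im]
      ring
    have h3 : HasDerivAt (fun τ => l2norm (d τ - d t) ^ 2) 0 t := by
      rw [hasDerivAt_iff_isLittleO]
      simpa [l2norm] using hW.l2norm_sub_sq_isLittleO hC ht
    have h4 := ((h2.const_mul 2).add h3).sub_const (l2norm (d t) ^ 2)
    rw [mul_zero, add_zero] at h4
    refine h4.congr_of_eventuallyEq ?_
    filter_upwards [Ioo_mem_nhds ht.1 ht.2] with τ hτ
    have pτ := hC.pair τ (Ioo_subset_Ico_self hτ)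
    simp only [Pi.add_apply]
    rw [integral_conj_mul_eq_inner pt.memLp pτ.memLp, l2norm_eq_norm_toLp pt.memLp,
      l2norm_eq_norm_toLp pτ.memLp, l2norm_eq_norm_toLp (pτ.memLp.sub pt.memLp),
      MemLp.toLp_sub pτ.memLp pt.memLp]
    have := @norm_sub_sq ℂ _ _ _ _ (pτ.memLp.toLp (d τ)) (pt.memLp.toLp (d t))
    have hre := inner_re_symm (𝕜 := ℂ) (pτ.memLp.toLp (d τ)) (pt.memLp.toLp (d t))
    rw [this, hre]
    simp only [RCLike.re_eq_complex_re]
    ring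
  intro t ht
  rcases ht.1.eq_or_lt with rfl | ht0
  · exact h0
  refine eq_zero_ae_of_l2norm (hC.pair t ht).memLp ?_
  have hcont : ContinuousOn (fun τ => l2norm (d τ) ^ 2) (Icc 0 t) := fun τ hτ =>
    ((hC.tendsto_l2norm ⟨hτ.1, hτ.2.trans_lt ht.2⟩).pow 2).mono_left
      (nhdsWithin_mono _ fun y hy => ⟨hy.1, hy.2.trans_lt ht.2⟩)
  obtain ⟨c, -, hc⟩ := exists_hasDerivAt_eq_slope (fun τ => l2norm (d τ) ^ 2) (fun _ => 0) ht0 hcont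
    fun τ hτ => hder τ ⟨hτ.1, hτ.2.trans ht.2⟩
  have hz : l2norm (d 0) = 0 := by rw [l2norm_congr h0]; simp [l2norm]
  rw [eq_comm, div_eq_zero_iff, hz] at hc
  have := hc.resolve_right (by linarith)
  simpa using this

/-- The Cole–Hopf transformation removes the derivative nonlinearity. -/
theorem coleHopf {m : ℝ} (hm : m ≠ 0) {G : ℝ → ℝ → ℂ}
    (hW : WeakSchrodinger T (Complex.I / (2 * m)) d
      (fun t x => -Complex.I * (d' t x ^ 2 + G t x)))
    (hC : H1Curve T d d') (hG : ∀ t ∈ Ioo 0 T, Integrable (G t) volume) {η : ℝ → ℂ} (hη : IsTest η)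
    {t : ℝ} (ht : t ∈ Ioo 0 T) :
    HasDerivAt (fun τ => ∫ x, η x * (Complex.exp (-2 * m * d τ x) - 1))
      ((∫ x, η x * (2 * m * Complex.I * Complex.exp (-2 * m * d t x) * G t x))
        + Complex.I / (2 * m) * ∫ x, deriv (deriv η) x * (Complex.exp (-2 * m * d t x) - 1)) t := by
  set l : ℂ := -2 * m with hl
  set κ : ℂ := Complex.I / (2 * m) with hκ
  -- This relation is what makes `(d')²` disappear: the `(d')²` of the equation cancels against the
  -- one that arises when the derivative falls on `e^{l d}`.
  have hlκ : l * κ = -Complex.I := by rw [hl, hκ]; have : (m : ℂ) ≠ 0 := by exact_mod_cast hm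
                                      field_simp
  set E : ℝ → ℂ := fun x => Complex.exp (l * d t x) with hE
  have ht' := Ioo_subset_Ico_self ht
  have pt := hC.pair t ht'
  have pE := pt.exp_sub_one l
  -- This is `η E`, written as `η (E - 1) + η` because only `E - 1` is known to be in `H¹`. Testing
  -- the equation for `d` with it gives the part of the increment of `∫ η e^{l d}` that is linear in
  -- the increment of `d`.
  have pψ := (pE.test_mul hη).add hη.h1Pair
  set B := ‖l‖ * (l2norm (d t) + l2norm (d' t)) with hB
  have hEm : AEStronglyMeasurable E volume :=
    Complex.continuous_exp.comp_aestronglyMeasurable (pt.memLp.1.const_mul l)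
  have hEb : ∀ᵐ x, ‖E x‖ ≤ Real.exp B := by
    filter_upwards [pt.norm_le] with x hx using norm_exp_mul_le hx
  have h1 := hW.hasDerivAt hC ht pψ
  -- the remainder
  have hR : HasDerivAt (fun τ => ∫ x, η x * (E x * (Complex.exp (l * (d τ x - d t x)) - 1
      - l * (d τ x - d t x)))) 0 t := by
    obtain ⟨C, hC0, hCb⟩ := hη.exists_bound
    rw [hasDerivAt_iff_isLittleO]
    simp only [sub_self, mul_zero, Complex.exp_zero, integral_zero, sub_zero, smul_zero]
    have hlt := ((hC.tendsto_l2norm ht').add (hC.tendsto_l2norm' ht')).eventually_le_const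
      (u := l2norm (d t) + l2norm (d' t) + 1) (by linarith)
    rw [H1Curve.nhds_eq ht] at hlt
    set M := l2norm (d t) + l2norm (d' t) + 1 with hM
    -- Second-order Taylor bound for the exponential: the integrand is at most a constant times `|d
    -- τ - d t|²`, the sup norms being bounded near `t`.
    refine Asymptotics.IsBigO.trans_isLittleO ?_ (hW.l2norm_sub_sq_isLittleO hC ht)
    refine Asymptotics.IsBigO.of_bound (C * (Real.exp B * (‖l‖ ^ 2 * Real.exp (‖l‖ * (2 * M))))) ?_
    filter_upwards [hlt, Ioo_mem_nhds ht.1 ht.2] with τ hlτ hτ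
    have pτ := hC.pair τ (Ioo_subset_Ico_self hτ)
    have pΔ := pτ.sub pt
    have i1 := integrable_mul_two (memLp_conj pΔ.memLp) pΔ.memLp
    have hbd : ∀ᵐ x, ‖η x * (E x * (Complex.exp (l * (d τ x - d t x)) - 1 - l * (d τ x - d t x)))‖
        ≤ C * (Real.exp B * (‖l‖ ^ 2 * Real.exp (‖l‖ * (2 * M)))) *
          ‖(starRingEnd ℂ) ((d τ - d t) x) * (d τ - d t) x‖ := by
      filter_upwards [pτ.norm_le, pt.norm_le, hEb] with x hx1 hx2 hx3
      have hx4 : ‖d τ x - d t x‖ ≤ 2 * M := (norm_sub_le _ _).trans (by linarith)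
      rw [norm_mul, norm_mul (E x)]
      calc _ ≤ C * (Real.exp B * (‖l * (d τ x - d t x)‖ ^ 2 * Real.exp ‖l * (d τ x - d t x)‖)) := by
            gcongr
            · exact hCb x
            · exact norm_exp_sub_one_sub_le_mul _
        _ ≤ C * (Real.exp B * ((‖l‖ * ‖d τ x - d t x‖) ^ 2 * Real.exp (‖l‖ * (2 * M)))) := by
            rw [norm_mul]
            gcongr
        _ = _ := by simp only [Pi.sub_apply, norm_mul, RCLike.norm_conj]; ring
    refine (norm_integral_le_of_norm_le (i1.norm.const_mul _) hbd).trans (le_of_eq ?_)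
    rw [integral_const_mul]
    congr 1
    have e1 := l2norm_sq pΔ.memLp
    have e2 : ∀ x, ‖(starRingEnd ℂ) ((d τ - d t) x) * (d τ - d t) x‖ = ‖(d τ - d t) x‖ ^ 2 :=
      fun x => by rw [norm_mul, RCLike.norm_conj, sq]
    have e3 : ∀ x, (starRingEnd ℂ) ((d τ - d t) x) * (d τ - d t) x
        = ((‖(d τ - d t) x‖ ^ 2 : ℝ) : ℂ) := fun x => by rw [Complex.conj_mul']; push_cast; rfl
    simp only [e3] at e1
    rw [integral_complex_ofReal] at e1
    simp only [e2]
    rw [Real.norm_of_nonneg (by positivity)]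
    exact_mod_cast e1.symm
  have h2 := ((h1.const_mul l).add hR).add_const
    (∫ x, η x * (E x - 1) - l * (((fun x => η x * (E x - 1)) + η) x * d t x))
  refine (h2.congr_deriv ?_).congr_of_eventuallyEq ?_
  · have hηd : ∀ x, (deriv η x * (Complex.exp (l * d t x) - 1)
        + η x * (l * Complex.exp (l * d t x) * d' t x)) + deriv η x
        = deriv η x * E x + η x * (l * E x * d' t x) := fun x => by simp only [hE]; ring
    have w := pE.weak _ hη.deriv
    have i1 := integrable_mul_of_ae_bound pψ.memLp.1 pψ.norm_le (hW.integrable t ht)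
    have i2 := integrable_mul_two pψ.memLp' pt.memLp'
    have i3 : Integrable (fun x => η x * (2 * m * Complex.I * E x * G t x)) volume := by
      obtain ⟨C, hC0, hCb⟩ := hη.exists_bound
      have := integrable_mul_of_ae_bound (hη.continuous.aestronglyMeasurable)
        (Eventually.of_forall hCb) (integrable_mul_of_ae_bound hEm hEb (hG t ht))
      refine (this.const_mul (2 * m * Complex.I)).congr (Eventually.of_forall fun x => ?_)
      simp only; ring
    have i4 := integrable_mul_two hη.deriv.memLp pE.memLp'
    rw [w, add_zero]
    simp only [Pi.add_apply] at i1 i2 ⊢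
    rw [mul_neg, ← sub_eq_add_neg, mul_sub]
    simp only [← integral_const_mul]
    rw [← integral_sub (i1.const_mul l) ((i2.const_mul κ).const_mul l), ← integral_sub i3 (i4.const_mul κ)]
    congr 1; funext x
    have hl2 : l = -2 * m := hl
    simp only [hE]
    have e1 : l * (κ * (η x * (l * Complex.exp (l * d t x) * d' t x) * d' t x))
        = -Complex.I * l * (η x * Complex.exp (l * d t x) * d' t x ^ 2) := by
      linear_combination (η x * (l * Complex.exp (l * d t x) * d' t x) * d' t x) * hlκ
    linear_combination -e1 - Complex.I * Complex.exp (l * d t x) * G t x * η x * hl2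
  · filter_upwards [Ioo_mem_nhds ht.1 ht.2] with τ hτ
    have pτ := hC.pair τ (Ioo_subset_Ico_self hτ)
    have i1 := integrable_mul_two pψ.memLp pτ.memLp
    have i2 := integrable_mul_two pψ.memLp pt.memLp
    have i3 := integrable_mul_two hη.memLp pE.memLp
    have i4 := integrable_mul_two hη.memLp (pτ.exp_sub_one l).memLp
    have i5 : Integrable (fun x => η x * (E x - 1)
        - l * (((fun x => η x * (E x - 1)) + η) x * d t x)) volume := i3.sub (i2.const_mul l)
    have i6 : Integrable (fun x => η x * (E x * (Complex.exp (l * (d τ x - d t x)) - 1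
      - l * (d τ x - d t x)))) volume := by
      refine ((i4.sub (i1.const_mul l)).sub i5).congr (Eventually.of_forall fun x => ?_)
      simp only [Pi.sub_apply, Pi.add_apply, hE]
      have : Complex.exp (l * d τ x)
          = Complex.exp (l * d t x) * Complex.exp (l * (d τ x - d t x)) := by
        rw [← Complex.exp_add]; ring_nf
      rw [this]; ring
    simp only [Pi.add_apply] at i1 i5 i6 ⊢
    have i7 : Integrable (fun x => l * ((η x * (Complex.exp (l * d t x) - 1) + η x) * d τ x)
        + η x * (E x * (Complex.exp (l * (d τ x - d t x)) - 1 - l * (d τ x - d t x)))) volume :=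
      (i1.const_mul l).add i6
    rw [← integral_const_mul, ← integral_add (i1.const_mul l) i6,
      ← integral_add i7 i5]
    congr 1; funext x
    simp only [hE]
    have : Complex.exp (l * d τ x)
        = Complex.exp (l * d t x) * Complex.exp (l * (d τ x - d t x)) := by
      rw [← Complex.exp_add]; ring_nf
    rw [this]; ring

end WeakSchrodinger

end

noncomputable section

/-! ### Weak derivatives of general order -/

section Weak

variable {E : Type*} [NormedAddCommGroup E] [NormedSpace ℝ E] {k s : ℕ} {f g f₁ g₁ f₂ g₂ : ℝ → E}

lemma integrable_test_smul {η : ℝ → ℝ} (hη : Continuous η) (hs : HasCompactSupport η)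
    (hf : LocallyIntegrable f volume) : Integrable (fun x => η x • f x) volume :=
  hf.integrable_smul_left_of_hasCompactSupport hη hs

lemma hasCompactSupport_iteratedDeriv {η : ℝ → ℝ} (hs : HasCompactSupport η) (k : ℕ) :
    HasCompactSupport (iteratedDeriv k η) := by
  induction k with
  | zero => simpa using hs
  | succ k ih => rw [iteratedDeriv_succ]; exact ih.deriv

lemma continuous_iteratedDeriv_of_smooth {η : ℝ → ℝ} (hη : ContDiff ℝ ∞ η) (k : ℕ) :
    Continuous (iteratedDeriv k η) :=
  hη.continuous_iteratedDeriv k (by exact_mod_cast le_top)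

namespace HasWeakDeriv

lemma unique [CompleteSpace E] (h₁ : HasWeakDeriv k f g₁) (h₂ : HasWeakDeriv k f g₂) :
    g₁ =ᵐ[volume] g₂ := by
  refine ae_eq_of_integral_contDiff_smul_eq h₁.2.1 h₂.2.1 fun η hη hs => ?_
  have := (h₁.2.2 η hη hs).symm.trans (h₂.2.2 η hη hs)
  exact smul_right_injective E (pow_ne_zero k (by norm_num : (-1 : ℝ) ≠ 0)) this

lemma weakDeriv_ae_eq [CompleteSpace E] (h : HasWeakDeriv k f g) : weakDeriv k f =ᵐ[volume] g := by
  have hex : ∃ g, HasWeakDeriv k f g := ⟨g, h⟩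
  rw [weakDeriv, dif_pos hex]
  exact hex.choose_spec.unique h

lemma congr_right (h : HasWeakDeriv k f g₁) (hg : g₁ =ᵐ[volume] g₂) : HasWeakDeriv k f g₂ := by
  refine ⟨h.1, h.2.1.congr hg, fun η hη hs => ?_⟩
  rw [h.2.2 η hη hs, integral_congr_ae (g := fun x => η x • g₂ x) (hg.mono fun x hx => by simp only [hx])]

lemma self_weakDeriv [CompleteSpace E] (h : HasWeakDeriv k f g) :
    HasWeakDeriv k f (weakDeriv k f) :=
  h.congr_right h.weakDeriv_ae_eq.symm

lemma sub (h₁ : HasWeakDeriv k f₁ g₁) (h₂ : HasWeakDeriv k f₂ g₂) :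
    HasWeakDeriv k (f₁ - f₂) (g₁ - g₂) := by
  refine ⟨h₁.1.sub h₂.1, h₁.2.1.sub h₂.2.1, fun η hη hs => ?_⟩
  have c := continuous_iteratedDeriv_of_smooth hη k
  have cs := hasCompactSupport_iteratedDeriv hs k
  simp only [Pi.sub_apply, smul_sub]
  rw [integral_sub (integrable_test_smul c cs h₁.1) (integrable_test_smul c cs h₂.1),
    integral_sub (integrable_test_smul hη.continuous hs h₁.2.1)
      (integrable_test_smul hη.continuous hs h₂.2.1), h₁.2.2 η hη hs, h₂.2.2 η hη hs, smul_sub]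

lemma zero_self (hf : LocallyIntegrable f volume) : HasWeakDeriv 0 f f :=
  ⟨hf, hf, fun η _ _ => by simp⟩

end HasWeakDeriv

namespace MemHs

variable [CompleteSpace E]

lemma hasWeakDeriv (h : MemHs s f) (hk : k ≤ s) : HasWeakDeriv k f (weakDeriv k f) := by
  obtain ⟨g, hg, -⟩ := h k hk
  exact hg.self_weakDeriv

lemma memLp_weakDeriv (h : MemHs s f) (hk : k ≤ s) : MemLp (weakDeriv k f) 2 volume := by
  obtain ⟨g, hg, hL⟩ := h k hk
  exact (memLp_congr_ae hg.weakDeriv_ae_eq).2 hL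

lemma weakDeriv_zero_ae_eq (h : MemHs s f) : weakDeriv 0 f =ᵐ[volume] f :=
  (HasWeakDeriv.zero_self (h.hasWeakDeriv (Nat.zero_le s)).1).weakDeriv_ae_eq

lemma memLp (h : MemHs s f) : MemLp f 2 volume :=
  (memLp_congr_ae h.weakDeriv_zero_ae_eq).1 (h.memLp_weakDeriv (Nat.zero_le s))

lemma weakDeriv_sub_ae_eq (h₁ : MemHs s f₁) (h₂ : MemHs s f₂) (hk : k ≤ s) :
    weakDeriv k (f₁ - f₂) =ᵐ[volume] weakDeriv k f₁ - weakDeriv k f₂ :=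
  ((h₁.hasWeakDeriv hk).sub (h₂.hasWeakDeriv hk)).weakDeriv_ae_eq

end MemHs

lemma eLpNorm_weakDeriv_le_normHs (hk : k ≤ s) (f : ℝ → E) :
    (eLpNorm (weakDeriv k f) 2 volume).toReal ≤ normHs s f :=
  Finset.single_le_sum (f := fun k => (eLpNorm (weakDeriv k f) 2 volume).toReal)
    (fun _ _ => ENNReal.toReal_nonneg) (Finset.mem_range.2 (Nat.lt_succ_of_le hk))

end Weak

/-! ### Components -/

lemma norm_coord_le (v : EuclideanSpace ℂ (Fin 3)) (j : Fin 3) : ‖v j‖ ≤ ‖v‖ := PiLp.norm_apply_le v j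

lemma memLp_coord {f : ℝ → EuclideanSpace ℂ (Fin 3)} (hf : MemLp f 2 volume) (j : Fin 3) :
    MemLp (fun x => f x j) 2 volume :=
  hf.of_le ((EuclideanSpace.proj (𝕜 := ℂ) j).continuous.comp_aestronglyMeasurable hf.1)
    (Eventually.of_forall fun _ => norm_coord_le _ j)

lemma l2norm_coord_le {f : ℝ → EuclideanSpace ℂ (Fin 3)} (hf : MemLp f 2 volume) (j : Fin 3) :
    l2norm (fun x => f x j) ≤ (eLpNorm f 2 volume).toReal :=
  ENNReal.toReal_mono hf.eLpNorm_ne_top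
    (eLpNorm_mono_ae (Eventually.of_forall fun _ => norm_coord_le _ j))

lemma integral_smul_coord {f : ℝ → EuclideanSpace ℂ (Fin 3)} {η : ℝ → ℝ}
    (h : Integrable (fun x => η x • f x) volume) (j : Fin 3) :
    (∫ x, η x • f x) j = ∫ x, η x • f x j := by
  have := (EuclideanSpace.proj (𝕜 := ℂ) j : EuclideanSpace ℂ (Fin 3) →L[ℂ] ℂ).integral_comp_comm h
  simpa using this.symm

/-- Solutions are defined through real test functions; this splitting passes to the complex ones
used for `H1Pair` and `WeakSchrodinger`. -/
lemma IsTest.integral_eq {η f : ℝ → ℂ} (hη : IsTest η) (hf : LocallyIntegrable f volume) :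
    ∫ x, η x * f x = (∫ x, (η x).re • f x) + Complex.I * ∫ x, (η x).im • f x := by
  have c1 : Integrable (fun x => (η x).re • f x) volume :=
    integrable_test_smul (Complex.continuous_re.comp hη.continuous)
      (hη.supp.comp_left (g := Complex.re) rfl) hf
  have c2 : Integrable (fun x => (η x).im • f x) volume :=
    integrable_test_smul (Complex.continuous_im.comp hη.continuous)
      (hη.supp.comp_left (g := Complex.im) rfl) hf
  rw [← integral_const_mul, ← integral_add c1 (c2.const_mul _)]
  congr 1; funext x
  simp only [Complex.real_smul]
  nth_rewrite 1 [← Complex.re_add_im (η x)]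
  ring

namespace IsTest

variable {η : ℝ → ℂ}

lemma re_smooth (h : IsTest η) : ContDiff ℝ ∞ fun x => (η x).re := Complex.reCLM.contDiff.comp h.smooth

lemma im_smooth (h : IsTest η) : ContDiff ℝ ∞ fun x => (η x).im := Complex.imCLM.contDiff.comp h.smooth

lemma re_supp (h : IsTest η) : HasCompactSupport fun x => (η x).re :=
  h.supp.comp_left (g := Complex.re) rfl

lemma im_supp (h : IsTest η) : HasCompactSupport fun x => (η x).im :=
  h.supp.comp_left (g := Complex.im) rfl

lemma deriv_re (h : IsTest η) : _root_.deriv (fun x => (η x).re) = fun x => (_root_.deriv η x).re :=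
  funext fun x =>
    (Complex.reCLM.hasFDerivAt.comp_hasDerivAt x (h.differentiable x).hasDerivAt).deriv

lemma deriv_im (h : IsTest η) : _root_.deriv (fun x => (η x).im) = fun x => (_root_.deriv η x).im :=
  funext fun x =>
    (Complex.imCLM.hasFDerivAt.comp_hasDerivAt x (h.differentiable x).hasDerivAt).deriv

lemma iteratedDeriv_two_re (h : IsTest η) :
    iteratedDeriv 2 (fun x => (η x).re) = fun x => (_root_.deriv (_root_.deriv η) x).re := by
  rw [iteratedDeriv_succ, iteratedDeriv_one, h.deriv_re, h.deriv.deriv_re]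

lemma iteratedDeriv_two_im (h : IsTest η) :
    iteratedDeriv 2 (fun x => (η x).im) = fun x => (_root_.deriv (_root_.deriv η) x).im := by
  rw [iteratedDeriv_succ, iteratedDeriv_one, h.deriv_im, h.deriv.deriv_im]

end IsTest

lemma MemHs.h1Pair {s : ℕ} {f : ℝ → EuclideanSpace ℂ (Fin 3)} (h : MemHs s f) (hs : 1 ≤ s)
    (j : Fin 3) : H1Pair (fun x => f x j) (fun x => weakDeriv 1 f x j) := by
  have hw := h.hasWeakDeriv hs
  have m1 := memLp_coord h.memLp j
  have m2 := memLp_coord (h.memLp_weakDeriv hs) j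
  have real : ∀ η : ℝ → ℝ, ContDiff ℝ ∞ η → HasCompactSupport η →
      ∫ x, deriv η x • f x j = -∫ x, η x • weakDeriv 1 f x j := by
    intro η hη hsu
    have e := congrArg (fun v : EuclideanSpace ℂ (Fin 3) => v j) (hw.2.2 η hη hsu)
    simp only [PiLp.smul_apply] at e
    rw [integral_smul_coord (integrable_test_smul hη.continuous hsu hw.2.1),
      integral_smul_coord (integrable_test_smul (continuous_iteratedDeriv_of_smooth hη 1)
        (hasCompactSupport_iteratedDeriv hsu 1) hw.1), iteratedDeriv_one] at e
    simpa using e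
  refine ⟨m1, m2, fun η hη => ?_⟩
  have r := real _ hη.re_smooth hη.re_supp
  have i := real _ hη.im_smooth hη.im_supp
  rw [hη.deriv_re] at r
  rw [hη.deriv_im] at i
  rw [hη.deriv.integral_eq (m1.locallyIntegrable (by norm_num)),
    hη.integral_eq (m2.locallyIntegrable (by norm_num)), r, i]
  ring

/-! ### Uniqueness of solutions in `C([0, T); Hˢ)` -/

namespace IsSolution

variable {s : ℕ} {m : Fin 3 → ℝ} {Q : ℂ → ℂ → ℂ} {T : ℝ} {φ : ℝ → EuclideanSpace ℂ (Fin 3)}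
  {u w : ℝ → ℝ → EuclideanSpace ℂ (Fin 3)}

lemma curve (h : IsSolution s m Q T φ u) (hs : 1 ≤ s) (j : Fin 3) :
    H1Curve T (fun t x => u t x j) (fun t x => weakDeriv 1 (u t) x j) := by
  refine ⟨fun t ht => (h.memHs t ht).h1Pair hs j, fun t₀ h₀ => ?_, fun t₀ h₀ => ?_⟩
  · refine squeeze_zero' (Eventually.of_forall fun _ => l2norm_nonneg _) ?_ (h.continuous t₀ h₀)
    filter_upwards [self_mem_nhdsWithin] with t ht
    have a := h.memHs t ht
    have b := h.memHs t₀ h₀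
    refine le_trans ?_ (eLpNorm_weakDeriv_le_normHs (Nat.zero_le s) (u t - u t₀))
    have e : weakDeriv 0 (u t - u t₀) =ᵐ[volume] u t - u t₀ :=
      (HasWeakDeriv.zero_self ((a.memLp.sub b.memLp).locallyIntegrable (by norm_num))).weakDeriv_ae_eq
    rw [eLpNorm_congr_ae e]
    exact l2norm_coord_le (a.memLp.sub b.memLp) j
  · refine squeeze_zero' (Eventually.of_forall fun _ => l2norm_nonneg _) ?_ (h.continuous t₀ h₀)
    filter_upwards [self_mem_nhdsWithin] with t ht
    have a := h.memHs t ht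
    have b := h.memHs t₀ h₀
    refine le_trans ?_ (eLpNorm_weakDeriv_le_normHs hs (u t - u t₀))
    rw [eLpNorm_congr_ae (a.weakDeriv_sub_ae_eq b hs)]
    exact l2norm_coord_le ((a.memLp_weakDeriv hs).sub (b.memLp_weakDeriv hs)) j

lemma mono (h : IsSolution s m Q T φ u) {T' : ℝ} (hT : T' ≤ T) : IsSolution s m Q T' φ u where
  memHs t ht := h.memHs t ⟨ht.1, ht.2.trans_le hT⟩
  continuous t₀ h₀ := (h.continuous t₀ ⟨h₀.1, h₀.2.trans_le hT⟩).mono_left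
    (nhdsWithin_mono _ (Ico_subset_Ico_right hT))
  initial := h.initial
  equation η hη hs j t ht := h.equation η hη hs j t ⟨ht.1, ht.2.trans_le hT⟩

lemma weak_eq (h : IsSolution s m Q T φ u) {j : Fin 3} {t : ℝ} (ht : t ∈ Ioo 0 T)
    (hN : Integrable (fun x => nonlinearity m Q (u t x) (weakDeriv 1 (u t) x) j) volume)
    {η : ℝ → ℂ} (hη : IsTest η) :
    HasDerivAt (fun τ => ∫ x, η x * u τ x j)
      ((∫ x, η x * (-Complex.I * nonlinearity m Q (u t x) (weakDeriv 1 (u t) x) j))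
        + Complex.I / (2 * m j) * ∫ x, deriv (deriv η) x * u t x j) t := by
  have hloc : ∀ τ ∈ Ico 0 T, LocallyIntegrable (fun x => u τ x j) volume := fun τ hτ =>
    (memLp_coord (h.memHs τ hτ).memLp j).locallyIntegrable (by norm_num)
  have r := h.equation _ hη.re_smooth hη.re_supp j t ht
  have i := h.equation _ hη.im_smooth hη.im_supp j t ht
  rw [hη.iteratedDeriv_two_re] at r
  rw [hη.iteratedDeriv_two_im] at i
  have key := (r.add (i.const_mul Complex.I)).const_mul (-Complex.I)
  refine (key.congr_deriv ?_).congr_of_eventuallyEq ?_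
  · rw [hη.deriv.deriv.integral_eq (hloc t (Ioo_subset_Ico_self ht))]
    simp only [mul_left_comm (η _) (-Complex.I)]
    rw [integral_const_mul, hη.integral_eq hN.locallyIntegrable]
    ring
  · filter_upwards [Ioo_mem_nhds ht.1 ht.2] with τ hτ
    rw [hη.integral_eq (hloc τ (Ioo_subset_Ico_self hτ))]
    simp only [Pi.add_apply]
    set A := ∫ x, (η x).re • u τ x j
    set B := ∫ x, (η x).im • u τ x j
    linear_combination (A + Complex.I * B) * Complex.I_sq

lemma weakSchrodinger_sub (h : IsSolution s m Q T φ u) (k : IsSolution s m Q T φ w)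
    {j : Fin 3}
    (hu : ∀ t ∈ Ioo 0 T,
      Integrable (fun x => nonlinearity m Q (u t x) (weakDeriv 1 (u t) x) j) volume)
    (he : ∀ t ∈ Ioo 0 T, (fun x => nonlinearity m Q (u t x) (weakDeriv 1 (u t) x) j)
      =ᵐ[volume] fun x => nonlinearity m Q (w t x) (weakDeriv 1 (w t) x) j) :
    WeakSchrodinger T (Complex.I * ((1 / (2 * m j) : ℝ) : ℂ))
      (fun t => (fun x => u t x j) - fun x => w t x j) 0 := by
  refine ⟨fun t _ => integrable_zero _ _ _, fun t _ => ⟨0, by simp⟩, fun η hη t ht => ?_⟩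
  have pu := fun τ (hτ : τ ∈ Ico 0 T) => memLp_coord (h.memHs τ hτ).memLp j
  have pw := fun τ (hτ : τ ∈ Ico 0 T) => memLp_coord (k.memHs τ hτ).memLp j
  have a := h.weak_eq ht (hu t ht) hη
  have b := k.weak_eq ht ((hu t ht).congr (he t ht)) hη
  have e : ∫ x, η x * (-Complex.I * nonlinearity m Q (u t x) (weakDeriv 1 (u t) x) j)
      = ∫ x, η x * (-Complex.I * nonlinearity m Q (w t x) (weakDeriv 1 (w t) x) j) :=
    integral_congr_ae ((he t ht).mono fun x hx => by simp only [hx])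
  have ht' := Ioo_subset_Ico_self ht
  refine ((a.sub b).congr_deriv ?_).congr_of_eventuallyEq ?_
  · rw [e]
    simp only [Pi.sub_apply, mul_sub]
    rw [integral_sub (integrable_mul_two hη.deriv.deriv.memLp (pu t ht'))
      (integrable_mul_two hη.deriv.deriv.memLp (pw t ht'))]
    simp
    ring
  · filter_upwards [Ioo_mem_nhds ht.1 ht.2] with τ hτ
    have hτ' := Ioo_subset_Ico_self hτ
    simp only [Pi.sub_apply, mul_sub]
    rw [integral_sub (integrable_mul_two hη.memLp (pu τ hτ'))
      (integrable_mul_two hη.memLp (pw τ hτ'))]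

/-- The source term of the third equation without the derivative. -/
def source (m : Fin 3 → ℝ) (Q : ℂ → ℂ → ℂ) (u : ℝ → ℝ → EuclideanSpace ℂ (Fin 3)) (t x : ℝ) : ℂ :=
  Q (u t x 0) (u t x 1) * (Complex.exp (2 * (m 2 : ℂ) * u t x 2) / (2 * (m 2 : ℂ)))

/-- The exponential is bounded by Sobolev, and the quadratic bound on `Q` makes the rest integrable.
The estimate is explicit because it depends continuously on the norms of the components, hence is
locally bounded in time, as `WeakSchrodinger.bounded` demands. -/
lemma integrable_source_and_le (hQ : Continuous fun p : ℂ × ℂ => Q p.1 p.2)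
    (hQb : ∀ a b, ‖Q a b‖ ≤ ‖a‖ ^ 2 + ‖b‖ ^ 2) (hs : 1 ≤ s) (h : IsSolution s m Q T φ u) {t : ℝ}
    (ht : t ∈ Ico 0 T) : Integrable (source m Q u t) volume ∧
      ∫ x, ‖source m Q u t x‖ ≤ Real.exp (‖2 * (m 2 : ℂ)‖ * (l2norm (fun x => u t x 2)
        + l2norm (fun x => weakDeriv 1 (u t) x 2))) / ‖2 * (m 2 : ℂ)‖ *
        (l2norm (fun x => u t x 0) ^ 2 + l2norm (fun x => u t x 1) ^ 2) := by
  have p := fun j => (h.memHs t ht).h1Pair hs j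
  have hm : AEStronglyMeasurable (source m Q u t) volume := by
    refine (hQ.comp_aestronglyMeasurable ((p 0).memLp.1.prodMk (p 1).memLp.1)).mul ?_
    simp only [div_eq_mul_inv]
    exact (Complex.continuous_exp.comp_aestronglyMeasurable
      ((p 2).memLp.1.const_mul (2 * (m 2 : ℂ)))).mul_const _
  have i : ∀ j, Integrable (fun x => ‖u t x j * u t x j‖) volume := fun j =>
    (integrable_mul_two (p j).memLp (p j).memLp).norm
  set C := Real.exp (‖2 * (m 2 : ℂ)‖ * (l2norm (fun x => u t x 2)
    + l2norm (fun x => weakDeriv 1 (u t) x 2))) / ‖2 * (m 2 : ℂ)‖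
  have hb : ∀ᵐ x, ‖source m Q u t x‖ ≤ C * (‖u t x 0 * u t x 0‖ + ‖u t x 1 * u t x 1‖) := by
    filter_upwards [(p 2).norm_le] with x hx
    rw [source, norm_mul, mul_comm, norm_div]
    gcongr
    · exact div_le_div_of_nonneg_right (norm_exp_mul_le hx) (norm_nonneg _)
    · simpa [sq] using hQb (u t x 0) (u t x 1)
  have hi := ((i 0).add (i 1)).const_mul C
  refine ⟨hi.mono' hm hb, ?_⟩
  have hle : ∫ x, ‖source m Q u t x‖
      ≤ ∫ x, C * (‖u t x 0 * u t x 0‖ + ‖u t x 1 * u t x 1‖) :=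
    integral_mono_ae (hi.mono' hm hb).norm hi hb
  refine hle.trans ?_
  rw [integral_const_mul, integral_add (i 0) (i 1)]
  have j0 := integral_norm_mul_le (p 0).memLp (p 0).memLp
  have j1 := integral_norm_mul_le (p 1).memLp (p 1).memLp
  rw [← sq] at j0 j1
  gcongr

lemma weakSchrodinger (hQ : Continuous fun p : ℂ × ℂ => Q p.1 p.2)
    (hQb : ∀ a b, ‖Q a b‖ ≤ ‖a‖ ^ 2 + ‖b‖ ^ 2) (hs : 1 ≤ s) (h : IsSolution s m Q T φ u) :
    WeakSchrodinger T (Complex.I / (2 * m 2)) (fun t x => u t x 2)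
      (fun t x => -Complex.I * ((weakDeriv 1 (u t) x 2) ^ 2 + source m Q u t x)) := by
  have c := fun j => h.curve hs j
  have iN : ∀ t ∈ Ioo 0 T, Integrable (fun x => (weakDeriv 1 (u t) x 2) ^ 2 + source m Q u t x)
      volume := fun t ht => by
    have p := (h.memHs t (Ioo_subset_Ico_self ht)).h1Pair hs 2
    have := (integrable_mul_two p.memLp' p.memLp').add
      (integrable_source_and_le hQ hQb hs h (Ioo_subset_Ico_self ht)).1
    simp only [sq]
    exact this
  refine ⟨fun t ht => (iN t ht).const_mul _, fun t ht => ?_, fun η hη t ht => ?_⟩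
  · have ht' := Ioo_subset_Ico_self ht
    have lim := ((((c 2).tendsto_l2norm' ht').pow 2).add
      ((((((((c 2).tendsto_l2norm ht').add ((c 2).tendsto_l2norm' ht')).const_mul
        ‖2 * (m 2 : ℂ)‖).rexp).div_const ‖2 * (m 2 : ℂ)‖)).mul
        ((((c 0).tendsto_l2norm ht').pow 2).add (((c 1).tendsto_l2norm ht').pow 2))))
    rw [H1Curve.nhds_eq ht] at lim
    refine ⟨_, ((lim.eventually_le_const (lt_add_one _)).and (Ioo_mem_nhds ht.1 ht.2)).mono
      fun τ h1 => le_trans ?_ h1.1⟩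
    · have hτ := h1.2
      have p := (h.memHs τ (Ioo_subset_Ico_self hτ)).h1Pair hs 2
      obtain ⟨j1, j2⟩ := integrable_source_and_le hQ hQb hs h (Ioo_subset_Ico_self hτ)
      have j3 := integral_norm_mul_le p.memLp' p.memLp'
      have j4 := integrable_mul_two p.memLp' p.memLp'
      rw [← sq] at j3
      refine le_trans ?_ (add_le_add j3 j2)
      rw [← integral_add j4.norm j1.norm]
      refine integral_mono ((iN τ hτ).const_mul _).norm (j4.norm.add j1.norm) fun x => ?_
      simp only [norm_mul, norm_neg, Complex.norm_I, one_mul]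
      refine (norm_add_le _ _).trans (le_of_eq ?_)
      simp [sq]
  · exact h.weak_eq (j := 2) ht (iN t ht) hη

/-- Two solutions in `C([0, T); Hˢ)`, `s ≥ 1`, with the same data coincide. -/
theorem unique (hQ : Continuous fun p : ℂ × ℂ => Q p.1 p.2)
    (hQb : ∀ a b, ‖Q a b‖ ≤ ‖a‖ ^ 2 + ‖b‖ ^ 2) (hm : ∀ j, 0 < m j) (hs : 1 ≤ s) (h : IsSolution s m Q T φ u)
    (k : IsSolution s m Q T φ w) :
    ∀ t ∈ Ico 0 T, u t =ᵐ[volume] w t := by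
  have hinit : u 0 =ᵐ[volume] w 0 := h.initial.trans k.initial.symm
  have hinit' : ∀ j : Fin 3, ((fun x => u 0 x j) - fun x => w 0 x j) =ᵐ[volume] 0 := fun j => by
    filter_upwards [hinit] with x hx
    simp [hx]
  have c0 : ∀ t ∈ Ico 0 T, ∀ᵐ x, u t x 0 = w t x 0 := fun t ht => by
    have hW := h.weakSchrodinger_sub k (j := 0)
      (fun t _ => by simp [nonlinearity]) (fun t _ => by simp [nonlinearity])
    filter_upwards [hW.eq_zero ((h.curve hs 0).sub (k.curve hs 0)) (hinit' 0) t ht] with x hx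
    simpa [sub_eq_zero] using hx
  have c1 : ∀ t ∈ Ico 0 T, ∀ᵐ x, u t x 1 = w t x 1 := fun t ht => by
    have hW := h.weakSchrodinger_sub k (j := 1)
      (fun t ht => by
        have p := (h.memHs t (Ioo_subset_Ico_self ht)).h1Pair hs 0
        simpa [nonlinearity, sq] using integrable_mul_two p.memLp p.memLp)
      (fun t ht => by
        filter_upwards [c0 t (Ioo_subset_Ico_self ht)] with x hx
        simp [nonlinearity, hx])
    filter_upwards [hW.eq_zero ((h.curve hs 1).sub (k.curve hs 1)) (hinit' 1) t ht] with x hx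
    simpa [sub_eq_zero] using hx
  have hm2 : m 2 ≠ 0 := (hm 2).ne'
  have hm2c : (m 2 : ℂ) ≠ 0 := by exact_mod_cast hm2
  set l : ℂ := -2 * (m 2 : ℂ) with hl
  have cu := (h.curve hs 2).exp_sub_one l
  have cw := (k.curve hs 2).exp_sub_one l
  -- After Cole–Hopf the source no longer contains the third component. It depends on the first two
  -- only, which are already known to coincide, so the transforms of the two solutions differ by a
  -- solution of the free equation.
  have hsrc : ∀ {v : ℝ → ℝ → EuclideanSpace ℂ (Fin 3)} (t x : ℝ),
      2 * m 2 * Complex.I * Complex.exp (l * v t x 2) * source m Q v t x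
      = Complex.I * Q (v t x 0) (v t x 1) := fun {v} t x => by
    have : Complex.exp (l * v t x 2) * Complex.exp (2 * (m 2 : ℂ) * v t x 2) = 1 := by
      rw [← Complex.exp_add, hl]; simp
    rw [source]
    field_simp
    linear_combination Q (v t x 0) (v t x 1) * this
  have hZ : WeakSchrodinger T (Complex.I * ((1 / (2 * m 2) : ℝ) : ℂ))
      (fun t => (fun x => Complex.exp (l * u t x 2) - 1) - fun x => Complex.exp (l * w t x 2) - 1)
      0 := by
    refine ⟨fun t _ => integrable_zero _ _ _, fun t _ => ⟨0, by simp⟩, fun η hη t ht => ?_⟩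
    have ht' := Ioo_subset_Ico_self ht
    have a := (weakSchrodinger hQ hQb hs h).coleHopf hm2 (h.curve hs 2)
      (fun t ht => (integrable_source_and_le hQ hQb hs h (Ioo_subset_Ico_self ht)).1) hη ht
    have b := (weakSchrodinger hQ hQb hs k).coleHopf hm2 (k.curve hs 2)
      (fun t ht => (integrable_source_and_le hQ hQb hs k (Ioo_subset_Ico_self ht)).1) hη ht
    rw [← hl] at a b
    refine ((a.sub b).congr_deriv ?_).congr_of_eventuallyEq ?_
    · simp only [hsrc]
      have e : ∫ x, η x * (Complex.I * Q (u t x 0) (u t x 1))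
          = ∫ x, η x * (Complex.I * Q (w t x 0) (w t x 1)) := by
        refine integral_congr_ae ?_
        filter_upwards [c0 t ht', c1 t ht'] with x h1 h2
        rw [h1, h2]
      have i1 := integrable_mul_two hη.deriv.deriv.memLp (cu.pair t ht').memLp
      have i2 := integrable_mul_two hη.deriv.deriv.memLp (cw.pair t ht').memLp
      have e' : ∫ x, deriv (deriv η) x * ((fun x => Complex.exp (l * u t x 2) - 1)
          - fun x => Complex.exp (l * w t x 2) - 1) x
          = (∫ x, deriv (deriv η) x * (Complex.exp (l * u t x 2) - 1))
          - ∫ x, deriv (deriv η) x * (Complex.exp (l * w t x 2) - 1) := by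
        rw [← integral_sub i1 i2]
        congr 1; funext x; simp only [Pi.sub_apply]; ring
      rw [e, e']
      simp
      ring
    · filter_upwards [Ioo_mem_nhds ht.1 ht.2] with τ hτ
      have hτ' := Ioo_subset_Ico_self hτ
      have i1 := integrable_mul_two hη.memLp (cu.pair τ hτ').memLp
      have i2 := integrable_mul_two hη.memLp (cw.pair τ hτ').memLp
      simp only [Pi.sub_apply]
      rw [← integral_sub i1 i2]
      congr 1; funext x; ring
  intro t ht
  have hz := hZ.eq_zero (cu.sub cw) (by
    filter_upwards [hinit] with x hx
    simp [hx]) t ht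
  have hexp : ∀ᵐ x, Complex.exp (l * (u t x 2 - w t x 2)) = 1 := by
    filter_upwards [hz] with x hx
    simp only [Pi.sub_apply, Pi.zero_apply, sub_sub_sub_cancel_right] at hx
    rw [mul_sub, Complex.exp_sub, sub_eq_zero.1 hx, div_self (Complex.exp_ne_zero _)]
  have pd := (((h.memHs t ht).h1Pair hs 2).sub ((k.memHs t ht).h1Pair hs 2))
  have pe := pd.exp_sub_one l
  -- Equality of exponentials fixes the difference only modulo periods. But `e^{l (u - w)} - 1` is
  -- zero almost everywhere, so by the chain rule the weak derivative of `u - w` vanishes, and an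
  -- `H¹` function with zero derivative is zero.
  have hd : ((fun x => weakDeriv 1 (u t) x 2) - fun x => weakDeriv 1 (w t) x 2) =ᵐ[volume] 0 := by
    have z := ae_eq_zero_of_test pe.memLp' fun η hη => by
      have := pe.weak η hη
      rw [integral_eq_zero_of_ae (f := fun x => deriv η x * _)] at this
      · exact neg_eq_zero.1 this.symm
      · filter_upwards [hexp] with x hx
        simp [hx]
    filter_upwards [z, hexp] with x h1 h2
    simp only [Pi.sub_apply, Pi.zero_apply] at h1 ⊢
    rw [h2, mul_one] at h1
    exact (mul_eq_zero.1 h1).resolve_left (by rw [hl]; simpa using hm2)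
  have c2 := pd.ae_eq_zero_of_deriv hd
  filter_upwards [c0 t ht, c1 t ht, c2] with x h0 h1 h2
  ext j
  fin_cases j
  · exact h0
  · exact h1
  · simpa [sub_eq_zero] using h2

end IsSolution

end

noncomputable section

/-! ### Families of smooth functions with locally uniform weighted bounds -/

/-- The weight `1 / (1 + x²)`. -/
def decay (x : ℝ) : ℝ := 1 / (1 + x ^ 2)

lemma decay_pos (x : ℝ) : 0 < decay x := by unfold decay; positivity

lemma decay_le_one (x : ℝ) : decay x ≤ 1 := by
  unfold decay
  rw [div_le_one (by positivity)]
  nlinarith [sq_nonneg x]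

section Tame

variable {Y Y' : Type*} [TopologicalSpace Y] [TopologicalSpace Y']
  {E : Type*} [NormedAddCommGroup E]

/-- Joint continuity over `S × ℝ` and a bound by the weight `ρ`, locally uniform in `S`. -/
structure TameBase (S : Set Y) (ρ : ℝ → ℝ) (f : Y → ℝ → E) : Prop where
  cont : ContinuousOn (fun p : Y × ℝ => f p.1 p.2) (S ×ˢ univ)
  bound : ∀ y₀ ∈ S, ∃ C, ∀ᶠ y in 𝓝[S] y₀, ∀ x, ‖f y x‖ ≤ C * ρ x

variable {S S' : Set Y} {ρ ρ₁ ρ₂ : ℝ → ℝ} {f g : Y → ℝ → E}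

namespace TameBase

lemma mono (h : TameBase S ρ f) (hS : S' ⊆ S) : TameBase S' ρ f :=
  ⟨h.cont.mono (prod_mono_left hS), fun y hy => by
    obtain ⟨C, hC⟩ := h.bound y (hS hy)
    exact ⟨C, hC.filter_mono (nhdsWithin_mono _ hS)⟩⟩

lemma weaken (h : TameBase S ρ₁ f) (h0 : ∀ x, 0 ≤ ρ₁ x) (hρ : ∀ x, ρ₁ x ≤ ρ₂ x) :
    TameBase S ρ₂ f :=
  ⟨h.cont, fun y hy => by
    obtain ⟨C, hC⟩ := h.bound y hy
    refine ⟨max C 0, hC.mono fun z hz x => (hz x).trans ?_⟩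
    exact mul_le_mul (le_max_left _ _) (hρ x) (h0 x) (le_max_right _ _)⟩

lemma congr (h : TameBase S ρ f) (hfg : ∀ y ∈ S, ∀ x, f y x = g y x) : TameBase S ρ g :=
  ⟨h.cont.congr fun p hp => (hfg p.1 hp.1 p.2).symm, fun y hy => by
    obtain ⟨C, hC⟩ := h.bound y hy
    refine ⟨C, ?_⟩
    filter_upwards [hC, self_mem_nhdsWithin] with z hz hzS x
    rw [← hfg z hzS x]
    exact hz x⟩

lemma add (h : TameBase S ρ f) (k : TameBase S ρ g) : TameBase S ρ (fun y x => f y x + g y x) :=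
  ⟨h.cont.add k.cont, fun y hy => by
    obtain ⟨C, hC⟩ := h.bound y hy
    obtain ⟨D, hD⟩ := k.bound y hy
    refine ⟨C + D, ?_⟩
    filter_upwards [hC, hD] with z h1 h2 x
    rw [add_mul]
    exact (norm_add_le _ _).trans (add_le_add (h1 x) (h2 x))⟩

lemma mul {f g : Y → ℝ → ℂ} (h : TameBase S ρ₁ f) (k : TameBase S ρ₂ g)
    (h1 : ∀ x, 0 ≤ ρ₁ x) (h2 : ∀ x, 0 ≤ ρ₂ x) (hρ : ∀ x, ρ₁ x * ρ₂ x ≤ ρ x) :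
    TameBase S ρ (fun y x => f y x * g y x) :=
  ⟨h.cont.mul k.cont, fun y hy => by
    obtain ⟨C, hC⟩ := h.bound y hy
    obtain ⟨D, hD⟩ := k.bound y hy
    refine ⟨max C 0 * max D 0, ?_⟩
    filter_upwards [hC, hD] with z e1 e2 x
    rw [norm_mul]
    calc _ ≤ (max C 0 * ρ₁ x) * (max D 0 * ρ₂ x) := by
          have a1 := h1 x
          have a2 := h2 x
          refine mul_le_mul ((e1 x).trans ?_) ((e2 x).trans ?_) (norm_nonneg _) (by positivity)
          · gcongr; exact le_max_left _ _
          · gcongr; exact le_max_left _ _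
      _ = max C 0 * max D 0 * (ρ₁ x * ρ₂ x) := by ring
      _ ≤ _ := by gcongr; exact hρ x⟩

lemma continuous (h : TameBase S ρ f) {y : Y} (hy : y ∈ S) : Continuous (f y) := by
  rw [← continuousOn_univ]
  exact h.cont.comp (f := fun x : ℝ => (y, x)) (by fun_prop) fun x _ => ⟨hy, mem_univ x⟩

lemma tendsto (h : TameBase S ρ f) {y : Y} (hy : y ∈ S) (x : ℝ) :
    Tendsto (fun z => f z x) (𝓝[S] y) (𝓝 (f y x)) := by
  have : ContinuousOn (fun z => f z x) S :=
    h.cont.comp (f := fun z : Y => (z, x)) (by fun_prop) fun z hz => ⟨hz, mem_univ x⟩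
  exact this y hy

lemma exists_bound (h : TameBase S decay f) {y : Y} (hy : y ∈ S) :
    ∃ C, ∀ x, ‖f y x‖ ≤ C / (1 + x ^ 2) := by
  obtain ⟨C, hC⟩ := h.bound y hy
  exact ⟨C, fun x => by simpa [decay, div_eq_mul_inv] using hC.self_of_nhdsWithin hy x⟩

lemma memLp (h : TameBase S decay f) {y : Y} (hy : y ∈ S) : MemLp (f y) 2 volume := by
  obtain ⟨C, hC⟩ := h.exists_bound hy
  exact memLp_two_of_decay (h.continuous hy).aestronglyMeasurable hC

end TameBase

variable [NormedSpace ℝ E]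

/-- The `x`-derivatives of `f` up to order `n` exist and satisfy `TameBase`. -/
def Tame (S : Set Y) (ρ : ℝ → ℝ) : ℕ → (Y → ℝ → E) → Prop
  | 0, f => TameBase S ρ f
  | n + 1, f => TameBase S ρ f ∧ ∃ g : Y → ℝ → E,
      (∀ y ∈ S, ∀ x, HasDerivAt (f y) (g y x) x) ∧ Tame S ρ n g

variable {n : ℕ}

namespace Tame

lemma base (h : Tame S ρ n f) : TameBase S ρ f := by
  cases n with
  | zero => exact h
  | succ n => exact h.1

lemma of_succ (h : Tame S ρ (n + 1) f) : Tame S ρ n f := by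
  induction n generalizing f with
  | zero => exact h.1
  | succ n ih =>
    obtain ⟨h1, g, h2, h3⟩ := h
    exact ⟨h1, g, h2, ih h3⟩

lemma of_le {k : ℕ} (h : Tame S ρ n f) (hk : k ≤ n) : Tame S ρ k f := by
  induction n with
  | zero => rwa [Nat.le_zero.1 hk]
  | succ n ih =>
    rcases hk.eq_or_lt with rfl | hlt
    · exact h
    · exact ih h.of_succ (Nat.lt_succ_iff.1 hlt)

lemma mono (h : Tame S ρ n f) (hS : S' ⊆ S) : Tame S' ρ n f := by
  induction n generalizing f with
  | zero => exact TameBase.mono h hS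
  | succ n ih =>
    obtain ⟨h1, g, h2, h3⟩ := h
    exact ⟨h1.mono hS, g, fun y hy => h2 y (hS hy), ih h3⟩

lemma weaken (h : Tame S ρ₁ n f) (h0 : ∀ x, 0 ≤ ρ₁ x) (hρ : ∀ x, ρ₁ x ≤ ρ₂ x) :
    Tame S ρ₂ n f := by
  induction n generalizing f with
  | zero => exact TameBase.weaken h h0 hρ
  | succ n ih =>
    obtain ⟨h1, g, h2, h3⟩ := h
    exact ⟨h1.weaken h0 hρ, g, h2, ih h3⟩

lemma congr (h : Tame S ρ n f) (hfg : ∀ y ∈ S, ∀ x, f y x = g y x) : Tame S ρ n g := by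
  cases n with
  | zero => exact TameBase.congr h hfg
  | succ n =>
    obtain ⟨h1, k, h2, h3⟩ := h
    refine ⟨h1.congr hfg, k, fun y hy x => ?_, h3⟩
    have : f y = g y := funext (hfg y hy)
    rw [← this]
    exact h2 y hy x

lemma add (h : Tame S ρ n f) (k : Tame S ρ n g) : Tame S ρ n (fun y x => f y x + g y x) := by
  induction n generalizing f g with
  | zero => exact TameBase.add h k
  | succ n ih =>
    obtain ⟨h1, f', h2, h3⟩ := h
    obtain ⟨k1, g', k2, k3⟩ := k
    exact ⟨h1.add k1, _, fun y hy x => (h2 y hy x).add (k2 y hy x), ih h3 k3⟩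

lemma mul {f g : Y → ℝ → ℂ} (h : Tame S ρ₁ n f) (k : Tame S ρ₂ n g)
    (h1 : ∀ x, 0 ≤ ρ₁ x) (h2 : ∀ x, 0 ≤ ρ₂ x) (hρ : ∀ x, ρ₁ x * ρ₂ x ≤ ρ x) :
    Tame S ρ n (fun y x => f y x * g y x) := by
  induction n generalizing f g with
  | zero => exact TameBase.mul h k h1 h2 hρ
  | succ n ih =>
    have hs := h.of_succ
    have ks := k.of_succ
    obtain ⟨a1, f', a2, a3⟩ := h
    obtain ⟨b1, g', b2, b3⟩ := k
    exact ⟨a1.mul b1 h1 h2 hρ, _, fun y hy x => (a2 y hy x).mul (b2 y hy x),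
      (ih a3 ks).add (ih hs b3)⟩

lemma one_mul_decay {f g : Y → ℝ → ℂ} (h : Tame S (fun _ => 1) n f) (k : Tame S decay n g) :
    Tame S decay n (fun y x => f y x * g y x) :=
  h.mul k (fun _ => zero_le_one) (fun x => (decay_pos x).le) (fun x => by simp)

lemma const (c : E) : Tame S (fun _ => 1) n (fun _ _ => c) := by
  induction n generalizing c with
  | zero => exact ⟨continuousOn_const, fun y _ => ⟨‖c‖, by simp⟩⟩
  | succ n ih =>
    exact ⟨⟨continuousOn_const, fun y _ => ⟨‖c‖, by simp⟩⟩, fun _ _ => 0,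
      fun y _ x => hasDerivAt_const x c, ih 0⟩

lemma const_mul {f : Y → ℝ → ℂ} (h : Tame S decay n f) (c : ℂ) :
    Tame S decay n (fun y x => c * f y x) :=
  (const (S := S) (n := n) c).one_mul_decay h

end Tame

/-- Gaussians with polynomial factors are tame. -/
lemma tame_gaussian {a b : Y → ℂ} (ha : ContinuousOn a S) (hb : ContinuousOn b S)
    (hpos : ∀ y ∈ S, 0 < (b y).re) (n k : ℕ) :
    Tame S decay n (fun y x => a y * (x : ℂ) ^ k * Complex.exp (-b y * (x : ℂ) ^ 2)) := by
  have hbase : ∀ {a : Y → ℂ} (k : ℕ), ContinuousOn a S → TameBase S decay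
      (fun y x => a y * (x : ℂ) ^ k * Complex.exp (-b y * (x : ℂ) ^ 2)) := by
    intro a k ha
    refine ⟨?_, fun y₀ h₀ => ?_⟩
    · have a' : ContinuousOn (fun p : Y × ℝ => a p.1) (S ×ˢ univ) :=
        ha.comp continuousOn_fst fun p hp => hp.1
      have b' : ContinuousOn (fun p : Y × ℝ => b p.1) (S ×ˢ univ) :=
        hb.comp continuousOn_fst fun p hp => hp.1
      have e' : Continuous fun p : Y × ℝ => (p.2 : ℂ) := Complex.continuous_ofReal.comp continuous_snd
      exact (a'.mul (e'.pow k).continuousOn).mul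
        (Complex.continuous_exp.comp_continuousOn (b'.neg.mul (e'.pow 2).continuousOn))
    · set β := (b y₀).re / 2 with hβ
      have hβ0 : 0 < β := by have := hpos y₀ h₀; positivity
      -- The constant comes from `Xⁿ / n! ≤ e^X` with `X = β (1 + x²)` and `n = k + 1`: `k` powers
      -- absorb `|x|ᵏ` and one gives the weight. Halving `Re (b y₀)` keeps the bound valid for `y`
      -- near `y₀`.
      refine ⟨(‖a y₀‖ + 1) * ((k + 1).factorial * Real.exp β / β ^ (k + 1)), ?_⟩
      have e1 := (ha y₀ h₀).norm.eventually_le_const (lt_add_one _)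
      have e2 : ∀ᶠ y in 𝓝[S] y₀, β ≤ (b y).re :=
        ((Complex.continuous_re.tendsto _).comp (hb y₀ h₀)).eventually_const_le
          (half_lt_self (hpos y₀ h₀))
      filter_upwards [e1, e2] with y h1 h2 x
      rw [norm_mul, norm_mul, norm_pow, Complex.norm_real, Real.norm_eq_abs, mul_assoc, mul_assoc]
      refine mul_le_mul h1 ?_ (by positivity) (by positivity)
      have h3 : ‖Complex.exp (-b y * (x : ℂ) ^ 2)‖ ≤ Real.exp (-β * x ^ 2) := by
        rw [Complex.norm_exp]
        refine Real.exp_le_exp.2 ?_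
        have : (-b y * (x : ℂ) ^ 2).re = -((b y).re * x ^ 2) := by
          rw [← Complex.ofReal_pow, Complex.mul_re, Complex.ofReal_re, Complex.ofReal_im]; simp
        rw [this]
        nlinarith [sq_nonneg x]
      have h4 : |x| ^ k ≤ (1 + x ^ 2) ^ k := by
        gcongr
        nlinarith [sq_abs x, abs_nonneg x]
      have h5 := Real.pow_div_factorial_le_exp (β * (1 + x ^ 2)) (by positivity) (k + 1)
      rw [div_le_iff₀ (by positivity), mul_pow, mul_add, mul_one, Real.exp_add] at h5
      unfold decay
      rw [mul_one_div, le_div_iff₀ (by positivity), le_div_iff₀ (by positivity)]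
      calc _ ≤ (1 + x ^ 2) ^ k * Real.exp (-β * x ^ 2) * (1 + x ^ 2) * β ^ (k + 1) := by gcongr
        _ = (β ^ (k + 1) * (1 + x ^ 2) ^ (k + 1)) * Real.exp (-β * x ^ 2) := by ring
        _ ≤ (Real.exp β * Real.exp (β * x ^ 2) * (k + 1).factorial) * Real.exp (-β * x ^ 2) := by
            gcongr
        _ = (k + 1).factorial * Real.exp β * (Real.exp (β * x ^ 2) * Real.exp (-β * x ^ 2)) := by
            ring
        _ = _ := by rw [← Real.exp_add]; simp
  induction n generalizing a k with
  | zero => exact hbase k ha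
  | succ n ih =>
    have hexp : ∀ y, ∀ x : ℝ, HasDerivAt (fun x : ℝ => Complex.exp (-b y * (x : ℂ) ^ 2))
        (Complex.exp (-b y * (x : ℂ) ^ 2) * (-b y * (2 * x))) x := fun y x => by
      have := ((Complex.ofRealCLM.hasDerivAt (x := x)).pow 2).const_mul (-b y)
      simpa using this.cexp
    have hpow : ∀ y, ∀ x : ℝ, HasDerivAt (fun x : ℝ => a y * (x : ℂ) ^ k)
        (a y * (k * (x : ℂ) ^ (k - 1))) x := fun y x => by
      have := ((Complex.ofRealCLM.hasDerivAt (x := x)).pow k).const_mul (a y)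
      simpa using this
    refine ⟨hbase k ha, _, fun y _ x => (hpow y x).mul (hexp y x), ?_⟩
    -- The derivative is a sum of two terms of the same form, of degrees `k - 1` and `k + 1`. For `k
    -- = 0` the first has coefficient zero, so the truncated subtraction does no harm.
    have t1 := ih (a := fun y => a y * k) (ha.mul continuousOn_const) (k - 1)
    have t2 := ih (a := fun y => -2 * b y * a y) ((continuousOn_const.mul hb).mul ha) (k + 1)
    refine (t1.add t2).congr fun y _ x => ?_
    ring

end Tame

end

/-! ### Inverse and logarithm of `1 + z` for a decaying family `z` -/

noncomputable section

section Nonlinear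

variable {Y : Type*} [TopologicalSpace Y] {S : Set Y} {z : Y → ℝ → ℂ} {n : ℕ}

/-- For `|x| > 2|C| + 1` the decay forces `‖z‖ ≤ 1/2`; on the remaining compact interval the minimum
at `y₀` is positive, and half of it survives nearby by compactness. -/
lemma TameBase.exists_lower_bound (h : TameBase S decay z) (hne : ∀ y ∈ S, ∀ x, 1 + z y x ≠ 0)
    {y₀ : Y} (h₀ : y₀ ∈ S) : ∃ δ, 0 < δ ∧ ∀ᶠ y in 𝓝[S] y₀, ∀ x, δ ≤ ‖1 + z y x‖ := by
  obtain ⟨C, hC⟩ := h.bound y₀ h₀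
  set R := 2 * |C| + 1 with hR
  have hR1 : 1 ≤ R := by have := abs_nonneg C; linarith
  have hcont : Continuous fun x => ‖1 + z y₀ x‖ := (continuous_const.add (h.continuous h₀)).norm
  obtain ⟨x₁, -, hx₁⟩ := (isCompact_Icc (a := -R) (b := R)).exists_isMinOn
    ⟨0, by constructor <;> linarith⟩ hcont.continuousOn
  have hm : 0 < ‖1 + z y₀ x₁‖ := norm_pos_iff.2 (hne y₀ h₀ x₁)
  set μ := ‖1 + z y₀ x₁‖ with hμ
  have hev : ∀ᶠ y in 𝓝 y₀, ∀ x ∈ Icc (-R) R, y ∈ S → μ / 2 ≤ ‖1 + z y x‖ := by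
    refine isCompact_Icc.eventually_forall_of_forall_eventually fun x hx => ?_
    have hc : ContinuousWithinAt (fun p : Y × ℝ => ‖1 + z p.1 p.2‖) (S ×ˢ univ) (y₀, x) :=
      ((continuousOn_const.add h.cont).norm) (y₀, x) ⟨h₀, mem_univ x⟩
    have hlt : μ / 2 < ‖1 + z y₀ x‖ := lt_of_lt_of_le (half_lt_self hm) (hx₁ hx)
    have := hc.eventually_const_le hlt
    rw [eventually_nhdsWithin_iff] at this
    filter_upwards [this] with p hp hpS
    exact hp ⟨hpS, mem_univ _⟩
  refine ⟨min (μ / 2) (1 / 2), by positivity, ?_⟩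
  filter_upwards [hC, mem_nhdsWithin_of_mem_nhds hev, self_mem_nhdsWithin] with y h1 h2 hyS x
  by_cases hx : x ∈ Icc (-R) R
  · exact (min_le_left _ _).trans (h2 x hx hyS)
  · refine (min_le_right _ _).trans ?_
    have hx' : R < |x| := by
      rw [mem_Icc, ← abs_le, not_le] at hx
      exact hx
    have h3 : ‖z y x‖ ≤ 1 / 2 := by
      refine (h1 x).trans ?_
      unfold decay
      rw [mul_one_div, div_le_iff₀ (by positivity)]
      nlinarith [le_abs_self C, sq_abs x, abs_nonneg C]
    have h4 := norm_sub_norm_le (1 : ℂ) (-z y x)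
    rw [norm_neg, norm_one, sub_neg_eq_add] at h4
    linarith

lemma TameBase.inv_one_add (h : TameBase S decay z) (hne : ∀ y ∈ S, ∀ x, 1 + z y x ≠ 0) :
    TameBase S (fun _ => 1) (fun y x => (1 + z y x)⁻¹) :=
  ⟨(continuousOn_const.add h.cont).inv₀ fun p hp => hne p.1 hp.1 p.2, fun y hy => by
    obtain ⟨δ, hδ, hev⟩ := h.exists_lower_bound hne hy
    refine ⟨δ⁻¹, hev.mono fun w hw x => ?_⟩
    rw [norm_inv, mul_one]
    exact inv_anti₀ hδ (hw x)⟩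

lemma Tame.inv_one_add (h : Tame S decay n z) (hne : ∀ y ∈ S, ∀ x, 1 + z y x ≠ 0) :
    Tame S (fun _ => 1) n (fun y x => (1 + z y x)⁻¹) := by
  induction n with
  | zero => exact TameBase.inv_one_add h hne
  | succ n ih =>
    have hi := ih h.of_succ
    obtain ⟨h1, z', h2, h3⟩ := h
    refine ⟨h1.inv_one_add hne, _, fun y hy x => ((h2 y hy x).const_add 1).fun_inv (hne y hy x), ?_⟩
    have t := (hi.one_mul_decay (hi.one_mul_decay h3)).const_mul (-1)
    refine (t.weaken (fun x => (decay_pos x).le) decay_le_one).congr fun y _ x => ?_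
    field_simp

/-- A bound linear in `‖z‖` lets the logarithm inherit the decay of `z`. For `‖z‖ ≤ 1/2` it is the
usual estimate; for `‖z‖ ≥ 1/2` the logarithm is merely bounded, and `1 ≤ 2 ‖z‖`. -/
lemma norm_log_le_of_bounds {z : ℂ} {δ : ℝ} (hδ : 0 < δ) (hz : ‖z‖ ≤ 1) (hlow : δ ≤ ‖1 + z‖) :
    ‖Complex.log (1 + z)‖ ≤ (3 / 2 + 2 * (|Real.log δ| + Real.log 2 + Real.pi)) * ‖z‖ := by
  have hl2 : 0 ≤ Real.log 2 := Real.log_nonneg (by norm_num)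
  have hpi := Real.pi_pos
  set L := |Real.log δ| + Real.log 2 + Real.pi with hL
  have hL0 : 0 ≤ L := by positivity
  rcases le_total ‖z‖ (1 / 2) with h | h
  · have := Complex.norm_log_one_add_half_le_self h
    nlinarith [norm_nonneg z]
  · have h1 : ‖Complex.log (1 + z)‖ ≤ L := by
      refine (Complex.norm_le_abs_re_add_abs_im _).trans ?_
      rw [Complex.log_re, Complex.log_im, hL]
      refine add_le_add ?_ (Complex.abs_arg_le_pi _)
      have hup : ‖1 + z‖ ≤ 2 := (norm_add_le _ _).trans (by rw [norm_one]; linarith)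
      have a1 := Real.log_le_log hδ hlow
      have a2 := Real.log_le_log (hδ.trans_le hlow) hup
      rw [abs_le]
      constructor
      · have := neg_abs_le (Real.log δ); linarith
      · have := abs_nonneg (Real.log δ); linarith
    nlinarith [norm_nonneg z]

lemma Tame.log_one_add (h : Tame S decay n z) (hlt : ∀ y ∈ S, ∀ x, ‖z y x‖ < 1) :
    Tame S decay n (fun y x => Complex.log (1 + z y x)) := by
  have hslit : ∀ y ∈ S, ∀ x, 1 + z y x ∈ Complex.slitPlane := fun y hy x =>
    Complex.mem_slitPlane_of_norm_lt_one (hlt y hy x)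
  have hne : ∀ y ∈ S, ∀ x, 1 + z y x ≠ 0 := fun y hy x => Complex.slitPlane_ne_zero (hslit y hy x)
  have hbase : TameBase S decay (fun y x => Complex.log (1 + z y x)) := by
    have hb := h.base
    refine ⟨(continuousOn_const.add hb.cont).clog fun p hp => hslit p.1 hp.1 p.2, fun y hy => ?_⟩
    obtain ⟨δ, hδ, hev⟩ := hb.exists_lower_bound hne hy
    obtain ⟨C, hC⟩ := hb.bound y hy
    have hl2 : 0 ≤ Real.log 2 := Real.log_nonneg (by norm_num)
    have hpi := Real.pi_pos
    refine ⟨(3 / 2 + 2 * (|Real.log δ| + Real.log 2 + Real.pi)) * C, ?_⟩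
    filter_upwards [hev, hC, self_mem_nhdsWithin] with w h1 h2 hw x
    refine (norm_log_le_of_bounds hδ (hlt w hw x).le (h1 x)).trans ?_
    rw [mul_assoc]
    gcongr
    exact h2 x
  cases n with
  | zero => exact hbase
  | succ n =>
    have hi := h.of_succ.inv_one_add hne
    obtain ⟨h1, z', h2, h3⟩ := h
    refine ⟨hbase, _, fun y hy x => ((h2 y hy x).const_add 1).clog_real (hslit y hy x), ?_⟩
    refine (hi.one_mul_decay h3).congr fun y _ x => ?_
    rw [div_eq_mul_inv, mul_comm]

end Nonlinear

/-! ### Integrals over a parameter -/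

/-- The bounds near the points `(t₀, θ)` are patched together by compactness of the unit interval.
-/
lemma TameBase.exists_uniform_bound {f : ℝ × ℝ → ℝ → ℂ} (h : TameBase univ decay f) (t₀ : ℝ) :
    ∃ C, ∀ᶠ t in 𝓝 t₀, ∀ θ ∈ Icc (0 : ℝ) 1, ∀ x, ‖f (t, θ) x‖ ≤ C * decay x := by
  refine (isCompact_Icc (a := (0 : ℝ)) (b := 1)).induction_on
    (p := fun s => ∃ C, ∀ᶠ t in 𝓝 t₀, ∀ θ ∈ s, ∀ x, ‖f (t, θ) x‖ ≤ C * decay x)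
    ⟨0, by simp⟩ ?_ ?_ ?_
  · rintro s s' hss ⟨C, hC⟩
    exact ⟨C, hC.mono fun t ht θ hθ => ht θ (hss hθ)⟩
  · rintro s s' ⟨C, hC⟩ ⟨D, hD⟩
    refine ⟨max C D, ?_⟩
    filter_upwards [hC, hD] with t h1 h2 θ hθ x
    have := (decay_pos x).le
    rcases hθ with hθ | hθ
    · exact (h1 θ hθ x).trans (by gcongr; exact le_max_left _ _)
    · exact (h2 θ hθ x).trans (by gcongr; exact le_max_right _ _)
  · intro θ₀ _
    obtain ⟨C, hC⟩ := h.bound (t₀, θ₀) (mem_univ _)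
    rw [nhdsWithin_univ, nhds_prod_eq] at hC
    obtain ⟨U, hU, V, hV, hUV⟩ := Filter.mem_prod_iff.1 hC
    refine ⟨V, mem_nhdsWithin_of_mem_nhds hV, C, ?_⟩
    filter_upwards [hU] with t ht θ hθ
    exact hUV (mk_mem_prod ht hθ)

lemma TameBase.integral {f : ℝ × ℝ → ℝ → ℂ} (h : TameBase univ decay f) :
    TameBase univ decay (fun t x => ∫ θ in (0 : ℝ)..1, f (t, θ) x) := by
  have hc : Continuous fun p : (ℝ × ℝ) × ℝ => f p.1 p.2 := by
    rw [← continuousOn_univ, ← univ_prod_univ]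
    exact h.cont
  refine ⟨?_, fun t₀ _ => ?_⟩
  · refine Continuous.continuousOn ?_
    refine intervalIntegral.continuous_parametric_intervalIntegral_of_continuous'
      (f := fun (p : ℝ × ℝ) (θ : ℝ) => f (p.1, θ) p.2) ?_ 0 1
    exact hc.comp (by fun_prop : Continuous fun q : (ℝ × ℝ) × ℝ => ((q.1.1, q.2), q.1.2))
  · obtain ⟨C, hC⟩ := h.exists_uniform_bound t₀
    rw [nhdsWithin_univ]
    refine ⟨C, hC.mono fun t ht x => ?_⟩
    have := intervalIntegral.norm_integral_le_of_norm_le_const (a := (0 : ℝ)) (b := 1)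
      (f := fun θ => f (t, θ) x) (C := C * decay x) fun θ hθ => by
        rw [uIoc_of_le zero_le_one] at hθ
        exact ht θ (Ioc_subset_Icc_self hθ) x
    simpa using this

lemma TameBase.hasDerivAt_integral {f g : ℝ × ℝ → ℝ → ℂ} (h1 : TameBase univ decay f)
    (h3 : TameBase univ decay g) (h2 : ∀ y x, HasDerivAt (f y) (g y x) x) (t x : ℝ) :
    HasDerivAt (fun x => ∫ θ in (0 : ℝ)..1, f (t, θ) x) (∫ θ in (0 : ℝ)..1, g (t, θ) x) x := by
  have hcf : ∀ x, Continuous fun θ => f (t, θ) x := fun x => by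
    have hc : Continuous fun p : (ℝ × ℝ) × ℝ => f p.1 p.2 := by
      rw [← continuousOn_univ, ← univ_prod_univ]
      exact h1.cont
    exact hc.comp (by fun_prop : Continuous fun θ : ℝ => ((t, θ), x))
  have hcg : Continuous fun θ => g (t, θ) x := by
    have hc : Continuous fun p : (ℝ × ℝ) × ℝ => g p.1 p.2 := by
      rw [← continuousOn_univ, ← univ_prod_univ]
      exact h3.cont
    exact hc.comp (by fun_prop : Continuous fun θ : ℝ => ((t, θ), x))
  obtain ⟨C, hC⟩ := h3.exists_uniform_bound t
  have hC' := hC.self_of_nhds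
  refine (intervalIntegral.hasDerivAt_integral_of_dominated_loc_of_deriv_le
    (F := fun x θ => f (t, θ) x) (F' := fun x θ => g (t, θ) x) (bound := fun _ => |C|)
    (s := univ) univ_mem
    (Eventually.of_forall fun y => (hcf y).aestronglyMeasurable) ((hcf x).intervalIntegrable _ _)
    hcg.aestronglyMeasurable (Eventually.of_forall fun θ hθ y _ => ?_) (by simp)
    (Eventually.of_forall fun θ _ y _ => h2 (t, θ) y)).2
  rw [uIoc_of_le zero_le_one] at hθ
  refine (hC' θ (Ioc_subset_Icc_self hθ) y).trans ?_
  exact (mul_le_mul_of_nonneg_right (le_abs_self C) (decay_pos y).le).trans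
    (mul_le_of_le_one_right (abs_nonneg C) (decay_le_one y))

lemma Tame.integral {n : ℕ} {f : ℝ × ℝ → ℝ → ℂ} (h : Tame univ decay n f) :
    Tame univ decay n (fun t x => ∫ θ in (0 : ℝ)..1, f (t, θ) x) := by
  induction n generalizing f with
  | zero => exact TameBase.integral h
  | succ n ih =>
    obtain ⟨h1, g, h2, h3⟩ := h
    exact ⟨h1.integral, _, fun t _ => h1.hasDerivAt_integral h3.base
      (fun y => h2 y (mem_univ y)) t, ih h3⟩

/-! ### Sobolev regularity of tame families -/

section Sobolev

variable {E : Type*} [NormedAddCommGroup E] [NormedSpace ℝ E]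

lemma HasWeakDeriv.of_hasDerivAt {k : ℕ} {f f' g : ℝ → E} (hf : ∀ x, HasDerivAt f (f' x) x)
    (hc : Continuous f') (h : HasWeakDeriv k f' g) : HasWeakDeriv (k + 1) f g := by
  have hcf : Continuous f := continuous_iff_continuousAt.2 fun x => (hf x).continuousAt
  refine ⟨hcf.locallyIntegrable, h.2.1, fun η hη hs => ?_⟩
  have c0 := continuous_iteratedDeriv_of_smooth hη k
  have c1 := continuous_iteratedDeriv_of_smooth hη (k + 1)
  have s0 := hasCompactSupport_iteratedDeriv hs k
  have s1 := hasCompactSupport_iteratedDeriv hs (k + 1)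
  have hd : ∀ x, HasDerivAt (iteratedDeriv k η) (iteratedDeriv (k + 1) η x) x := fun x => by
    rw [iteratedDeriv_succ]
    exact ((hη.differentiable_iteratedDeriv k (by exact_mod_cast ENat.natCast_lt_top k)) x).hasDerivAt
  have := integral_bilinear_hasDerivAt_right_eq_neg_left_of_integrable
    (L := (ContinuousLinearMap.lsmul ℝ ℝ (E := E)).flip) (u := f) (v := iteratedDeriv k η)
    (u' := f') (v' := iteratedDeriv (k + 1) η) (fun x _ => hf x) (fun x _ => hd x)
    (integrable_test_smul c1 s1 hcf.locallyIntegrable)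
    (integrable_test_smul c0 s0 hc.locallyIntegrable)
    (integrable_test_smul c0 s0 hcf.locallyIntegrable)
  simp only [ContinuousLinearMap.flip_apply, ContinuousLinearMap.lsmul_apply] at this
  rw [this, h.2.2 η hη hs, pow_succ, mul_neg_one, neg_smul]

lemma Tame.exists_hasWeakDeriv {Y : Type*} [TopologicalSpace Y] {S : Set Y} {n k : ℕ}
    {f : Y → ℝ → E} (h : Tame S decay n f) (hk : k ≤ n) :
    ∃ g, TameBase S decay g ∧ ∀ y ∈ S, HasWeakDeriv k (f y) (g y) := by
  induction k generalizing n f with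
  | zero => exact ⟨f, h.base, fun y hy =>
      HasWeakDeriv.zero_self (h.base.continuous hy).locallyIntegrable⟩
  | succ k ih =>
    obtain ⟨n, rfl⟩ : ∃ l, n = l + 1 := ⟨n - 1, by omega⟩
    obtain ⟨h1, f', h2, h3⟩ := h
    obtain ⟨g, hg, hw⟩ := ih h3 (by omega)
    exact ⟨g, hg, fun y hy => HasWeakDeriv.of_hasDerivAt (h2 y hy) (h3.base.continuous hy) (hw y hy)⟩

lemma Tame.memHs {Y : Type*} [TopologicalSpace Y] {S : Set Y} {n : ℕ}
    {f : Y → ℝ → E} (h : Tame S decay n f) {y : Y} (hy : y ∈ S) : MemHs n (f y) := fun k hk => by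
  obtain ⟨g, hg, hw⟩ := h.exists_hasWeakDeriv hk
  exact ⟨g y, hw y hy, hg.memLp hy⟩

/-- Joint continuity gives pointwise convergence, and the locally uniform weight gives the majorant.
-/
lemma TameBase.tendsto_eLpNorm {E : Type*} [NormedAddCommGroup E] {S : Set ℝ} {g : ℝ → ℝ → E} (h : TameBase S decay g) {t₀ : ℝ}
    (h₀ : t₀ ∈ S) :
    Tendsto (fun t => (eLpNorm (g t - g t₀) 2 volume).toReal) (𝓝[S] t₀) (𝓝 0) := by
  obtain ⟨C, hC⟩ := h.bound t₀ h₀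
  have hC0 := hC.self_of_nhdsWithin h₀
  have hCn : 0 ≤ C := by
    have := (norm_nonneg _).trans (hC0 0)
    exact nonneg_of_mul_nonneg_left this (decay_pos 0)
  have lim : Tendsto (fun t => ∫ x, ‖g t x - g t₀ x‖ ^ (2 : ℝ)) (𝓝[S] t₀) (𝓝 (∫ _ : ℝ, (0 : ℝ))) := by
    refine tendsto_integral_filter_of_dominated_convergence (fun x => (2 * C) ^ 2 * decay x) ?_ ?_ ?_ ?_
    · filter_upwards [self_mem_nhdsWithin] with t ht
      exact (((h.continuous ht).sub (h.continuous h₀)).norm.rpow_const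
        fun _ => Or.inr (by norm_num)).aestronglyMeasurable
    · filter_upwards [hC] with t ht
      refine Eventually.of_forall fun x => ?_
      have h1 : ‖g t x - g t₀ x‖ ≤ 2 * C * decay x :=
        (norm_sub_le _ _).trans (by linarith [ht x, hC0 x])
      rw [Real.norm_of_nonneg (by positivity), Real.rpow_two]
      calc _ ≤ (2 * C * decay x) ^ 2 := by gcongr
        _ = (2 * C) ^ 2 * decay x * decay x := by ring
        _ ≤ _ := mul_le_of_le_one_right (mul_nonneg (by positivity) (decay_pos x).le)
          (decay_le_one x)
    · have : Integrable decay volume := integrable_inv_one_add_sq' 1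
      exact this.const_mul _
    · refine Eventually.of_forall fun x => ?_
      have h1 := ((h.tendsto h₀ x).sub_const (g t₀ x)).norm.rpow_const (p := 2) (Or.inr (by norm_num))
      simpa using h1
  have e : ∀ t ∈ S, (eLpNorm (g t - g t₀) 2 volume).toReal
      = (∫ x, ‖g t x - g t₀ x‖ ^ (2 : ℝ)) ^ (2 : ℝ)⁻¹ := fun t ht => by
    have hm := (h.memLp ht).sub (h.memLp h₀)
    rw [hm.eLpNorm_eq_integral_rpow_norm (by norm_num) (by norm_num), ENNReal.toReal_ofReal]
    · simp
    · exact Real.rpow_nonneg (integral_nonneg fun _ => Real.rpow_nonneg (norm_nonneg _) _) _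
  have lim2 := lim.rpow_const (p := (2 : ℝ)⁻¹) (Or.inr (by norm_num))
  rw [integral_zero, Real.zero_rpow (by norm_num)] at lim2
  refine lim2.congr' ?_
  filter_upwards [self_mem_nhdsWithin] with t ht
  exact (e t ht).symm

lemma Tame.tendsto_normHs [CompleteSpace E] {S : Set ℝ} {s : ℕ} {f : ℝ → ℝ → E}
    (h : Tame S decay s f) {t₀ : ℝ} (h₀ : t₀ ∈ S) :
    Tendsto (fun t => normHs s (f t - f t₀)) (𝓝[S] t₀) (𝓝 0) := by
  have : Tendsto (fun t => normHs s (f t - f t₀)) (𝓝[S] t₀)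
      (𝓝 (∑ _k ∈ Finset.range (s + 1), (0 : ℝ))) := by
    unfold normHs
    refine tendsto_finsetSum _ fun k hk => ?_
    obtain ⟨g, hg, hw⟩ := h.exists_hasWeakDeriv (Nat.lt_succ_iff.1 (Finset.mem_range.1 hk))
    refine (hg.tendsto_eLpNorm h₀).congr' ?_
    filter_upwards [self_mem_nhdsWithin] with t ht
    rw [eLpNorm_congr_ae ((hw t ht).sub (hw t₀ h₀)).weakDeriv_ae_eq]
  simpa using this

end Sobolev

/-! ### Differentiation in time -/

lemma hasDerivAt_integral_smul_of_tame {T : ℝ} {f g : ℝ → ℝ → ℂ} (hf : TameBase (Ioo 0 T) decay f)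
    (hg : TameBase (Ioo 0 T) decay g)
    (hder : ∀ t ∈ Ioo 0 T, ∀ x, HasDerivAt (fun τ => f τ x) (g t x) t) {η : ℝ → ℝ}
    (hη : Continuous η) (hs : HasCompactSupport η) {t : ℝ} (ht : t ∈ Ioo 0 T) :
    HasDerivAt (fun τ => ∫ x, η x • f τ x) (∫ x, η x • g t x) t := by
  obtain ⟨C, hC⟩ := hg.bound t ht
  have hIoo := Ioo_mem_nhds ht.1 ht.2
  rw [nhdsWithin_eq_nhds.2 hIoo] at hC
  have hint : ∀ τ ∈ Ioo 0 T, Integrable (fun x => η x • f τ x) volume := fun τ hτ =>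
    integrable_test_smul hη hs (hf.continuous hτ).locallyIntegrable
  refine (hasDerivAt_integral_of_dominated_loc_of_deriv_le (F := fun τ x => η x • f τ x)
    (F' := fun τ x => η x • g τ x) (bound := fun x => |η x| * |C|) (hC.and hIoo) ?_ (hint t ht)
    (hη.smul (hg.continuous ht)).aestronglyMeasurable ?_ ?_ ?_).2
  · filter_upwards [hIoo] with τ hτ using (hint τ hτ).1
  · refine Eventually.of_forall fun x τ hτ => ?_
    rw [norm_smul, Real.norm_eq_abs]
    gcongr
    exact (hτ.1 x).trans ((mul_le_mul_of_nonneg_right (le_abs_self C) (decay_pos x).le).trans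
      (mul_le_of_le_one_right (abs_nonneg C) (decay_le_one x)))
  · exact (hη.abs.integrable_of_hasCompactSupport hs.abs).mul_const _
  · exact Eventually.of_forall fun x τ hτ => (hder τ hτ.2 x).const_smul (η x)

end

noncomputable section

/-! ### Classical solutions are solutions -/

section Vector

/-- The vector-valued function with components `f j`. -/
def vec (f : Fin 3 → ℝ → ℝ → ℂ) (t x : ℝ) : EuclideanSpace ℂ (Fin 3) :=
  WithLp.toLp 2 fun j => f j t x

lemma norm_toLp_le (v : Fin 3 → ℂ) : ‖(WithLp.toLp 2 v : EuclideanSpace ℂ (Fin 3))‖ ≤ ∑ j, ‖v j‖ := by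
  rw [EuclideanSpace.norm_eq]
  refine Real.sqrt_le_iff.2 ⟨Finset.sum_nonneg fun _ _ => norm_nonneg _, ?_⟩
  exact Finset.sum_sq_le_sq_sum_of_nonneg fun _ _ => norm_nonneg _

lemma hasDerivAt_toLp {f : ℝ → Fin 3 → ℂ} {f' : Fin 3 → ℂ} {x : ℝ}
    (h : ∀ j, HasDerivAt (fun x => f x j) (f' j) x) :
    HasDerivAt (fun x => (WithLp.toLp 2 (f x) : EuclideanSpace ℂ (Fin 3))) (WithLp.toLp 2 f') x :=
  (PiLp.continuousLinearEquiv 2 ℝ (fun _ : Fin 3 => ℂ)).symm.hasFDerivAt.comp_hasDerivAt x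
    (hasDerivAt_pi.2 h)

lemma TameBase.vec {S : Set ℝ} {ρ : ℝ → ℝ} {f : Fin 3 → ℝ → ℝ → ℂ}
    (h : ∀ j, TameBase S ρ (f j)) : TameBase S ρ (vec f) := by
  refine ⟨(PiLp.continuous_toLp 2 _).comp_continuousOn (continuousOn_pi.2 fun j => (h j).cont),
    fun y hy => ?_⟩
  choose C hC using fun j => (h j).bound y hy
  refine ⟨∑ j, C j, ?_⟩
  filter_upwards [eventually_all.2 hC] with t ht x
  rw [Finset.sum_mul]
  exact (norm_toLp_le _).trans (Finset.sum_le_sum fun j _ => ht j x)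

lemma Tame.vec {S : Set ℝ} {ρ : ℝ → ℝ} {n : ℕ} {f : Fin 3 → ℝ → ℝ → ℂ}
    (h : ∀ j, Tame S ρ n (f j)) : Tame S ρ n (vec f) := by
  induction n generalizing f with
  | zero => exact TameBase.vec h
  | succ n ih =>
    choose h1 g h2 h3 using h
    exact ⟨TameBase.vec h1, _, fun y hy x => hasDerivAt_toLp fun j => h2 j y hy x, ih h3⟩

end Vector

/-- Order `s + 1` rather than `s` is required so that even for `s = 1` there are two continuous
`x`-derivatives and `η''` can be integrated by parts. -/
theorem isSolution_of_tame {s : ℕ} {m : Fin 3 → ℝ} {Q : ℂ → ℂ → ℂ} {T : ℝ} (hs : 1 ≤ s)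
    {f fx fxx ft : Fin 3 → ℝ → ℝ → ℂ} (hf : ∀ j, Tame (Ico 0 T) decay (s + 1) (f j))
    (hx : ∀ j, ∀ t ∈ Ico 0 T, ∀ x, HasDerivAt (f j t) (fx j t x) x)
    (hxx : ∀ j, ∀ t ∈ Ico 0 T, ∀ x, HasDerivAt (fx j t) (fxx j t x) x)
    (hft : ∀ j, TameBase (Ioo 0 T) decay (ft j))
    (ht : ∀ j, ∀ t ∈ Ioo 0 T, ∀ x, HasDerivAt (fun τ => f j τ x) (ft j t x) t)
    (heq : ∀ j, ∀ t ∈ Ioo 0 T, ∀ x, Complex.I * ft j t x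
      = nonlinearity m Q (vec f t x) (vec fx t x) j - 1 / (2 * (m j : ℂ)) * fxx j t x) :
    IsSolution s m Q T (vec f 0) (vec f) := by
  have hv : Tame (Ico 0 T) decay (s + 1) (vec f) := Tame.vec hf
  have cxx : ∀ j, ∀ t ∈ Ico 0 T, Continuous (fxx j t) := fun j t htT => by
    obtain ⟨l, rfl⟩ : ∃ l, s = l + 1 := ⟨s - 1, by omega⟩
    obtain ⟨-, f', h2, -, f'', h3, h4⟩ := hf j
    have e1 : f' t = fx j t := funext fun x => (h2 t htT x).unique (hx j t htT x)
    have e2 : f'' t = fxx j t := funext fun x =>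
      (h3 t htT x).unique (by rw [e1]; exact hxx j t htT x)
    rw [← e2]
    exact h4.base.continuous htT
  have cx : ∀ j, ∀ t ∈ Ico 0 T, Continuous (fx j t) := fun j t htT =>
    continuous_iff_continuousAt.2 fun x => (hxx j t htT x).continuousAt
  refine ⟨fun t htT => hv.of_succ.memHs htT, fun t₀ h₀ => hv.of_succ.tendsto_normHs h₀,
    EventuallyEq.rfl, fun η hη hsη j t htT => ?_⟩
  have htI : t ∈ Ico 0 T := Ioo_subset_Ico_self htT
  have w1 : HasWeakDeriv 1 (vec f t) (vec fx t) := by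
    have c : Continuous (vec fx t) :=
      (PiLp.continuous_toLp 2 _).comp (continuous_pi fun j => cx j t htI)
    exact HasWeakDeriv.of_hasDerivAt (fun x => hasDerivAt_toLp fun j => hx j t htI x) c
      (HasWeakDeriv.zero_self c.locallyIntegrable)
  have w2 : HasWeakDeriv 2 (f j t) (fxx j t) :=
    HasWeakDeriv.of_hasDerivAt (hx j t htI) (cx j t htI)
      (HasWeakDeriv.of_hasDerivAt (hxx j t htI) (cxx j t htI)
        (HasWeakDeriv.zero_self (cxx j t htI).locallyIntegrable))
  have key := (hasDerivAt_integral_smul_of_tame ((hf j).base.mono Ioo_subset_Ico_self) (hft j)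
    (ht j) hη.continuous hsη htT).const_mul Complex.I
  refine key.congr_deriv ?_
  have i1 : Integrable (fun x => η x • ft j t x) volume :=
    integrable_test_smul hη.continuous hsη ((hft j).continuous htT).locallyIntegrable
  have i2 : Integrable (fun x => η x • fxx j t x) volume :=
    integrable_test_smul hη.continuous hsη (cxx j t htI).locallyIntegrable
  have e1 : ∫ x, η x • nonlinearity m Q (vec f t x) (weakDeriv 1 (vec f t) x) j
      = ∫ x, (Complex.I * (η x • ft j t x) + 1 / (2 * (m j : ℂ)) * (η x • fxx j t x)) := by
    refine integral_congr_ae ?_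
    filter_upwards [w1.weakDeriv_ae_eq] with x hxw
    simp only [hxw, Complex.real_smul]
    have := heq j t htT x
    linear_combination (-(η x : ℂ)) * this
  rw [e1, integral_add (i1.const_mul _) (i2.const_mul _), integral_const_mul, integral_const_mul]
  have e2 : ∫ x, iteratedDeriv 2 η x • vec f t x j = ∫ x, η x • fxx j t x := by
    have := w2.2.2 η hη hsη
    simpa [vec] using this
  rw [e2]
  ring

end

noncomputable section

/-! ### Gaussian solutions of the free equation -/

/-- The Gaussian `q^{-1/2} exp(-m x² / (2 q))`. -/
def gaussK (m : ℝ) (q : ℂ) (x : ℝ) : ℂ :=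
  q ^ (-(1 / 2) : ℂ) * Complex.exp (-(m / (2 * q)) * (x : ℂ) ^ 2)

/-- The first `x`-derivative of `gaussK`. -/
def gaussKx (m : ℝ) (q : ℂ) (x : ℝ) : ℂ :=
  -(m / q) * q ^ (-(1 / 2) : ℂ) * (x : ℂ) * Complex.exp (-(m / (2 * q)) * (x : ℂ) ^ 2)

/-- The second `x`-derivative of `gaussK`. -/
def gaussKxx (m : ℝ) (q : ℂ) (x : ℝ) : ℂ :=
  (m ^ 2 / q ^ 2 * (x : ℂ) ^ 2 - m / q) * q ^ (-(1 / 2) : ℂ)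
    * Complex.exp (-(m / (2 * q)) * (x : ℂ) ^ 2)

lemma ne_zero_of_re_pos {q : ℂ} (hq : 0 < q.re) : q ≠ 0 := by
  rintro rfl; simp at hq

lemma hasDerivAt_gaussK (m : ℝ) (q : ℂ) (x : ℝ) :
    HasDerivAt (gaussK m q) (gaussKx m q x) x := by
  have := (((Complex.ofRealCLM.hasDerivAt (x := x)).pow 2).const_mul (-(m / (2 * q)) : ℂ)).cexp
  refine (this.const_mul (q ^ (-(1 / 2) : ℂ))).congr_deriv ?_
  rcases eq_or_ne q 0 with rfl | hq
  · simp [gaussKx]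
  · simp only [gaussKx, Complex.ofRealCLM_apply, Pi.pow_apply]
    push_cast
    field_simp

lemma hasDerivAt_gaussKx (m : ℝ) (q : ℂ) (x : ℝ) :
    HasDerivAt (gaussKx m q) (gaussKxx m q x) x := by
  have := (((Complex.ofRealCLM.hasDerivAt (x := x)).pow 2).const_mul (-(m / (2 * q)) : ℂ)).cexp
  refine (((Complex.ofRealCLM.hasDerivAt (x := x)).const_mul
    (-(m / q) * q ^ (-(1 / 2) : ℂ))).mul this).congr_deriv ?_
  rcases eq_or_ne q 0 with rfl | hq
  · simp [gaussKxx]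
  · simp only [gaussKxx, Complex.ofRealCLM_apply, Pi.pow_apply]
    push_cast
    field_simp
    ring

/-- The heat equation in complex time `q`. Along `q = p + i t` it is the free Schrödinger equation
of mass `m`. -/
lemma hasDerivAt_gaussK_param (m : ℝ) {q : ℂ} (hq : 0 < q.re) (hm : m ≠ 0) (x : ℝ) :
    HasDerivAt (fun q => gaussK m q x) (1 / (2 * m) * gaussKxx m q x) q := by
  have hq0 := ne_zero_of_re_pos hq
  have hm' : (m : ℂ) ≠ 0 := by exact_mod_cast hm
  have h1 : HasDerivAt (fun q : ℂ => q ^ (-(1 / 2) : ℂ))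
      (-(1 / 2) * q ^ (-(1 / 2) - 1 : ℂ) * 1) q :=
    (hasDerivAt_id q).cpow_const (Or.inl hq)
  have h2 : HasDerivAt (fun q : ℂ => -(m / (2 * q)) * (x : ℂ) ^ 2)
      (m / (2 * q ^ 2) * (x : ℂ) ^ 2) q := by
    have := ((((hasDerivAt_id q).const_mul (2 : ℂ)).fun_inv
      (by simpa using hq0)).const_mul (-(m : ℂ))).mul_const ((x : ℂ) ^ 2)
    refine (this.congr_deriv ?_).congr_of_eventuallyEq (Eventually.of_forall fun q => ?_)
    · simp only [id]
      field_simp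
    · simp only [id]
      rw [div_eq_mul_inv]; ring
  refine (h1.mul h2.cexp).congr_deriv ?_
  rw [Complex.cpow_sub _ _ hq0, Complex.cpow_one, gaussKxx]
  field_simp
  ring

section TameKernel

variable {Y : Type*} [TopologicalSpace Y] {S : Set Y} {a q : Y → ℂ} {m : ℝ}

lemma continuousOn_rpow_half (hq : ContinuousOn q S) (hpos : ∀ y ∈ S, 0 < (q y).re) :
    ContinuousOn (fun y => q y ^ (-(1 / 2) : ℂ)) S := fun y hy =>
  (hq y hy).cpow continuousWithinAt_const (Or.inl (hpos y hy))

lemma re_div_pos (hm : 0 < m) {q : ℂ} (hq : 0 < q.re) : 0 < ((m : ℂ) / (2 * q)).re := by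
  have h0 : 0 < Complex.normSq q := Complex.normSq_pos.2 (ne_zero_of_re_pos hq)
  have e : (m : ℂ) / (2 * q) = ((m / 2 : ℝ) : ℂ) * q⁻¹ := by push_cast; field_simp
  rw [e, Complex.re_ofReal_mul, Complex.inv_re]
  positivity

lemma tame_gaussK (hm : 0 < m) (ha : ContinuousOn a S) (hq : ContinuousOn q S)
    (hpos : ∀ y ∈ S, 0 < (q y).re) (n : ℕ) :
    Tame S decay n (fun y x => a y * gaussK m (q y) x) := by
  have hb : ContinuousOn (fun y => (m : ℂ) / (2 * q y)) S :=
    continuousOn_const.div (continuousOn_const.mul hq) fun y hy =>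
      mul_ne_zero two_ne_zero (ne_zero_of_re_pos (hpos y hy))
  refine (tame_gaussian (ha.mul (continuousOn_rpow_half hq hpos)) hb
    (fun y hy => re_div_pos hm (hpos y hy)) n 0).congr fun y _ x => ?_
  simp only [gaussK, Pi.mul_apply]
  ring

/-- `Tame` only asserts that derivatives exist; uniqueness of derivatives transfers its bounds to
explicit ones. -/
lemma Tame.tameBase_snd {E : Type*} [NormedAddCommGroup E] [NormedSpace ℝ E] {ρ : ℝ → ℝ}
    {f fx fxx : Y → ℝ → E} (h : Tame S ρ 2 f) (hx : ∀ y ∈ S, ∀ x, HasDerivAt (f y) (fx y x) x)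
    (hxx : ∀ y ∈ S, ∀ x, HasDerivAt (fx y) (fxx y x) x) :
    TameBase S ρ fx ∧ TameBase S ρ fxx := by
  obtain ⟨-, f', h2, h2', f'', h3, h4⟩ := h
  have e1 : ∀ y ∈ S, f' y = fx y := fun y hy => funext fun x => (h2 y hy x).unique (hx y hy x)
  exact ⟨h2'.congr fun y hy x => congrFun (e1 y hy) x, TameBase.congr h4 fun y hy x =>
    (h3 y hy x).unique (by rw [e1 y hy]; exact hxx y hy x)⟩

lemma tameBase_gaussK (hm : 0 < m) (ha : ContinuousOn a S) (hq : ContinuousOn q S)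
    (hpos : ∀ y ∈ S, 0 < (q y).re) :
    TameBase S decay (fun y x => a y * gaussKx m (q y) x) ∧
      TameBase S decay (fun y x => a y * gaussKxx m (q y) x) :=
  (tame_gaussK hm ha hq hpos 2).tameBase_snd
    (fun y _ x => (hasDerivAt_gaussK m (q y) x).const_mul (a y))
    (fun y _ x => (hasDerivAt_gaussKx m (q y) x).const_mul (a y))

end TameKernel

/-! ### Duhamel integrals -/

/-- The integral up to `s` is split at the fixed `t`: the part on `[0, t]` is differentiated under
the integral sign, and the short remainder contributes the value on the diagonal. -/
lemma hasDerivAt_integral_diag {G G' : ℝ → ℝ → ℂ} (hG : Continuous fun p : ℝ × ℝ => G p.1 p.2)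
    (hG' : Continuous fun p : ℝ × ℝ => G' p.1 p.2) (hd : ∀ τ t, HasDerivAt (G τ) (G' τ t) t) (t : ℝ) :
    HasDerivAt (fun t => ∫ τ in (0 : ℝ)..t, G τ t) (G t t + ∫ τ in (0 : ℝ)..t, G' τ t) t := by
  have hGc : ∀ s, Continuous fun τ => G τ s := fun s =>
    hG.comp (by fun_prop : Continuous fun τ : ℝ => (τ, s))
  have h1 : HasDerivAt (fun s => ∫ τ in (0 : ℝ)..t, G τ s) (∫ τ in (0 : ℝ)..t, G' τ t) t := by
    obtain ⟨C, hC⟩ := ((isCompact_uIcc (a := (0 : ℝ)) (b := t)).prod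
      (isCompact_Icc (a := t - 1) (b := t + 1))).exists_bound_of_continuousOn hG'.continuousOn
    refine (intervalIntegral.hasDerivAt_integral_of_dominated_loc_of_deriv_le
      (F := fun s τ => G τ s) (F' := fun s τ => G' τ s) (bound := fun _ => C)
      (s := Icc (t - 1) (t + 1)) (Icc_mem_nhds (by linarith) (by linarith))
      (Eventually.of_forall fun s => (hGc s).aestronglyMeasurable)
      ((hGc t).intervalIntegrable _ _) ?_ (Eventually.of_forall fun τ hτ s hs => ?_) (by simp)
      (Eventually.of_forall fun τ _ s _ => hd τ s)).2
    · exact (hG'.comp (by fun_prop : Continuous fun τ : ℝ => (τ, t))).aestronglyMeasurable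
    · exact hC (τ, s) ⟨uIoc_subset_uIcc hτ, hs⟩
  have h2 : HasDerivAt (fun s => ∫ τ in t..s, G τ s) (G t t) t := by
    rw [hasDerivAt_iff_isLittleO, Asymptotics.isLittleO_iff]
    intro ε hε
    have hc : Tendsto (fun p : ℝ × ℝ => G p.1 p.2) (𝓝 (t, t)) (𝓝 (G t t)) := hG.tendsto (t, t)
    obtain ⟨δ, hδ, hball⟩ := Metric.tendsto_nhds_nhds.1 hc ε hε
    filter_upwards [Metric.ball_mem_nhds t hδ] with s hs
    rw [intervalIntegral.integral_same, sub_zero, Complex.real_smul]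
    have e : ∫ τ in t..s, (G τ s - G t t) = (∫ τ in t..s, G τ s) - ((s - t : ℝ) : ℂ) * G t t := by
      rw [intervalIntegral.integral_sub ((hGc s).intervalIntegrable _ _)
        (by simp), intervalIntegral.integral_const, Complex.real_smul]
    rw [← e, Real.norm_eq_abs]
    refine intervalIntegral.norm_integral_le_of_norm_le_const fun τ hτ => ?_
    rw [← dist_eq_norm]
    refine (hball (x := (τ, s)) ?_).le
    rw [Prod.dist_eq, max_lt_iff]
    refine ⟨?_, hs⟩
    rw [Real.dist_eq]
    rw [Metric.mem_ball, Real.dist_eq] at hs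
    exact (abs_sub_left_of_mem_uIcc (uIoc_subset_uIcc hτ)).trans_lt hs
  refine ((h2.add h1).congr_of_eventuallyEq (Eventually.of_forall fun s => ?_))
  rw [Pi.add_apply, add_comm, intervalIntegral.integral_add_adjacent_intervals] <;>
    exact (hGc s).intervalIntegrable _ _

/-- The solution with zero data of `i ∂ₜ z + ∂ₓ² z / (2 m) = - c(t) gaussK m (p(t)) x`. -/
def duhamel (m : ℝ) (c p : ℝ → ℂ) (t x : ℝ) : ℂ :=
  Complex.I * ∫ τ in (0 : ℝ)..t, c τ * gaussK m (p τ + Complex.I * (t - τ)) x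

/-- The first `x`-derivative of `duhamel`. -/
def duhamelX (m : ℝ) (c p : ℝ → ℂ) (t x : ℝ) : ℂ :=
  Complex.I * ∫ τ in (0 : ℝ)..t, c τ * gaussKx m (p τ + Complex.I * (t - τ)) x

/-- The second `x`-derivative of `duhamel`. -/
def duhamelXX (m : ℝ) (c p : ℝ → ℂ) (t x : ℝ) : ℂ :=
  Complex.I * ∫ τ in (0 : ℝ)..t, c τ * gaussKxx m (p τ + Complex.I * (t - τ)) x

/-- The substitution `τ = t θ` fixes the interval of integration, so that Duhamel integrals become
integrals over a parameter as in `Tame.integral`. -/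
lemma integral_eq_unit_interval (F : ℝ → ℂ) (t : ℝ) :
    Complex.I * ∫ τ in (0 : ℝ)..t, F τ = ∫ θ in (0 : ℝ)..1, Complex.I * t * F (t * θ) := by
  rw [intervalIntegral.integral_const_mul, mul_assoc, ← Complex.real_smul,
    intervalIntegral.smul_integral_comp_mul_left]
  simp

section Duhamel

variable {m : ℝ} {c p : ℝ → ℂ}

lemma duhamel_zero (x : ℝ) : duhamel m c p 0 x = 0 := by simp [duhamel]

lemma continuous_duhamel_param (hp : Continuous p) :
    Continuous fun y : ℝ × ℝ => p (y.1 * y.2) + Complex.I * (y.1 - (y.1 * y.2 : ℝ)) := by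
  fun_prop

lemma re_duhamel_param (hpos : ∀ t, 0 < (p t).re) (s t : ℝ) :
    0 < (p s + Complex.I * (t - s)).re := by
  have : (Complex.I * ((t : ℂ) - s)).re = 0 := by
    rw [← Complex.ofReal_sub, Complex.I_mul_re, Complex.ofReal_im, neg_zero]
  rw [Complex.add_re, this, add_zero]
  exact hpos s

lemma duhamel_eq (t x : ℝ) : duhamel m c p t x = ∫ θ in (0 : ℝ)..1,
    Complex.I * t * c (t * θ) * gaussK m (p (t * θ) + Complex.I * (t - (t * θ : ℝ))) x := by
  rw [duhamel, integral_eq_unit_interval]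
  simp only [mul_assoc]

lemma duhamelX_eq (t x : ℝ) : duhamelX m c p t x = ∫ θ in (0 : ℝ)..1,
    Complex.I * t * c (t * θ) * gaussKx m (p (t * θ) + Complex.I * (t - (t * θ : ℝ))) x := by
  rw [duhamelX, integral_eq_unit_interval]
  simp only [mul_assoc]

lemma duhamelXX_eq (t x : ℝ) : duhamelXX m c p t x = ∫ θ in (0 : ℝ)..1,
    Complex.I * t * c (t * θ) * gaussKxx m (p (t * θ) + Complex.I * (t - (t * θ : ℝ))) x := by
  rw [duhamelXX, integral_eq_unit_interval]
  simp only [mul_assoc]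

lemma tame_duhamel (hm : 0 < m) (hc : Continuous c) (hp : Continuous p)
    (hpos : ∀ t, 0 < (p t).re) (n : ℕ) : Tame univ decay n (duhamel m c p) := by
  have ha : Continuous fun y : ℝ × ℝ => Complex.I * y.1 * c (y.1 * y.2) := by fun_prop
  exact (tame_gaussK hm ha.continuousOn (continuous_duhamel_param hp).continuousOn
    (fun y _ => re_duhamel_param hpos _ _) n).integral.congr fun t _ x => (duhamel_eq t x).symm

lemma hasDerivAt_duhamel_x (hm : 0 < m) (hc : Continuous c) (hp : Continuous p)
    (hpos : ∀ t, 0 < (p t).re) (t x : ℝ) :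
    HasDerivAt (duhamel m c p t) (duhamelX m c p t x) x ∧
      HasDerivAt (duhamelX m c p t) (duhamelXX m c p t x) x := by
  have ha : Continuous fun y : ℝ × ℝ => Complex.I * y.1 * c (y.1 * y.2) := by fun_prop
  have hq := (continuous_duhamel_param hp).continuousOn (s := univ)
  have hr : ∀ y ∈ (univ : Set (ℝ × ℝ)),
      0 < (p (y.1 * y.2) + Complex.I * (y.1 - (y.1 * y.2 : ℝ))).re :=
    fun y _ => re_duhamel_param hpos _ _
  have t0 := (tame_gaussK hm ha.continuousOn hq hr 0).base
  obtain ⟨t1, t2⟩ := tameBase_gaussK hm ha.continuousOn hq hr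
  have h1 := t0.hasDerivAt_integral t1 (fun y x => (hasDerivAt_gaussK m _ x).const_mul _) t x
  have h2 := t1.hasDerivAt_integral t2 (fun y x => (hasDerivAt_gaussKx m _ x).const_mul _) t x
  simp only [← duhamel_eq, ← duhamelX_eq, ← duhamelXX_eq] at h1 h2
  exact ⟨h1, h2⟩

lemma continuous_gaussK_family {q : ℝ × ℝ → ℂ} (hm : 0 < m) {x : ℝ} (hq : Continuous q)
    (hpos : ∀ y, 0 < (q y).re) :
    Continuous (fun y => gaussK m (q y) x) ∧ Continuous fun y => gaussKxx m (q y) x := by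
  have h1 := (tame_gaussK hm (continuousOn_const (c := (1 : ℂ))) hq.continuousOn (S := univ)
    (fun y _ => hpos y) 0).base
  have h2 := (tameBase_gaussK hm (continuousOn_const (c := (1 : ℂ))) hq.continuousOn (S := univ)
    (fun y _ => hpos y)).2
  simp only [one_mul] at h1 h2
  constructor
  · exact continuous_iff_continuousAt.2 fun y => by
      simpa [ContinuousAt, nhdsWithin_univ] using h1.tendsto (mem_univ y) x
  · exact continuous_iff_continuousAt.2 fun y => by
      simpa [ContinuousAt, nhdsWithin_univ] using h2.tendsto (mem_univ y) x

lemma hasDerivAt_duhamel_t (hm : 0 < m) (hc : Continuous c) (hp : Continuous p)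
    (hpos : ∀ t, 0 < (p t).re) (t x : ℝ) :
    HasDerivAt (fun t => duhamel m c p t x)
      (Complex.I * (c t * gaussK m (p t) x) + Complex.I / (2 * m) * duhamelXX m c p t x) t := by
  have hq : Continuous fun y : ℝ × ℝ => p y.1 + Complex.I * (y.2 - y.1) := by fun_prop
  obtain ⟨k1, k2⟩ := continuous_gaussK_family hm (x := x) hq fun y => re_duhamel_param hpos _ _
  have hc' : Continuous fun y : ℝ × ℝ => c y.1 := by fun_prop
  have := hasDerivAt_integral_diag
    (G := fun τ t => c τ * gaussK m (p τ + Complex.I * (t - τ)) x)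
    (G' := fun τ t => Complex.I / (2 * m) * (c τ * gaussKxx m (p τ + Complex.I * (t - τ)) x))
    (hc'.mul k1) (continuous_const.mul (hc'.mul k2)) (fun τ t => ?_) t
  · refine (this.const_mul Complex.I).congr_deriv ?_
    rw [intervalIntegral.integral_const_mul, duhamelXX]
    simp only [sub_self, mul_zero, add_zero]
    ring
  · have hin : HasDerivAt (fun t : ℝ => p τ + Complex.I * ((t : ℂ) - τ)) Complex.I t := by
      have := ((Complex.ofRealCLM.hasDerivAt (x := t)).sub_const (τ : ℂ)).const_mul Complex.I
      simpa using this.const_add (p τ)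
    have := (hasDerivAt_gaussK_param m (re_duhamel_param hpos τ t) hm.ne' x).comp t hin
    refine (this.const_mul (c τ)).congr_deriv ?_
    ring

end Duhamel

end

noncomputable section

/-! ### The explicit solution -/

/-- The amplitude of the second component: `i gain' = (1 + i t)^{-1/2}`, `gain 0 = 0`. -/
def gain (t : ℝ) : ℂ := -2 * ((1 + Complex.I * t) ^ (1 / 2 : ℂ) - 1)

lemma re_one_add_I_mul_pos (t : ℝ) : 0 < (1 + Complex.I * (t : ℂ)).re := by simp

lemma gain_zero : gain 0 = 0 := by simp [gain]

lemma hasDerivAt_one_add_I_mul (t : ℝ) :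
    HasDerivAt (fun t : ℝ => 1 + Complex.I * (t : ℂ)) Complex.I t := by
  simpa using ((Complex.ofRealCLM.hasDerivAt (x := t)).const_mul Complex.I).const_add 1

lemma hasDerivAt_gain (t : ℝ) :
    HasDerivAt gain (-Complex.I * (1 + Complex.I * t) ^ (-(1 / 2) : ℂ)) t := by
  have h := ((hasDerivAt_id (1 + Complex.I * (t : ℂ))).cpow_const (c := (1 / 2 : ℂ))
    (Or.inl (re_one_add_I_mul_pos t))).comp t (hasDerivAt_one_add_I_mul t)
  refine ((h.sub_const 1).const_mul (-2)).congr_deriv ?_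
  norm_num
  ring

lemma continuous_gain : Continuous gain :=
  continuous_iff_continuousAt.2 fun t => (hasDerivAt_gain t).continuousAt

/-- The three components of the solution: two Gaussians and the Cole–Hopf transform of `B • Z`. -/
def explicitSol (m : Fin 3 → ℝ) (A B : ℂ) (Z : ℝ → ℝ → ℂ) : Fin 3 → ℝ → ℝ → ℂ :=
  ![fun t x => A * gaussK (m 0) (1 + Complex.I * t) x,
    fun t x => A ^ 2 * gain t * gaussK (m 1) (1 + Complex.I * t) x,
    fun t x => -(1 / (2 * (m 2 : ℂ))) * Complex.log (1 + B * Z t x)]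

/-- The first component of the data, before scaling. -/
def gaussData (m : ℝ) (x : ℝ) : EuclideanSpace ℂ (Fin 3) := WithLp.toLp 2 ![gaussK m 1 x, 0, 0]

lemma forall_fin_three' {P : Fin 3 → Prop} (h0 : P 0) (h1 : P 1) (h2 : P 2) : ∀ j, P j
  | 0 => h0
  | 1 => h1
  | 2 => h2

lemma vec_explicitSol_zero {m : Fin 3 → ℝ} {A B : ℂ} {Z : ℝ → ℝ → ℂ} (hZ : ∀ x, Z 0 x = 0) :
    vec (explicitSol m A B Z) 0 = A • gaussData (m 0) := by
  funext x
  ext j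
  revert j
  refine forall_fin_three' ?_ ?_ ?_ <;> simp [vec, explicitSol, gaussData, gain_zero, hZ]

/-- Multiplication adds the masses. This is the origin of the mass ratios: a product of free
Gaussians is, up to a factor depending on time, a free Gaussian of the next equation. -/
lemma gaussK_mul (m m' : ℝ) {q : ℂ} (hq : q ≠ 0) (x : ℝ) :
    gaussK m q x * gaussK m' q x = q ^ (-(1 / 2) : ℂ) * gaussK (m + m') q x := by
  unfold gaussK
  rw [mul_mul_mul_comm, ← Complex.exp_add, mul_assoc]
  congr 3
  push_cast
  field_simp
  ring

lemma gaussK_sq {m : ℝ} {q : ℂ} (hq : q ≠ 0) (x : ℝ) :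
    gaussK m q x ^ 2 = q ^ (-(1 / 2) : ℂ) * gaussK (2 * m) q x := by
  rw [sq, gaussK_mul m m hq, two_mul]

/-- By `hQ` and `hprof` the source of the third equation is `B c(t)` times a Gaussian, which `B *
duhamel` integrates. With `z = B * duhamel` one has `e^{2 m₃ u₃} = (1 + z)⁻¹`, so the third equation
reduces to the linear one for `z`; `hlt` keeps `1 + z` off the cut of the logarithm. -/
theorem isSolution_explicitSol {s : ℕ} {m : Fin 3 → ℝ} {Q : ℂ → ℂ → ℂ} {T : ℝ} {A B : ℂ}
    {c p : ℝ → ℂ} (hs : 1 ≤ s) (hm : ∀ j, 0 < m j) (hm1 : m 1 = 2 * m 0)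
    (hQ : ∀ z₁ z₂, Q (A * z₁) (A ^ 2 * z₂) = B * Q z₁ z₂)
    (hc : Continuous c) (hp : Continuous p) (hpos : ∀ t, 0 < (p t).re)
    (hprof : ∀ (t x : ℝ), Q (gaussK (m 0) (1 + Complex.I * t) x)
      (gain t * gaussK (m 1) (1 + Complex.I * t) x) = c t * gaussK (m 2) (p t) x)
    (hlt : ∀ t ∈ Ico 0 T, ∀ x, ‖B * duhamel (m 2) c p t x‖ < 1) :
    IsSolution s m Q T (A • gaussData (m 0)) (vec (explicitSol m A B (duhamel (m 2) c p))) := by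
  have hσ : ∀ S : Set ℝ, ContinuousOn (fun t : ℝ => 1 + Complex.I * (t : ℂ)) S := fun S => by
    fun_prop
  have hσp : ∀ S : Set ℝ, ∀ t ∈ S, 0 < (1 + Complex.I * (t : ℂ)).re := fun S t _ =>
    re_one_add_I_mul_pos t
  have hg : ∀ (S : Set ℝ), ContinuousOn (fun t : ℝ => A ^ 2 * gain t) S := fun S =>
    (continuous_const.mul continuous_gain).continuousOn
  have m2 : (m 2 : ℂ) ≠ 0 := by exact_mod_cast (hm 2).ne'
  have m1 : (m 1 : ℂ) ≠ 0 := by exact_mod_cast (hm 1).ne'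
  have m0 : (m 0 : ℂ) ≠ 0 := by exact_mod_cast (hm 0).ne'
  have hz : Tame (Ico 0 T) decay (s + 1) (fun t x => B * duhamel (m 2) c p t x) :=
    ((tame_duhamel (hm 2) hc hp hpos (s + 1)).mono (subset_univ _)).const_mul B
  have hslit : ∀ t ∈ Ico 0 T, ∀ x, 1 + B * duhamel (m 2) c p t x ∈ Complex.slitPlane :=
    fun t ht x => Complex.mem_slitPlane_of_norm_lt_one (hlt t ht x)
  have hne : ∀ t ∈ Ico 0 T, ∀ x, 1 + B * duhamel (m 2) c p t x ≠ 0 :=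
    fun t ht x => Complex.slitPlane_ne_zero (hslit t ht x)
  have dx := fun t x => hasDerivAt_duhamel_x (hm 2) hc hp hpos t x
  rw [← vec_explicitSol_zero (m := m) (A := A) (B := B) (Z := duhamel (m 2) c p) duhamel_zero]
  refine isSolution_of_tame hs
    (fx := ![fun t x => A * gaussKx (m 0) (1 + Complex.I * t) x,
      fun t x => A ^ 2 * gain t * gaussKx (m 1) (1 + Complex.I * t) x,
      fun t x => -(1 / (2 * (m 2 : ℂ))) *
        (B * duhamelX (m 2) c p t x / (1 + B * duhamel (m 2) c p t x))])
    (fxx := ![fun t x => A * gaussKxx (m 0) (1 + Complex.I * t) x,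
      fun t x => A ^ 2 * gain t * gaussKxx (m 1) (1 + Complex.I * t) x,
      fun t x => -(1 / (2 * (m 2 : ℂ))) *
        ((B * duhamelXX (m 2) c p t x * (1 + B * duhamel (m 2) c p t x)
          - B * duhamelX (m 2) c p t x * (B * duhamelX (m 2) c p t x))
          / (1 + B * duhamel (m 2) c p t x) ^ 2)])
    (ft := ![fun t x => A * Complex.I / (2 * m 0) * gaussKxx (m 0) (1 + Complex.I * t) x,
      fun t x => A ^ 2 * (-Complex.I * (1 + Complex.I * t) ^ (-(1 / 2) : ℂ))
          * gaussK (m 1) (1 + Complex.I * t) x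
        + A ^ 2 * gain t * Complex.I / (2 * m 1) * gaussKxx (m 1) (1 + Complex.I * t) x,
      fun t x => (1 + B * duhamel (m 2) c p t x)⁻¹ * (-(1 / (2 * (m 2 : ℂ))) * (B *
        (Complex.I * c t * gaussK (m 2) (p t) x
          + Complex.I / (2 * m 2) * duhamelXX (m 2) c p t x)))])
    (forall_fin_three' ?_ ?_ ?_) (forall_fin_three' ?_ ?_ ?_) (forall_fin_three' ?_ ?_ ?_)
    (forall_fin_three' ?_ ?_ ?_) (forall_fin_three' ?_ ?_ ?_) (forall_fin_three' ?_ ?_ ?_)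
  · exact tame_gaussK (hm 0) continuousOn_const (hσ _) (hσp _) _
  · exact tame_gaussK (hm 1) (hg _) (hσ _) (hσp _) _
  · exact (hz.log_one_add hlt).const_mul _
  · exact fun t _ x => (hasDerivAt_gaussK (m 0) _ x).const_mul A
  · exact fun t _ x => (hasDerivAt_gaussK (m 1) _ x).const_mul _
  · exact fun t ht x =>
      ((((dx t x).1.const_mul B).const_add 1).clog_real (hslit t ht x)).const_mul _
  · exact fun t _ x => (hasDerivAt_gaussKx (m 0) _ x).const_mul A
  · exact fun t _ x => (hasDerivAt_gaussKx (m 1) _ x).const_mul _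
  · exact fun t ht x => ((((dx t x).2.const_mul B).div
      (((dx t x).1.const_mul B).const_add 1) (hne t ht x))).const_mul _
  · exact (tameBase_gaussK (hm 0) continuousOn_const (hσ _) (hσp _)).2
  · refine TameBase.add (tame_gaussK (hm 1) ?_ (hσ _) (hσp _) 0).base
      (tameBase_gaussK (hm 1) ?_ (hσ _) (hσp _)).2
    · exact continuousOn_const.mul (continuousOn_const.mul
        (continuousOn_rpow_half (hσ _) (hσp _)))
    · exact ((hg _).mul continuousOn_const).div_const _
  · have k1 : Tame (Ioo 0 T) decay 0 (fun t x => Complex.I * c t * gaussK (m 2) (p t) x) :=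
      tame_gaussK (hm 2) (continuous_const.mul hc).continuousOn hp.continuousOn
        (fun t _ => hpos t) 0
    have k2 : Tame (Ioo 0 T) decay 0 (duhamelXX (m 2) c p) :=
      ((tame_duhamel (hm 2) hc hp hpos 2).tameBase_snd (fun t _ x => (dx t x).1)
        (fun t _ x => (dx t x).2)).2.mono (subset_univ _)
    have k3 : Tame (Ioo 0 T) (fun _ => 1) 0 (fun t x => (1 + B * duhamel (m 2) c p t x)⁻¹) :=
      (((hz.of_le (Nat.zero_le _)).inv_one_add hne)).mono Ioo_subset_Ico_self
    exact (k3.one_mul_decay (((k1.add (k2.const_mul _)).const_mul B).const_mul _)).base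
  · intro t _ x
    refine (((hasDerivAt_gaussK_param (m 0) (re_one_add_I_mul_pos t) (hm 0).ne' x).comp t
      (hasDerivAt_one_add_I_mul t)).const_mul A).congr_deriv ?_
    simp only [Matrix.cons_val_zero]
    ring
  · intro t _ x
    have h1 := (hasDerivAt_gaussK_param (m 1) (re_one_add_I_mul_pos t) (hm 1).ne' x).comp t
      (hasDerivAt_one_add_I_mul t)
    refine (((hasDerivAt_gain t).const_mul (A ^ 2)).mul h1).congr_deriv ?_
    simp only [Matrix.cons_val_one, Matrix.cons_val_zero, Function.comp]
    ring
  · intro t ht x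
    have h1 := ((((hasDerivAt_duhamel_t (hm 2) hc hp hpos t x).const_mul B).const_add 1).clog_real
      (hslit t (Ioo_subset_Ico_self ht) x)).const_mul (-(1 / (2 * (m 2 : ℂ))))
    refine h1.congr_deriv ?_
    simp only [Matrix.cons_val]
    ring
  · intro t _ x
    simp only [nonlinearity, Matrix.cons_val_zero]
    field_simp
    linear_combination A * gaussKxx (m 0) (1 + Complex.I * t) x * Complex.I_sq
  · intro t _ x
    have hsq := gaussK_sq (m := m 0) (ne_zero_of_re_pos (re_one_add_I_mul_pos t)) x
    rw [← hm1] at hsq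
    simp only [nonlinearity, vec, explicitSol, Matrix.cons_val_one, Matrix.cons_val_zero]
    rw [mul_pow, hsq]
    field_simp
    ring_nf
    simp only [Complex.I_sq]
    ring
  · intro t ht x
    have hw := hne t (Ioo_subset_Ico_self ht) x
    have hexp : Complex.exp (2 * (m 2 : ℂ) * (-(1 / (2 * (m 2 : ℂ))) *
        Complex.log (1 + B * duhamel (m 2) c p t x))) = (1 + B * duhamel (m 2) c p t x)⁻¹ := by
      rw [← Complex.exp_log hw, ← Complex.exp_neg, Complex.exp_log hw]
      congr 1
      field_simp
    simp only [nonlinearity, vec, explicitSol, Matrix.cons_val]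
    rw [hexp, mul_assoc (A ^ 2), hQ, hprof]
    field_simp
    ring_nf
    simp only [Complex.I_sq]
    ring

end

noncomputable section

/-! ### Size of the data -/

section Scaling

variable {f g : ℝ → EuclideanSpace ℂ (Fin 3)} {k s : ℕ}

lemma HasWeakDeriv.const_smul (h : HasWeakDeriv k f g) (A : ℂ) :
    HasWeakDeriv k (A • f) (A • g) := by
  refine ⟨h.1.smul A, h.2.1.smul A, fun η hη hs => ?_⟩
  have := congrArg (fun v => A • v) (h.2.2 η hη hs)
  simp only [Pi.smul_apply, smul_comm _ A, integral_smul] at this ⊢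
  exact this

lemma MemHs.const_smul (h : MemHs s f) (A : ℂ) : MemHs s (A • f) := fun k hk => by
  obtain ⟨g, hg, hL⟩ := h k hk
  exact ⟨A • g, hg.const_smul A, hL.const_smul A⟩

lemma MemHs.normHs_const_smul (h : MemHs s f) (A : ℂ) : normHs s (A • f) = ‖A‖ * normHs s f := by
  unfold normHs
  rw [Finset.mul_sum]
  refine Finset.sum_congr rfl fun k hk => ?_
  have hw := h.hasWeakDeriv (Nat.lt_succ_iff.1 (Finset.mem_range.1 hk))
  rw [eLpNorm_congr_ae (hw.const_smul A).weakDeriv_ae_eq, eLpNorm_const_smul, ENNReal.toReal_mul,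
    toReal_enorm]

lemma tame_gaussData {m : ℝ} (hm : 0 < m) (n : ℕ) :
    Tame (univ : Set ℝ) decay n (fun _ => gaussData m) := by
  have h0 : Tame (univ : Set ℝ) decay n (fun _ => gaussK m 1) := by
    simpa using tame_gaussK (Y := ℝ) (S := univ) (a := fun _ => 1) (q := fun _ => 1) hm
      continuousOn_const continuousOn_const (by simp) n
  have hz : Tame (univ : Set ℝ) decay n (fun _ _ => (0 : ℂ)) := by simpa using h0.const_mul 0
  refine (Tame.vec (f := ![fun _ => gaussK m 1, fun _ _ => 0, fun _ _ => 0])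
    (forall_fin_three' h0 hz hz)).congr fun t _ x => ?_
  ext j
  revert j
  refine forall_fin_three' ?_ ?_ ?_ <;> simp [vec, gaussData]

lemma memHs_gaussData {m : ℝ} (hm : 0 < m) (s : ℕ) : MemHs s (gaussData m) :=
  (tame_gaussData hm s).memHs (mem_univ (0 : ℝ))

lemma normHs_gaussData_pos {m : ℝ} (hm : 0 < m) (s : ℕ) : 0 < normHs s (gaussData m) := by
  have hM := memHs_gaussData hm s
  have hc : Continuous (gaussData m) := (tame_gaussData hm 0).base.continuous (mem_univ (0 : ℝ))
  refine lt_of_lt_of_le ?_ (eLpNorm_weakDeriv_le_normHs (Nat.zero_le s) (gaussData m))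
  rw [eLpNorm_congr_ae hM.weakDeriv_zero_ae_eq]
  refine ENNReal.toReal_pos (fun h0 => ?_) hM.memLp.eLpNorm_ne_top
  have hae := (eLpNorm_eq_zero_iff hc.aestronglyMeasurable (by norm_num)).1 h0
  have hzero := Continuous.ae_eq_iff_eq volume hc continuous_const |>.1 hae
  have := congrArg (fun v : EuclideanSpace ℂ (Fin 3) => v 0) (congrFun hzero 0)
  simp [gaussData, gaussK] at this

end Scaling

/-! ### Blow-up -/

/-- Continuity upgrades the almost everywhere Sobolev bound to every point, in particular to the
point of blow-up. The factor `2` pays for bounding the function and its derivative separately by the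
full norm. -/
lemma norm_coord_le_normHs {s : ℕ} (hs : 1 ≤ s) {f : ℝ → EuclideanSpace ℂ (Fin 3)}
    (h : MemHs s f) (hc : Continuous f) (j : Fin 3) (x : ℝ) : ‖f x j‖ ≤ 2 * normHs s f := by
  have hae := (h.h1Pair hs j).norm_le
  have hcj : Continuous fun x => f x j := (EuclideanSpace.proj (𝕜 := ℂ) j).continuous.comp hc
  have hle : l2norm (fun x => f x j) + l2norm (fun x => weakDeriv 1 f x j) ≤ 2 * normHs s f := by
    have h0 := l2norm_coord_le h.memLp j
    have h1 := l2norm_coord_le (h.memLp_weakDeriv hs) j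
    have h2 := eLpNorm_weakDeriv_le_normHs (Nat.zero_le s) f
    rw [eLpNorm_congr_ae h.weakDeriv_zero_ae_eq] at h2
    have h3 := eLpNorm_weakDeriv_le_normHs hs f
    linarith
  have hclosed : IsClosed {x | ‖f x j‖ ≤ 2 * normHs s f} :=
    isClosed_le hcj.norm continuous_const
  have hd : Dense {x | ‖f x j‖ ≤ 2 * normHs s f} :=
    Measure.dense_of_ae (μ := volume) (hae.mono fun x hx => hx.trans hle)
  have := hclosed.closure_eq ▸ hd x
  exact this

/-- The decay in `x` confines the set where `0 ≤ t ≤ t₂` and `‖Z‖ ≥ L` to a compact set, on which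
`t` attains its minimum. Equality at the minimum follows by continuity from earlier times. -/
lemma exists_first_time {Z : ℝ → ℝ → ℂ} (hZ : TameBase univ decay Z) (h0 : ∀ x, Z 0 x = 0)
    {L t₂ x₂ : ℝ} (hL : 0 < L) (ht₂ : 0 ≤ t₂) (hbig : L ≤ ‖Z t₂ x₂‖) :
    ∃ T x₀, 0 < T ∧ T ≤ t₂ ∧ ‖Z T x₀‖ = L ∧ ∀ t ∈ Ico 0 T, ∀ x, ‖Z t x‖ < L := by
  obtain ⟨C, hC⟩ : ∃ C, ∀ t ∈ Icc 0 t₂, ∀ x, ‖Z t x‖ ≤ C * decay x := by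
    refine (isCompact_Icc (a := (0 : ℝ)) (b := t₂)).induction_on
      (p := fun s => ∃ C, ∀ t ∈ s, ∀ x, ‖Z t x‖ ≤ C * decay x) ⟨0, by simp⟩ ?_ ?_ ?_
    · rintro s s' hss ⟨C, hC⟩
      exact ⟨C, fun t ht => hC t (hss ht)⟩
    · rintro s s' ⟨C, hC⟩ ⟨D, hD⟩
      refine ⟨max C D, fun t ht x => ?_⟩
      have := (decay_pos x).le
      rcases ht with ht | ht
      · exact (hC t ht x).trans (by gcongr; exact le_max_left _ _)
      · exact (hD t ht x).trans (by gcongr; exact le_max_right _ _)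
    · intro t _
      obtain ⟨C, hC⟩ := hZ.bound t (mem_univ t)
      rw [nhdsWithin_univ] at hC
      exact ⟨_, mem_nhdsWithin_of_mem_nhds hC, C, fun t ht => ht⟩
  have hcont : Continuous fun q : ℝ × ℝ => Z q.1 q.2 := by
    rw [← continuousOn_univ, ← univ_prod_univ]
    exact hZ.cont
  set R := |C| / L + 1 with hR
  have hRpos : 1 ≤ R := by have := div_nonneg (abs_nonneg C) hL.le; linarith
  have hmem : ∀ t ∈ Icc 0 t₂, ∀ x, L ≤ ‖Z t x‖ → x ∈ Icc (-R) R := by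
    intro t ht x hx
    have h1 : L * (1 + x ^ 2) ≤ |C| := by
      have h2 := hx.trans (hC t ht x)
      unfold decay at h2
      rw [mul_one_div, le_div_iff₀ (by positivity)] at h2
      exact h2.trans (le_abs_self C)
    have h3 : 1 + x ^ 2 ≤ |C| / L := by rw [le_div_iff₀ hL]; linarith
    rw [mem_Icc, ← abs_le]
    nlinarith [sq_abs x, sq_nonneg (|x| - 1), abs_nonneg x]
  set S := (Icc 0 t₂ ×ˢ Icc (-R) R) ∩ {q : ℝ × ℝ | L ≤ ‖Z q.1 q.2‖} with hS
  have hScomp : IsCompact S :=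
    (isCompact_Icc.prod isCompact_Icc).inter_right (isClosed_le continuous_const hcont.norm)
  have hSne : S.Nonempty :=
    ⟨(t₂, x₂), ⟨⟨ht₂, le_rfl⟩, hmem t₂ ⟨ht₂, le_rfl⟩ x₂ hbig⟩, hbig⟩
  obtain ⟨⟨T, x₀⟩, ⟨⟨hT, -⟩, hTL⟩, hmin⟩ := hScomp.exists_isMinOn hSne continuous_fst.continuousOn
  simp only [mem_ofPred_eq] at hT hTL
  have hbelow : ∀ t ∈ Ico 0 T, ∀ x, ‖Z t x‖ < L := by
    intro t ht x
    by_contra! hge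
    have htI : t ∈ Icc 0 t₂ := ⟨ht.1, ht.2.le.trans hT.2⟩
    have := hmin (a := (t, x)) ⟨⟨htI, hmem t htI x hge⟩, hge⟩
    exact absurd ht.2 (not_lt.2 this)
  have hTpos : 0 < T := by
    refine lt_of_le_of_ne hT.1 fun hT0 => ?_
    rw [← hT0, h0, norm_zero] at hTL
    exact absurd hL (not_lt.2 hTL)
  refine ⟨T, x₀, hTpos, hT.2, le_antisymm ?_ hTL, hbelow⟩
  have hl : Tendsto (fun t => ‖Z t x₀‖) (𝓝[<] T) (𝓝 ‖Z T x₀‖) :=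
    ((hcont.comp (by fun_prop : Continuous fun t : ℝ => (t, x₀))).norm.tendsto T).mono_left
      nhdsWithin_le_nhds
  refine le_of_tendsto hl ?_
  filter_upwards [Ioo_mem_nhdsLT hTpos] with t ht
  exact (hbelow t ⟨ht.1.le, ht.2⟩ x₀).le

/-- At the single point `x₀` the quantity `1 + z` tends to zero, so `|log (1 + z)| ≥ -log |1 + z|`
tends to infinity, and the `Hˢ` norm controls the value at `x₀`. -/
theorem solutionBlowsUpAt_of_eq_neg_one {s : ℕ} {m : Fin 3 → ℝ} {Q : ℂ → ℂ → ℂ} {T x₀ : ℝ}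
    {A B : ℂ} {c p : ℝ → ℂ} (hs : 1 ≤ s) (hm : ∀ j, 0 < m j) (hm1 : m 1 = 2 * m 0)
    (hQc : Continuous fun p : ℂ × ℂ => Q p.1 p.2) (hQb : ∀ a b, ‖Q a b‖ ≤ ‖a‖ ^ 2 + ‖b‖ ^ 2)
    (hQ : ∀ z₁ z₂, Q (A * z₁) (A ^ 2 * z₂) = B * Q z₁ z₂)
    (hc : Continuous c) (hp : Continuous p) (hpos : ∀ t, 0 < (p t).re)
    (hprof : ∀ (t x : ℝ), Q (gaussK (m 0) (1 + Complex.I * t) x)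
      (gain t * gaussK (m 1) (1 + Complex.I * t) x) = c t * gaussK (m 2) (p t) x)
    (hT : 0 < T) (hlt : ∀ t ∈ Ico 0 T, ∀ x, ‖B * duhamel (m 2) c p t x‖ < 1)
    (hend : B * duhamel (m 2) c p T x₀ = -1) :
    SolutionBlowsUpAt s m Q (A • gaussData (m 0)) T := by
  have hsol := isSolution_explicitSol hs hm hm1 hQ hc hp hpos hprof hlt
  set u := vec (explicitSol m A B (duhamel (m 2) c p)) with hu
  refine ⟨u, ⟨hsol, fun T' hT' w hw => hw.unique hQc hQb hm hs (hsol.mono hT')⟩, ?_⟩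
  set z := fun t => 1 + B * duhamel (m 2) c p t x₀ with hz
  have hzc : Continuous z := continuous_const.add (continuous_const.mul
    (continuous_iff_continuousAt.2 fun t => (hasDerivAt_duhamel_t (hm 2) hc hp hpos t x₀).continuousAt))
  have hzT : Tendsto (fun t => ‖z t‖) (𝓝[<] T) (𝓝[>] 0) := by
    refine tendsto_nhdsWithin_iff.2 ⟨?_, ?_⟩
    · have := (hzc.norm.tendsto T).mono_left (nhdsWithin_le_nhds (s := Iio T))
      simpa [hz, hend] using this
    · filter_upwards [Ioo_mem_nhdsLT hT] with t ht
      exact norm_pos_iff.2 (Complex.slitPlane_ne_zero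
        (Complex.mem_slitPlane_of_norm_lt_one (hlt t ⟨ht.1.le, ht.2⟩ x₀)))
  -- The coefficient is `1 / (2 m₃)` from the formula for the third component, halved by the factor
  -- `2` of `norm_coord_le_normHs`.
  have hlog : Tendsto (fun t => 1 / (4 * m 2) * -Real.log ‖z t‖) (𝓝[<] T) atTop :=
    (tendsto_neg_atBot_atTop.comp (Real.tendsto_log_nhdsGT_zero.comp hzT)).const_mul_atTop
      (by have := hm 2; positivity)
  refine tendsto_atTop_mono' _ ?_ hlog
  filter_upwards [Ioo_mem_nhdsLT hT] with t ht
  have htI : t ∈ Ico 0 T := ⟨ht.1.le, ht.2⟩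
  have hcu : Continuous (u t) := by
    have hσ : ContinuousOn (fun t : ℝ => 1 + Complex.I * (t : ℂ)) (Ico 0 T) := by fun_prop
    have hz : Tame (Ico 0 T) decay 0 (fun t x => B * duhamel (m 2) c p t x) :=
      ((tame_duhamel (hm 2) hc hp hpos 0).mono (subset_univ _)).const_mul B
    refine TameBase.continuous (S := Ico 0 T) (ρ := decay)
      (TameBase.vec (forall_fin_three' ?_ ?_ ?_)) htI
    · exact (tame_gaussK (hm 0) continuousOn_const hσ (fun t _ => re_one_add_I_mul_pos t) 0).base
    · exact (tame_gaussK (hm 1) (continuous_const.mul continuous_gain).continuousOn hσ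
        (fun t _ => re_one_add_I_mul_pos t) 0).base
    · exact ((hz.log_one_add hlt).const_mul _).base
  have h1 := norm_coord_le_normHs hs (hsol.memHs t htI) hcu 2 x₀
  have h2 : u t x₀ 2 = -(1 / (2 * (m 2 : ℂ))) * Complex.log (z t) := rfl
  have h3 : -Real.log ‖z t‖ ≤ ‖Complex.log (z t)‖ := by
    rw [← Complex.log_re]
    exact (neg_le_abs _).trans (Complex.abs_re_le_norm _)
  have h4 : ‖u t x₀ 2‖ = 1 / (2 * m 2) * ‖Complex.log (z t)‖ := by
    have := hm 2
    rw [h2, norm_mul, norm_neg, norm_div, norm_mul, norm_one, Complex.norm_real,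
      Real.norm_of_nonneg this.le]
    norm_num
  have h5 : 1 / (2 * m 2) * -Real.log ‖z t‖ ≤ 2 * normHs s (u t) := by
    refine le_trans ?_ (h4 ▸ h1)
    have := hm 2
    gcongr
  have h6 : 1 / (4 * m 2) * -Real.log ‖z t‖ = (1 / (2 * m 2) * -Real.log ‖z t‖) / 2 := by ring
  rw [h6]
  linarith

/-- Only the modulus `rᵈ` of `B` enters the choice of the first time `T` at which `rᵈ ‖duhamel‖`
reaches `1`. The phase `w` is chosen afterwards, so as to turn the value at `(T, x₀)` into `-1`;
`hQ` realizes it by a phase of the data, which does not affect the norm. -/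
theorem exists_blowUp {s : ℕ} {m : Fin 3 → ℝ} {Q : ℂ → ℂ → ℂ} {c p : ℝ → ℂ} {d e : ℕ}
    {C c₀ t₁ : ℝ} (hs : 1 ≤ s) (hm : ∀ j, 0 < m j) (hm1 : m 1 = 2 * m 0)
    (hQc : Continuous fun p : ℂ × ℂ => Q p.1 p.2) (hQb : ∀ a b, ‖Q a b‖ ≤ ‖a‖ ^ 2 + ‖b‖ ^ 2)
    (hQ : ∀ r : ℝ, 0 < r → ∀ w : ℂ, ‖w‖ = 1 → ∃ A : ℂ, ‖A‖ = r ∧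
      ∀ z₁ z₂, Q (A * z₁) (A ^ 2 * z₂) = r ^ d * w * Q z₁ z₂)
    (hc : Continuous c) (hp : Continuous p) (hpos : ∀ t, 0 < (p t).re)
    (hprof : ∀ (t x : ℝ), Q (gaussK (m 0) (1 + Complex.I * t) x)
      (gain t * gaussK (m 1) (1 + Complex.I * t) x) = c t * gaussK (m 2) (p t) x)
    (he : e ≠ 0) (hC : 0 < C) (hup : ∀ t, 0 ≤ t → ∀ x, ‖duhamel (m 2) c p t x‖ ^ e ≤ C * t)
    (hc₀ : 0 < c₀) (hlow : ∀ t, t₁ ≤ t → c₀ * t ≤ ‖duhamel (m 2) c p t 0‖ ^ e) :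
    ∃ κ K : ℝ, 0 < κ ∧ 0 < K ∧ ∀ ε : ℝ, 0 < ε → ε ≤ 1 →
      ∃ φ : ℝ → EuclideanSpace ℂ (Fin 3), MemHs s φ ∧ normHs s φ = ε ∧
        ∃ T : ℝ, κ / ε ^ (d * e) < T ∧ T < K / ε ^ (d * e) ∧ SolutionBlowsUpAt s m Q φ T := by
  have hM := memHs_gaussData (hm 0) s
  set N := normHs s (gaussData (m 0)) with hN
  have hNpos : 0 < N := normHs_gaussData_pos (hm 0) s
  set M := N ^ (d * e) with hMdef
  have hMpos : 0 < M := by positivity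
  set K := max t₁ (M / c₀) with hK
  have hKpos : 0 < K := lt_of_lt_of_le (by positivity) (le_max_right _ _)
  -- The threshold `L` for `‖duhamel‖` satisfies `L ^ e = M / ε^(d e)`. By `hup` it is not reached
  -- before `M / (C ε^(d e))`; by `hlow` it is reached by `K / ε^(d e)`, which exceeds `t₁` because
  -- `ε ≤ 1`. The factors `2` make the inequalities strict.
  refine ⟨M / (2 * C), 2 * K, by positivity, by positivity, fun ε hε hε1 => ?_⟩
  set E := ε ^ (d * e) with hE
  have hEpos : 0 < E := by positivity
  have hE1 : E ≤ 1 := pow_le_one₀ hε.le hε1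
  set r := ε / N with hr
  have hrpos : 0 < r := by positivity
  set L := (r ^ d)⁻¹ with hL
  have hLpos : 0 < L := by positivity
  have hLe : L ^ e = M / E := by
    rw [hL, hr, hMdef, hE, div_pow, inv_div, div_pow, pow_mul, pow_mul]
  have hKt₁ : t₁ ≤ K / E := (le_max_left _ _).trans (le_div_self hKpos.le hEpos hE1)
  have hbig : L ≤ ‖duhamel (m 2) c p (K / E) 0‖ := by
    rw [← pow_le_pow_iff_left₀ hLpos.le (norm_nonneg _) he, hLe]
    refine le_trans ?_ (hlow _ hKt₁)
    rw [← mul_div_assoc]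
    gcongr
    rw [← div_le_iff₀' hc₀]
    exact le_max_right _ _
  obtain ⟨T, x₀, hT, hTle, hTL, hbelow⟩ := exists_first_time
    (tame_duhamel (hm 2) hc hp hpos 0) duhamel_zero hLpos (by positivity) hbig
  set D := duhamel (m 2) c p with hD
  have hZne : D T x₀ ≠ 0 := norm_pos_iff.1 (hTL ▸ hLpos)
  have hrd : (0 : ℝ) < r ^ d := by positivity
  have hrdc : (r : ℂ) ^ d ≠ 0 := by exact_mod_cast hrd.ne'
  have hnr : ‖(r : ℂ) ^ d‖ = r ^ d := by
    rw [norm_pow, Complex.norm_real, Real.norm_of_nonneg hrpos.le]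
  have hw : ‖-((r : ℂ) ^ d * D T x₀)⁻¹‖ = 1 := by
    rw [norm_neg, norm_inv, norm_mul, hnr, hTL, hL, mul_inv_cancel₀ hrd.ne', inv_one]
  obtain ⟨A, hA, hAQ⟩ := hQ r hrpos _ hw
  refine ⟨A • gaussData (m 0), hM.const_smul A, ?_, T, ?_, ?_, ?_⟩
  · rw [hM.normHs_const_smul, hA, hr, ← hN, div_mul_cancel₀ _ hNpos.ne']
  · have h1 := hup T hT.le x₀
    rw [hTL, hLe, ← div_le_iff₀' hC] at h1
    refine lt_of_lt_of_le ?_ h1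
    have : M / (2 * C) / E = M / E / C / 2 := by field_simp
    rw [this]
    exact half_lt_self (by positivity)
  · refine hTle.trans_lt ?_
    rw [mul_div_assoc]
    have : 0 < K / E := by positivity
    linarith
  · refine solutionBlowsUpAt_of_eq_neg_one (x₀ := x₀) hs hm hm1 hQc hQb hAQ hc hp hpos hprof hT ?_ ?_
    · intro t ht x
      rw [norm_mul, norm_mul, hw, mul_one, hnr]
      calc r ^ d * ‖D t x‖ < r ^ d * L := by gcongr; exact hbelow t ht x
        _ = 1 := by rw [hL, mul_inv_cancel₀ hrd.ne']
    · change (r : ℂ) ^ d * -((r : ℂ) ^ d * D T x₀)⁻¹ * D T x₀ = -1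
      field_simp

end

noncomputable section

/-! ### Growth of Duhamel integrals -/

lemma cpow_ofReal_mul {r : ℝ} (hr : 0 < r) {z : ℂ} (hz : z ≠ 0) (w : ℂ) :
    ((r : ℂ) * z) ^ w = (r : ℂ) ^ w * z ^ w := by
  have hr' : (r : ℂ) ≠ 0 := by exact_mod_cast hr.ne'
  rw [Complex.cpow_def_of_ne_zero (mul_ne_zero hr' hz), Complex.cpow_def_of_ne_zero hr',
    Complex.cpow_def_of_ne_zero hz, Complex.log_ofReal_mul hr hz, ← Complex.exp_add,
    Complex.ofReal_log hr.le, add_mul]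

/-- For `t > 0` the product is `(q t / t) ^ w`, and powers are continuous on the slit plane. -/
lemma tendsto_rpow_mul_cpow {q : ℝ → ℂ} {L : ℂ} (hL : L ∈ Complex.slitPlane)
    (hq : Tendsto (fun t : ℝ => q t / t) atTop (𝓝 L)) (w : ℝ) :
    Tendsto (fun t : ℝ => ((t ^ (-w) : ℝ) : ℂ) * q t ^ (w : ℂ)) atTop (𝓝 (L ^ (w : ℂ))) := by
  have h := hq.cpow (tendsto_const_nhds (x := (w : ℂ))) hL
  refine h.congr' ?_
  filter_upwards [eventually_gt_atTop 0, hq.eventually_ne (Complex.slitPlane_ne_zero hL)]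
    with t ht hne
  have ht' : (t : ℂ) ≠ 0 := by exact_mod_cast ht.ne'
  have e : q t = (t : ℂ) * (q t / t) := by field_simp
  conv_rhs => rw [e]
  rw [cpow_ofReal_mul ht hne, ← mul_assoc, ← Complex.ofReal_cpow ht.le, ← Complex.ofReal_mul,
    ← Real.rpow_add ht]
  simp

lemma I_mem_slitPlane : Complex.I ∈ Complex.slitPlane := Or.inr (by simp)

lemma norm_cpow_neg_half (q : ℂ) : ‖q ^ (-(1 / 2) : ℂ)‖ = ‖q‖ ^ (-(1 / 2) : ℝ) := by
  have := Complex.norm_cpow_real q (-(1 / 2))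
  push_cast at this
  exact this

lemma norm_gaussK_le {m : ℝ} (hm : 0 < m) {q : ℂ} (hq : 0 < q.re) (x : ℝ) :
    ‖gaussK m q x‖ ≤ ‖q‖ ^ (-(1 / 2) : ℝ) := by
  rw [gaussK, norm_mul, norm_cpow_neg_half, Complex.norm_exp]
  refine mul_le_of_le_one_right (by positivity) (Real.exp_le_one_iff.2 ?_)
  rw [← Complex.ofReal_pow, Complex.re_mul_ofReal, Complex.neg_re]
  have := re_div_pos hm hq
  nlinarith [sq_nonneg x]

/-- Free evolution moves `q` upwards; from the upper half-plane this cannot decrease `‖q‖`, so a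
contribution to the Duhamel integral is never larger than at the time of its emission. -/
lemma norm_le_norm_add_I_mul {q : ℂ} (hq : 0 ≤ q.im) {r : ℝ} (hr : 0 ≤ r) :
    ‖q‖ ≤ ‖q + Complex.I * r‖ := by
  rw [← sq_le_sq₀ (norm_nonneg _) (norm_nonneg _), Complex.sq_norm, Complex.sq_norm]
  simp only [Complex.normSq_apply, Complex.add_re, Complex.add_im, Complex.I_mul_re,
    Complex.I_mul_im, Complex.ofReal_re, Complex.ofReal_im]
  nlinarith [mul_nonneg hq hr, sq_nonneg r]

section Growth

variable {m : ℝ} {c p : ℝ → ℂ} {β C₁ : ℝ} {Cinf : ℂ}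

lemma norm_duhamel_integrand_le (hm : 0 < m) (hpos : ∀ t, 0 < (p t).re)
    (him : ∀ t, 0 ≤ t → 0 ≤ (p t).im)
    (hbd : ∀ τ, 0 < τ → ‖c τ‖ * ‖p τ‖ ^ (-(1 / 2) : ℝ) ≤ C₁ * τ ^ (-β)) {τ t : ℝ} (hτ : 0 < τ)
    (hτt : τ ≤ t) (x : ℝ) :
    ‖c τ * gaussK m (p τ + Complex.I * (t - τ)) x‖ ≤ C₁ * τ ^ (-β) := by
  rw [norm_mul]
  refine le_trans ?_ (hbd τ hτ)
  gcongr
  refine (norm_gaussK_le hm (re_duhamel_param hpos τ t) x).trans ?_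
  refine Real.rpow_le_rpow_of_nonpos (norm_pos_iff.2 (ne_zero_of_re_pos (hpos τ))) ?_ (by norm_num)
  have := norm_le_norm_add_I_mul (him τ hτ.le) (sub_nonneg.2 hτt)
  rwa [Complex.ofReal_sub] at this

lemma norm_duhamel_le (hm : 0 < m) (hpos : ∀ t, 0 < (p t).re) (him : ∀ t, 0 ≤ t → 0 ≤ (p t).im)
    (hβ : β < 1) (hbd : ∀ τ, 0 < τ → ‖c τ‖ * ‖p τ‖ ^ (-(1 / 2) : ℝ) ≤ C₁ * τ ^ (-β)) {t : ℝ}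
    (ht : 0 ≤ t) (x : ℝ) : ‖duhamel m c p t x‖ ≤ C₁ / (1 - β) * t ^ (1 - β) := by
  rw [duhamel, norm_mul, Complex.norm_I, one_mul]
  refine (intervalIntegral.norm_integral_le_of_norm_le ht (g := fun τ => C₁ * τ ^ (-β))
    (Eventually.of_forall fun τ hτ => norm_duhamel_integrand_le hm hpos him hbd hτ.1 hτ.2 x)
    ((intervalIntegral.intervalIntegrable_rpow' (by linarith)).const_mul _)).trans (le_of_eq ?_)
  rw [intervalIntegral.integral_const_mul, integral_rpow (Or.inl (by linarith)),
    Real.zero_rpow (by linarith), neg_add_eq_sub]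
  ring

/-- With `τ = t θ` the parameter `p (t θ) + i (t - t θ)` behaves like `i t` whatever `θ` is, so at
`x = 0` all contributions have asymptotically the same phase. The rescaled integrand tends to a
constant times `θ^(1/2 - β)`, whose integral is `1 / (3/2 - β)`; the majorant `C₁ θ^(-β)` is
integrable as `β < 1`. -/
lemma tendsto_duhamel (hm : 0 < m) (hc : Continuous c) (hp : Continuous p)
    (hpos : ∀ t, 0 < (p t).re) (him : ∀ t, 0 ≤ t → 0 ≤ (p t).im) (hβ : β < 1)
    (hbd : ∀ τ, 0 < τ → ‖c τ‖ * ‖p τ‖ ^ (-(1 / 2) : ℝ) ≤ C₁ * τ ^ (-β))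
    (hplim : Tendsto (fun t : ℝ => p t / t) atTop (𝓝 Complex.I))
    (hclim : Tendsto (fun t : ℝ => ((t ^ (β - 1 / 2) : ℝ) : ℂ) * c t) atTop (𝓝 Cinf)) :
    Tendsto (fun t : ℝ => ((t ^ (β - 1) : ℝ) : ℂ) * duhamel m c p t 0) atTop
      (𝓝 (Complex.I * Cinf * Complex.I ^ (-(1 / 2) : ℂ) / (3 / 2 - β : ℝ))) := by
  have hval : ∫ θ in (0 : ℝ)..1, Complex.I * Cinf * Complex.I ^ (-(1 / 2) : ℂ)
      * ((θ ^ (1 / 2 - β) : ℝ) : ℂ)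
      = Complex.I * Cinf * Complex.I ^ (-(1 / 2) : ℂ) / (3 / 2 - β : ℝ) := by
    rw [intervalIntegral.integral_const_mul, intervalIntegral.integral_ofReal,
      integral_rpow (Or.inl (by linarith)), Real.one_rpow, Real.zero_rpow (by linarith),
      div_eq_mul_inv _ (((3 / 2 - β : ℝ)) : ℂ), ← Complex.ofReal_inv]
    congr 2
    rw [sub_zero, one_div]
    congr 1
    ring
  rw [← hval]
  have heq : ∀ t : ℝ, ((t ^ (β - 1) : ℝ) : ℂ) * duhamel m c p t 0 = ∫ θ in (0 : ℝ)..1,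
      ((t ^ (β - 1) : ℝ) : ℂ) * (Complex.I * t * (c (t * θ)
        * gaussK m (p (t * θ) + Complex.I * (t - (t * θ : ℝ))) 0)) := fun t => by
    rw [intervalIntegral.integral_const_mul, duhamel_eq]
    simp only [mul_assoc]
  simp only [heq]
  refine intervalIntegral.tendsto_integral_filter_of_dominated_convergence
    (fun θ => C₁ * θ ^ (-β)) ?_ ?_ ?_ ?_
  · refine Eventually.of_forall fun t => Continuous.aestronglyMeasurable ?_
    have hq : Continuous fun y : ℝ × ℝ => p (t * y.1) + Complex.I * (t - (t * y.1 : ℝ)) := by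
      fun_prop
    have := (continuous_gaussK_family hm (x := 0) hq fun y => re_duhamel_param hpos _ _).1
    have hk : Continuous fun θ : ℝ => gaussK m (p (t * θ) + Complex.I * (t - (t * θ : ℝ))) 0 :=
      this.comp (by fun_prop : Continuous fun θ : ℝ => (θ, (0 : ℝ)))
    fun_prop
  · filter_upwards [eventually_gt_atTop 0] with t ht
    refine Eventually.of_forall fun θ hθ => ?_
    rw [uIoc_of_le zero_le_one] at hθ
    have h1 := norm_duhamel_integrand_le hm hpos him hbd (τ := t * θ) (t := t)
      (mul_pos ht hθ.1) (mul_le_of_le_one_right ht.le hθ.2) 0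
    rw [norm_mul, norm_mul, norm_mul, Complex.norm_I, Complex.norm_real, Complex.norm_real,
      Real.norm_of_nonneg ht.le, Real.norm_of_nonneg (by positivity)]
    calc _ ≤ t ^ (β - 1) * (1 * t * (C₁ * (t * θ) ^ (-β))) := by gcongr
      _ = C₁ * θ ^ (-β) * (t ^ (β - 1) * t ^ (1 : ℝ) * t ^ (-β)) := by
          rw [Real.mul_rpow ht.le hθ.1.le, Real.rpow_one]; ring
      _ = _ := by
          rw [← Real.rpow_add ht, ← Real.rpow_add ht]
          simp
  · exact (intervalIntegral.intervalIntegrable_rpow' (by linarith)).const_mul _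
  · refine Eventually.of_forall fun θ hθ => ?_
    rw [uIoc_of_le zero_le_one] at hθ
    have hθ0 : (θ : ℂ) ≠ 0 := by exact_mod_cast hθ.1.ne'
    have hscale : Tendsto (fun t : ℝ => t * θ) atTop atTop := tendsto_id.atTop_mul_const hθ.1
    have l1 := hclim.comp hscale
    have l2 : Tendsto (fun t : ℝ => (p (t * θ) + Complex.I * (t - (t * θ : ℝ))) / t) atTop
        (𝓝 Complex.I) := by
      have h1 := ((hplim.comp hscale).mul_const (θ : ℂ)).add_const (Complex.I * (1 - θ))
      have e : Complex.I * θ + Complex.I * (1 - θ) = Complex.I := by ring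
      rw [e] at h1
      refine h1.congr' ?_
      filter_upwards [eventually_gt_atTop 0] with t ht
      have ht' : (t : ℂ) ≠ 0 := by exact_mod_cast ht.ne'
      simp only [Function.comp]
      push_cast
      field_simp
    have l3 := tendsto_rpow_mul_cpow I_mem_slitPlane l2 (-(1 / 2))
    have l4 := (l1.mul l3).const_mul (Complex.I * ((θ ^ (1 / 2 - β) : ℝ) : ℂ))
    have e : Complex.I * Cinf * Complex.I ^ (-(1 / 2) : ℂ) * ((θ ^ (1 / 2 - β) : ℝ) : ℂ)
        = Complex.I * ((θ ^ (1 / 2 - β) : ℝ) : ℂ)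
          * (Cinf * Complex.I ^ ((-(1 / 2) : ℝ) : ℂ)) := by push_cast; ring
    rw [e]
    refine l4.congr' ?_
    filter_upwards [eventually_gt_atTop 0] with t ht
    have hr : θ ^ (1 / 2 - β) * (t * θ) ^ (β - 1 / 2) * t ^ (-(-(1 / 2)) : ℝ)
        = t ^ (β - 1) * t := by
      rw [Real.mul_rpow ht.le hθ.1.le]
      calc _ = (θ ^ (1 / 2 - β) * θ ^ (β - 1 / 2)) * (t ^ (β - 1 / 2) * t ^ (-(-(1 / 2)) : ℝ)) := by
            ring
        _ = t ^ (β - 1) * t ^ (1 : ℝ) := by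
            rw [← Real.rpow_add hθ.1, ← Real.rpow_add ht, ← Real.rpow_add ht]
            ring_nf
            simp
        _ = _ := by rw [Real.rpow_one]
    have hr' := congrArg (fun r : ℝ => (r : ℂ)) hr
    push_cast at hr'
    simp only [Function.comp, gaussK]
    push_cast
    simp only [ne_eq, OfNat.ofNat_ne_zero, not_false_eq_true, zero_pow, mul_zero, Complex.exp_zero,
      mul_one]
    linear_combination (Complex.I * c (t * θ) *
      (p (t * θ) + Complex.I * (t - t * θ)) ^ (-(1 / 2) : ℂ)) * hr'

/-- Size `t^(1-β)` from above everywhere and from below at the origin; the power `e = 1 / (1 - β)`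
makes both bounds linear in `t`. -/
lemma exists_growth_bounds {e : ℕ} (hm : 0 < m) (hc : Continuous c) (hp : Continuous p)
    (hpos : ∀ t, 0 < (p t).re) (him : ∀ t, 0 ≤ t → 0 ≤ (p t).im) (hβ : β < 1)
    (hβe : (1 - β) * e = 1) (hC₁ : 0 < C₁)
    (hbd : ∀ τ, 0 < τ → ‖c τ‖ * ‖p τ‖ ^ (-(1 / 2) : ℝ) ≤ C₁ * τ ^ (-β))
    (hplim : Tendsto (fun t : ℝ => p t / t) atTop (𝓝 Complex.I))
    (hclim : Tendsto (fun t : ℝ => ((t ^ (β - 1 / 2) : ℝ) : ℂ) * c t) atTop (𝓝 Cinf))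
    (hCinf : Cinf ≠ 0) :
    ∃ C c₀ t₁ : ℝ, 0 < C ∧ 0 < c₀ ∧
      (∀ t, 0 ≤ t → ∀ x, ‖duhamel m c p t x‖ ^ e ≤ C * t) ∧
      (∀ t, t₁ ≤ t → c₀ * t ≤ ‖duhamel m c p t 0‖ ^ e) := by
  have hpow : ∀ t : ℝ, 0 ≤ t → (t ^ (1 - β)) ^ e = t := fun t ht => by
    rw [← Real.rpow_mul_natCast ht, hβe, Real.rpow_one]
  have h1β : 0 < 1 - β := by linarith
  have hlim := (tendsto_duhamel hm hc hp hpos him hβ hbd hplim hclim).norm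
  set ℓ := ‖Complex.I * Cinf * Complex.I ^ (-(1 / 2) : ℂ) / ((3 / 2 - β : ℝ) : ℂ)‖ with hℓ
  have hℓpos : 0 < ℓ := by
    have h3 : ((3 / 2 - β : ℝ) : ℂ) ≠ 0 := by
      have : 3 / 2 - β ≠ 0 := by linarith
      exact_mod_cast this
    have hI : Complex.I ^ (-(1 / 2) : ℂ) ≠ 0 := by
      rw [Complex.cpow_ne_zero_iff]; exact Or.inl Complex.I_ne_zero
    exact norm_pos_iff.2 (div_ne_zero (mul_ne_zero (mul_ne_zero Complex.I_ne_zero hCinf) hI) h3)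
  obtain ⟨t₁, ht₁⟩ := eventually_atTop.1
    ((hlim.eventually_const_le (half_lt_self hℓpos)).and (eventually_gt_atTop 0))
  refine ⟨(C₁ / (1 - β)) ^ e, (ℓ / 2) ^ e, t₁, by positivity, by positivity,
    fun t ht x => ?_, fun t ht => ?_⟩
  · calc _ ≤ (C₁ / (1 - β) * t ^ (1 - β)) ^ e := by
          gcongr; exact norm_duhamel_le hm hpos him hβ hbd ht x
      _ = _ := by rw [mul_pow, hpow t ht]
  · obtain ⟨h1, h2⟩ := ht₁ t ht
    rw [norm_mul, Complex.norm_real, Real.norm_of_nonneg (by positivity)] at h1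
    have h3 : ℓ / 2 * t ^ (1 - β) ≤ ‖duhamel m c p t 0‖ := by
      calc _ ≤ t ^ (β - 1) * ‖duhamel m c p t 0‖ * t ^ (1 - β) := by gcongr
        _ = ‖duhamel m c p t 0‖ * (t ^ (β - 1) * t ^ (1 - β)) := by ring
        _ = _ := by rw [← Real.rpow_add h2]; simp
    calc _ = (ℓ / 2 * t ^ (1 - β)) ^ e := by rw [mul_pow, hpow t h2.le]
      _ ≤ _ := by gcongr

end Growth

end

noncomputable section

/-! ### The four nonlinearities -/

/-- The factor `(1 + i t)^{-1/2}`. -/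
def invRoot (t : ℝ) : ℂ := (1 + Complex.I * t) ^ (-(1 / 2) : ℂ)

/-- The complex variance `(1 + t²) / (a - i t)` of the Gaussian `Q(u₁, u₂)`. -/
def variance (a t : ℝ) : ℂ := (1 + t ^ 2) / (a - Complex.I * t)

lemma one_le_norm_one_add_I_mul (t : ℝ) : 1 ≤ ‖1 + Complex.I * (t : ℂ)‖ := by
  simpa using Complex.re_le_norm (1 + Complex.I * (t : ℂ))

lemma le_norm_one_add_I_mul (t : ℝ) : t ≤ ‖1 + Complex.I * (t : ℂ)‖ := by
  simpa using Complex.im_le_norm (1 + Complex.I * (t : ℂ))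

lemma sub_I_mul_ne_zero {a : ℝ} (ha : 0 < a) (t : ℝ) : (a : ℂ) - Complex.I * t ≠ 0 :=
  ne_zero_of_re_pos (by simpa using ha)

/-- Rationalized form: a positive multiple of `a + i t`. It shows the positive real part, the sign
of the imaginary part and the asymptotics `i t`. -/
lemma variance_eq {a : ℝ} (ha : 0 < a) (t : ℝ) :
    variance a t = (((1 + t ^ 2) / (a ^ 2 + t ^ 2) : ℝ) : ℂ) * (a + Complex.I * t) := by
  have h0 := sub_I_mul_ne_zero ha t
  have h1 : ((a : ℂ) ^ 2 + (t : ℂ) ^ 2) ≠ 0 := by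
    have : a ^ 2 + t ^ 2 ≠ 0 := by positivity
    exact_mod_cast this
  rw [variance]
  push_cast
  rw [div_mul_eq_mul_div, div_eq_div_iff h0 h1]
  linear_combination (1 + (t : ℂ) ^ 2) * t ^ 2 * Complex.I_sq

lemma variance_re_pos {a : ℝ} (ha : 0 < a) (t : ℝ) : 0 < (variance a t).re := by
  rw [variance_eq ha, Complex.re_ofReal_mul]
  simp only [Complex.add_re, Complex.ofReal_re, Complex.I_mul_re, Complex.ofReal_im]
  have : 0 < a + -0 := by linarith
  positivity

lemma variance_im_nonneg {a : ℝ} (ha : 0 < a) {t : ℝ} (ht : 0 ≤ t) : 0 ≤ (variance a t).im := by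
  rw [variance_eq ha, Complex.im_ofReal_mul]
  simp only [Complex.add_im, Complex.ofReal_im, Complex.I_mul_im, Complex.ofReal_re]
  positivity

lemma continuous_variance {a : ℝ} (ha : 0 < a) : Continuous (variance a) := by
  unfold variance
  exact Continuous.div (by fun_prop) (by fun_prop) (sub_I_mul_ne_zero ha)

lemma variance_one (t : ℝ) : variance 1 t = 1 + Complex.I * t := by
  have h := sub_I_mul_ne_zero one_pos t
  rw [variance, div_eq_iff h]
  push_cast
  linear_combination (t : ℂ) ^ 2 * Complex.I_sq

lemma tendsto_add_I_mul_div (a : ℝ) :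
    Tendsto (fun t : ℝ => ((a : ℂ) + Complex.I * t) / t) atTop (𝓝 Complex.I) := by
  have h1 : Tendsto (fun t : ℝ => ((a / t : ℝ) : ℂ) + Complex.I) atTop (𝓝 (((0 : ℝ) : ℂ) + Complex.I)) :=
    ((Complex.continuous_ofReal.tendsto 0).comp (tendsto_const_nhds.div_atTop tendsto_id)).add_const _
  rw [Complex.ofReal_zero, zero_add] at h1
  refine h1.congr' ?_
  filter_upwards [eventually_gt_atTop 0] with t ht
  have ht' : (t : ℂ) ≠ 0 := by exact_mod_cast ht.ne'
  push_cast
  field_simp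

lemma tendsto_variance_div {a : ℝ} (ha : 0 < a) :
    Tendsto (fun t : ℝ => variance a t / t) atTop (𝓝 Complex.I) := by
  have h1 : Tendsto (fun t : ℝ => (1 + t ^ 2) / (a ^ 2 + t ^ 2)) atTop (𝓝 (1 + 0)) := by
    have h2 : Tendsto (fun t : ℝ => (1 - a ^ 2) / (a ^ 2 + t ^ 2)) atTop (𝓝 0) :=
      tendsto_const_nhds.div_atTop
        (tendsto_atTop_add_const_left _ _ (tendsto_pow_atTop two_ne_zero))
    refine (h2.const_add 1).congr fun t => ?_
    have : a ^ 2 + t ^ 2 ≠ 0 := by positivity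
    field_simp
    ring
  have h3 := ((Complex.continuous_ofReal.tendsto _).comp h1).mul (tendsto_add_I_mul_div a)
  rw [add_zero, Complex.ofReal_one, one_mul] at h3
  refine h3.congr fun t => ?_
  rw [variance_eq ha, mul_div_assoc]
  rfl

lemma continuous_invRoot : Continuous invRoot := by
  rw [← continuousOn_univ]
  exact continuousOn_rpow_half (by fun_prop) fun t _ => re_one_add_I_mul_pos t

lemma continuous_variance_root {a : ℝ} (ha : 0 < a) :
    Continuous fun t => variance a t ^ (1 / 2 : ℂ) :=
  continuous_iff_continuousAt.2 fun t => (continuous_variance ha).continuousAt.cpow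
    continuousAt_const (Or.inl (variance_re_pos ha t))

lemma norm_invRoot (t : ℝ) : ‖invRoot t‖ = (‖1 + Complex.I * (t : ℂ)‖ ^ (1 / 2 : ℝ))⁻¹ := by
  rw [invRoot, norm_cpow_neg_half, Real.rpow_neg (norm_nonneg _)]

lemma norm_cpow_half (q : ℂ) : ‖q ^ (1 / 2 : ℂ)‖ = ‖q‖ ^ (1 / 2 : ℝ) := by
  have := Complex.norm_cpow_real q (1 / 2)
  push_cast at this
  exact this

lemma norm_gain_le (t : ℝ) : ‖gain t‖ ≤ 4 * ‖1 + Complex.I * (t : ℂ)‖ ^ (1 / 2 : ℝ) := by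
  have h1 : 1 ≤ ‖1 + Complex.I * (t : ℂ)‖ ^ (1 / 2 : ℝ) :=
    Real.one_le_rpow (one_le_norm_one_add_I_mul t) (by norm_num)
  have h2 := norm_sub_le ((1 + Complex.I * (t : ℂ)) ^ (1 / 2 : ℂ)) 1
  rw [norm_cpow_half, norm_one] at h2
  rw [gain, norm_mul, norm_neg, Complex.norm_ofNat]
  linarith

lemma norm_invRoot_le {t : ℝ} (ht : 0 < t) : ‖invRoot t‖ ≤ t ^ (-(1 / 2) : ℝ) := by
  rw [norm_invRoot, Real.rpow_neg ht.le]
  have := le_norm_one_add_I_mul t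
  gcongr

/-- The resonant growth of the second component, `t^{1/2}`, offsets its dispersive decay,
`t^{-1/2}`. -/
lemma norm_gain_mul_invRoot_le (t : ℝ) : ‖gain t‖ * ‖invRoot t‖ ≤ 4 := by
  have h1 : 1 ≤ ‖1 + Complex.I * (t : ℂ)‖ ^ (1 / 2 : ℝ) :=
    Real.one_le_rpow (one_le_norm_one_add_I_mul t) (by norm_num)
  rw [norm_invRoot, ← div_eq_mul_inv, div_le_iff₀ (by linarith)]
  exact norm_gain_le t

lemma norm_variance_root_mul {a : ℝ} (ha : 0 < a) (t : ℝ) :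
    ‖variance a t ^ (1 / 2 : ℂ)‖ * ‖variance a t‖ ^ (-(1 / 2) : ℝ) = 1 := by
  have : 0 < ‖variance a t‖ := norm_pos_iff.2 (ne_zero_of_re_pos (variance_re_pos ha t))
  rw [norm_cpow_half, ← Real.rpow_add this]
  norm_num

/-- `gaussK` carries the prefactor `q^{-1/2}`. Where the variance of the source differs from `1 + i
t`, the amplitude `c` contains `variance^{1/2}` to undo it. -/
lemma variance_root_mul {a : ℝ} (ha : 0 < a) (t : ℝ) :
    variance a t ^ (1 / 2 : ℂ) * variance a t ^ (-(1 / 2) : ℂ) = 1 := by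
  rw [← Complex.cpow_add _ _ (ne_zero_of_re_pos (variance_re_pos ha t))]
  norm_num

/-! ### Limits -/

lemma tendsto_gain : Tendsto (fun t : ℝ => ((t ^ (1 / 2 : ℝ) : ℝ) : ℂ)⁻¹ * gain t) atTop
    (𝓝 (-2 * Complex.I ^ (1 / 2 : ℂ))) := by
  have h1 := tendsto_rpow_mul_cpow I_mem_slitPlane
    (by simpa using tendsto_add_I_mul_div 1) (1 / 2)
  have h2 := (Complex.continuous_ofReal.tendsto _).comp
    (tendsto_rpow_neg_atTop (y := (1 / 2 : ℝ)) (by norm_num))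
  have h3 := (h1.sub h2).const_mul (-2)
  push_cast at h3
  rw [sub_zero] at h3
  refine h3.congr' ?_
  filter_upwards [eventually_gt_atTop 0] with t ht
  rw [Function.comp, gain, Real.rpow_neg ht.le]
  push_cast
  ring

lemma tendsto_invRoot : Tendsto (fun t : ℝ => ((t ^ (1 / 2 : ℝ) : ℝ) : ℂ) * invRoot t) atTop
    (𝓝 (Complex.I ^ (-(1 / 2) : ℂ))) := by
  have h1 := tendsto_rpow_mul_cpow I_mem_slitPlane
    (by simpa using tendsto_add_I_mul_div 1) (-(1 / 2))
  rw [neg_neg] at h1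
  push_cast at h1
  exact h1

lemma tendsto_variance_root {a : ℝ} (ha : 0 < a) :
    Tendsto (fun t : ℝ => ((t ^ (1 / 2 : ℝ) : ℝ) : ℂ)⁻¹ * variance a t ^ (1 / 2 : ℂ)) atTop
      (𝓝 (Complex.I ^ (1 / 2 : ℂ))) := by
  have h1 := tendsto_rpow_mul_cpow I_mem_slitPlane (tendsto_variance_div ha) (1 / 2)
  push_cast at h1
  refine h1.congr' ?_
  filter_upwards [eventually_gt_atTop 0] with t ht
  rw [Real.rpow_neg ht.le]
  push_cast
  ring

lemma rpow_half_ne_zero {t : ℝ} (ht : 0 < t) : ((t ^ (1 / 2 : ℝ) : ℝ) : ℂ) ≠ 0 := by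
  have := (Real.rpow_pos_of_pos ht (1 / 2)).ne'
  exact_mod_cast this

lemma I_cpow_ne_zero (w : ℂ) : Complex.I ^ w ≠ 0 :=
  (Complex.cpow_ne_zero_iff).2 (Or.inl Complex.I_ne_zero)

/-! ### The phase of the data and the four cases -/

lemma exists_pow_eq_unimodular {n : ℕ} (hn : 0 < n) {w : ℂ} (hw : ‖w‖ = 1) :
    ∃ z : ℂ, ‖z‖ = 1 ∧ z ^ n = w := by
  obtain ⟨z, hz⟩ := IsAlgClosed.exists_pow_nat_eq w hn
  refine ⟨z, ?_, hz⟩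
  rw [← pow_eq_one_iff_of_nonneg (norm_nonneg z) hn.ne', ← norm_pow, hz, hw]

/-- What remains for each `Q`: its degree `d` under `(z₁, z₂) ↦ (A z₁, A² z₂)`, the variance
parameter `a` of its Gaussian profile, and the rate `t^{-β}` of its sup norm. The blow-up time is
then of order `ε^{-d e}` with `e = 1 / (1 - β)`. -/
theorem exists_blowUp_of_profile {s : ℕ} {m : Fin 3 → ℝ} {Q : ℂ → ℂ → ℂ} {c : ℝ → ℂ} {d e : ℕ}
    {a β C₁ : ℝ} {Cinf : ℂ} (hs : 1 ≤ s) (hm : ∀ j, 0 < m j) (hm1 : m 1 = 2 * m 0)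
    (hQc : Continuous fun p : ℂ × ℂ => Q p.1 p.2) (hQb : ∀ a b, ‖Q a b‖ ≤ ‖a‖ ^ 2 + ‖b‖ ^ 2)
    (hQ : ∀ r : ℝ, 0 < r → ∀ w : ℂ, ‖w‖ = 1 → ∃ A : ℂ, ‖A‖ = r ∧
      ∀ z₁ z₂, Q (A * z₁) (A ^ 2 * z₂) = r ^ d * w * Q z₁ z₂)
    (ha : 0 < a) (hc : Continuous c)
    (hprof : ∀ (t x : ℝ), Q (gaussK (m 0) (1 + Complex.I * t) x)
      (gain t * gaussK (m 1) (1 + Complex.I * t) x) = c t * gaussK (m 2) (variance a t) x)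
    (hβ : β < 1) (hβe : (1 - β) * e = 1) (hC₁ : 0 < C₁)
    (hbd : ∀ τ, 0 < τ → ‖c τ‖ * ‖variance a τ‖ ^ (-(1 / 2) : ℝ) ≤ C₁ * τ ^ (-β))
    (hclim : Tendsto (fun t : ℝ => ((t ^ (β - 1 / 2) : ℝ) : ℂ) * c t) atTop (𝓝 Cinf))
    (hCinf : Cinf ≠ 0) :
    ∃ κ K : ℝ, 0 < κ ∧ 0 < K ∧ ∀ ε : ℝ, 0 < ε → ε ≤ 1 →
      ∃ φ : ℝ → EuclideanSpace ℂ (Fin 3), MemHs s φ ∧ normHs s φ = ε ∧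
        ∃ T : ℝ, κ / ε ^ (d * e) < T ∧ T < K / ε ^ (d * e) ∧ SolutionBlowsUpAt s m Q φ T := by
  have he : e ≠ 0 := by rintro rfl; simp at hβe
  obtain ⟨C, c₀, t₁, hC, hc₀, hup, hlow⟩ := exists_growth_bounds (m := m 2) (hm 2) hc
    (continuous_variance ha) (variance_re_pos ha) (fun t ht => variance_im_nonneg ha ht) hβ hβe hC₁
    hbd (tendsto_variance_div ha) hclim hCinf
  exact exists_blowUp hs hm hm1 hQc hQb hQ hc (continuous_variance ha) (variance_re_pos ha) hprof he
    hC hup hc₀ hlow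

variable {s : ℕ} {m : Fin 3 → ℝ}

lemma norm_mul_le_sq_add_sq (a b : ℂ) : ‖a‖ * ‖b‖ ≤ ‖a‖ ^ 2 + ‖b‖ ^ 2 := by
  nlinarith [sq_nonneg (‖a‖ - ‖b‖), sq_nonneg ‖a‖, sq_nonneg ‖b‖]

theorem exists_blowUp_sq (hs : 1 ≤ s) (hm : ∀ j, 0 < m j) (hm1 : m 1 = 2 * m 0)
    (hm2 : m 2 = 4 * m 0) :
    ∃ κ K : ℝ, 0 < κ ∧ 0 < K ∧ ∀ ε : ℝ, 0 < ε → ε ≤ 1 →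
      ∃ φ : ℝ → EuclideanSpace ℂ (Fin 3), MemHs s φ ∧ normHs s φ = ε ∧
        ∃ T : ℝ, κ / ε ^ 4 < T ∧ T < K / ε ^ 4 ∧
          SolutionBlowsUpAt s m (fun _ z₂ => z₂ ^ 2) φ T := by
  -- The source is quadratic in the nondecaying second component, hence `β = 0` and `C₁ = 4²`. Here
  -- `B = A⁴`, so a fourth root supplies the phase.
  refine exists_blowUp_of_profile (d := 4) (e := 1) (a := 1) (β := 0) (C₁ := 16)
    (c := fun t => gain t ^ 2 * invRoot t)
    (Cinf := (-2 * Complex.I ^ (1 / 2 : ℂ)) ^ 2 * Complex.I ^ (-(1 / 2) : ℂ))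
    hs hm hm1 (by fun_prop) (fun a b => ?_) (fun r hr w hw => ?_) one_pos
    ((continuous_gain.pow 2).mul continuous_invRoot) (fun t x => ?_) (by norm_num) (by norm_num)
    (by norm_num) (fun t ht => ?_) ?_ ?_
  · rw [norm_pow]
    nlinarith [sq_nonneg ‖a‖]
  · obtain ⟨z, hz, hzw⟩ := exists_pow_eq_unimodular (n := 4) (by norm_num) hw
    refine ⟨r * z, by rw [norm_mul, hz, Complex.norm_real, Real.norm_of_nonneg hr.le, mul_one],
      fun z₁ z₂ => ?_⟩
    rw [← hzw]
    ring
  · have h2 : 2 * m 1 = m 2 := by rw [hm1, hm2]; ring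
    rw [mul_pow, gaussK_sq (ne_zero_of_re_pos (re_one_add_I_mul_pos t)), h2, variance_one, invRoot]
    ring
  · have h := norm_gain_mul_invRoot_le t
    have h2 : ‖variance 1 t‖ ^ (-(1 / 2) : ℝ) = ‖invRoot t‖ := by
      rw [variance_one, invRoot, norm_cpow_neg_half]
    rw [h2, norm_mul, norm_pow, neg_zero, Real.rpow_zero]
    nlinarith [norm_nonneg (gain t), norm_nonneg (invRoot t),
      mul_nonneg (norm_nonneg (gain t)) (norm_nonneg (invRoot t))]
  · refine ((tendsto_gain.pow 2).mul tendsto_invRoot).congr' ?_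
    filter_upwards [eventually_gt_atTop 0] with t ht
    have := rpow_half_ne_zero ht
    rw [zero_sub, Real.rpow_neg ht.le, Complex.ofReal_inv]
    field_simp
  · exact mul_ne_zero (pow_ne_zero _ (mul_ne_zero (by norm_num) (I_cpow_ne_zero _)))
      (I_cpow_ne_zero _)

theorem exists_blowUp_mul (hs : 1 ≤ s) (hm : ∀ j, 0 < m j) (hm1 : m 1 = 2 * m 0)
    (hm2 : m 2 = 3 * m 0) :
    ∃ κ K : ℝ, 0 < κ ∧ 0 < K ∧ ∀ ε : ℝ, 0 < ε → ε ≤ 1 →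
      ∃ φ : ℝ → EuclideanSpace ℂ (Fin 3), MemHs s φ ∧ normHs s φ = ε ∧
        ∃ T : ℝ, κ / ε ^ 6 < T ∧ T < K / ε ^ 6 ∧
          SolutionBlowsUpAt s m (fun z₁ z₂ => z₁ * z₂) φ T := by
  -- One factor does not decay and the other decays like `t^{-1/2}`, hence `β = 1/2`. Here `B = A³`.
  refine exists_blowUp_of_profile (d := 3) (e := 2) (a := 1) (β := 1 / 2) (C₁ := 4)
    (c := fun t => gain t * invRoot t)
    (Cinf := (-2 * Complex.I ^ (1 / 2 : ℂ)) * Complex.I ^ (-(1 / 2) : ℂ))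
    hs hm hm1 (by fun_prop) (fun a b => ?_) (fun r hr w hw => ?_) one_pos
    (continuous_gain.mul continuous_invRoot) (fun t x => ?_) (by norm_num) (by norm_num)
    (by norm_num) (fun t ht => ?_) ?_ ?_
  · rw [norm_mul]
    exact norm_mul_le_sq_add_sq a b
  · obtain ⟨z, hz, hzw⟩ := exists_pow_eq_unimodular (n := 3) (by norm_num) hw
    refine ⟨r * z, by rw [norm_mul, hz, Complex.norm_real, Real.norm_of_nonneg hr.le, mul_one],
      fun z₁ z₂ => ?_⟩
    rw [← hzw]
    ring
  · have h2 : m 0 + m 1 = m 2 := by rw [hm1, hm2]; ring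
    have h3 := gaussK_mul (m 0) (m 1) (ne_zero_of_re_pos (re_one_add_I_mul_pos t)) x
    rw [h2] at h3
    rw [mul_left_comm, h3, variance_one, invRoot]
    ring
  · have h := norm_gain_mul_invRoot_le t
    have h2 : ‖variance 1 t‖ ^ (-(1 / 2) : ℝ) = ‖invRoot t‖ := by
      rw [variance_one, invRoot, norm_cpow_neg_half]
    rw [h2, norm_mul]
    have := norm_invRoot_le ht
    gcongr
  · refine (tendsto_gain.mul tendsto_invRoot).congr' ?_
    filter_upwards [eventually_gt_atTop 0] with t ht
    have := rpow_half_ne_zero ht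
    rw [sub_self, Real.rpow_zero, Complex.ofReal_one]
    field_simp
  · exact mul_ne_zero (mul_ne_zero (by norm_num) (I_cpow_ne_zero _)) (I_cpow_ne_zero _)

lemma one_add_sq_eq (t : ℝ) :
    (1 + (t : ℂ) ^ 2) = (1 + Complex.I * t) * (1 - Complex.I * t) := by
  linear_combination (t : ℂ) ^ 2 * Complex.I_sq

lemma conj_gaussK_exponent (m t x : ℝ) :
    (starRingEnd ℂ) (-(m / (2 * (1 + Complex.I * t))) * (x : ℂ) ^ 2)
      = -(m / (2 * (1 - Complex.I * t))) * (x : ℂ) ^ 2 := by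
  simp [sub_eq_add_neg, Complex.conj_ofNat]

theorem exists_blowUp_conj_mul (hs : 1 ≤ s) (hm : ∀ j, 0 < m j) (hm1 : m 1 = 2 * m 0)
    (hm2 : m 2 = m 0) :
    ∃ κ K : ℝ, 0 < κ ∧ 0 < K ∧ ∀ ε : ℝ, 0 < ε → ε ≤ 1 →
      ∃ φ : ℝ → EuclideanSpace ℂ (Fin 3), MemHs s φ ∧ normHs s φ = ε ∧
        ∃ T : ℝ, κ / ε ^ 6 < T ∧ T < K / ε ^ 6 ∧
          SolutionBlowsUpAt s m (fun z₁ z₂ => (starRingEnd ℂ) z₁ * z₂) φ T := by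
  have h3 : (0 : ℝ) < 3 := by norm_num
  -- The rates are those of the product without conjugation, but now `B = |A|² A`, so the phase of
  -- `A` is the desired one itself.
  refine exists_blowUp_of_profile (d := 3) (e := 2) (a := 3) (β := 1 / 2) (C₁ := 4)
    (c := fun t => gain t * (starRingEnd ℂ) (invRoot t) * invRoot t * variance 3 t ^ (1 / 2 : ℂ))
    (Cinf := (-2 * Complex.I ^ (1 / 2 : ℂ)) * (starRingEnd ℂ) (Complex.I ^ (-(1 / 2) : ℂ))
      * Complex.I ^ (-(1 / 2) : ℂ) * Complex.I ^ (1 / 2 : ℂ))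
    hs hm hm1 ((Complex.continuous_conj.comp continuous_fst).mul continuous_snd) (fun a b => ?_)
    (fun r hr w hw => ?_) h3 (((continuous_gain.mul (Complex.continuous_conj.comp
      continuous_invRoot)).mul continuous_invRoot).mul (continuous_variance_root h3))
    (fun t x => ?_) (by norm_num) (by norm_num) (by norm_num) (fun t ht => ?_) ?_ ?_
  · rw [norm_mul, Complex.norm_conj]
    exact norm_mul_le_sq_add_sq a b
  · refine ⟨r * w, by rw [norm_mul, hw, Complex.norm_real, Real.norm_of_nonneg hr.le, mul_one],
      fun z₁ z₂ => ?_⟩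
    have hw2 : (starRingEnd ℂ) w * w = 1 := by
      rw [← Complex.normSq_eq_conj_mul_self, Complex.normSq_eq_norm_sq, hw]; simp
    simp only [map_mul, Complex.conj_ofReal]
    linear_combination (r : ℂ) ^ 3 * w * (starRingEnd ℂ) z₁ * z₂ * hw2
  · have e1 := ne_zero_of_re_pos (re_one_add_I_mul_pos t)
    have e2 := sub_I_mul_ne_zero one_pos t
    have e3 := sub_I_mul_ne_zero h3 t
    have e4 := variance_root_mul h3 t
    rw [Complex.ofReal_one] at e2
    -- The value `a = 3` comes from `1/(1 - i t) + 2/(1 + i t) = (3 - i t)/(1 + t²)`, the weights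
    -- being the mass ratios.
    have hexp : Complex.exp (-(m 0 / (2 * (1 - Complex.I * t))) * (x : ℂ) ^ 2)
        * Complex.exp (-(m 1 / (2 * (1 + Complex.I * t))) * (x : ℂ) ^ 2)
        = Complex.exp (-(m 2 / (2 * variance 3 t)) * (x : ℂ) ^ 2) := by
      rw [← Complex.exp_add, hm1, hm2, variance, one_add_sq_eq]
      congr 1
      push_cast at e3 ⊢
      field_simp
      ring
    rw [gaussK, gaussK, gaussK, map_mul, ← Complex.exp_conj, conj_gaussK_exponent, ← hexp]
    simp only [invRoot]
    linear_combination (-(gain t * (starRingEnd ℂ) ((1 + Complex.I * t) ^ (-(1 / 2) : ℂ))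
      * (1 + Complex.I * t) ^ (-(1 / 2) : ℂ)
      * Complex.exp (-(m 0 / (2 * (1 - Complex.I * t))) * (x : ℂ) ^ 2)
      * Complex.exp (-(m 1 / (2 * (1 + Complex.I * t))) * (x : ℂ) ^ 2))) * e4
  · have h := norm_gain_mul_invRoot_le t
    rw [norm_mul, norm_mul, norm_mul, Complex.norm_conj, mul_assoc, norm_variance_root_mul h3,
      mul_one]
    have := norm_invRoot_le ht
    gcongr
  · refine (((tendsto_gain.mul ((Complex.continuous_conj.tendsto _).comp tendsto_invRoot)).mul
      tendsto_invRoot).mul (tendsto_variance_root h3)).congr' ?_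
    filter_upwards [eventually_gt_atTop 0] with t ht
    have := rpow_half_ne_zero ht
    rw [sub_self, Real.rpow_zero, Complex.ofReal_one, Function.comp, map_mul, Complex.conj_ofReal]
    field_simp
  · exact mul_ne_zero (mul_ne_zero (mul_ne_zero (mul_ne_zero (by norm_num) (I_cpow_ne_zero _))
      ((map_ne_zero _).2 (I_cpow_ne_zero _))) (I_cpow_ne_zero _)) (I_cpow_ne_zero _)

theorem exists_blowUp_norm_mul (hs : 1 ≤ s) (hm : ∀ j, 0 < m j) (hm1 : m 1 = 2 * m 0)
    (hm2 : m 2 = 2 * m 0) :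
    ∃ κ K : ℝ, 0 < κ ∧ 0 < K ∧ ∀ ε : ℝ, 0 < ε → ε ≤ 1 →
      ∃ φ : ℝ → EuclideanSpace ℂ (Fin 3), MemHs s φ ∧ normHs s φ = ε ∧
        ∃ T : ℝ, κ / ε ^ 4 < T ∧ T < K / ε ^ 4 ∧
          SolutionBlowsUpAt s m (fun _ z₂ => (‖z₂‖ : ℂ) * z₂) φ T := by
  have h2 : (0 : ℝ) < 2 := by norm_num
  have hcn : Continuous fun z : ℂ => ((‖z‖ : ℝ) : ℂ) := Complex.continuous_ofReal.comp continuous_norm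
  -- The modulus contributes no phase: `B = |A|² A²`, and a square root suffices.
  refine exists_blowUp_of_profile (d := 4) (e := 1) (a := 2) (β := 0) (C₁ := 16)
    (c := fun t => ((‖gain t * invRoot t‖ : ℝ) : ℂ) * (gain t * invRoot t)
      * variance 2 t ^ (1 / 2 : ℂ))
    (Cinf := ((‖(-2 * Complex.I ^ (1 / 2 : ℂ)) * Complex.I ^ (-(1 / 2) : ℂ)‖ : ℝ) : ℂ)
      * ((-2 * Complex.I ^ (1 / 2 : ℂ)) * Complex.I ^ (-(1 / 2) : ℂ)) * Complex.I ^ (1 / 2 : ℂ))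
    hs hm hm1 ((hcn.comp continuous_snd).mul continuous_snd) (fun a b => ?_)
    (fun r hr w hw => ?_) h2 (((hcn.comp (continuous_gain.mul continuous_invRoot)).mul
      (continuous_gain.mul continuous_invRoot)).mul (continuous_variance_root h2))
    (fun t x => ?_) (by norm_num) (by norm_num) (by norm_num) (fun t ht => ?_) ?_ ?_
  · rw [norm_mul, Complex.norm_real, norm_norm]
    nlinarith [sq_nonneg ‖a‖]
  · obtain ⟨z, hz, hzw⟩ := exists_pow_eq_unimodular (n := 2) (by norm_num) hw
    have hA : ‖(r : ℂ) * z‖ = r := by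
      rw [norm_mul, hz, Complex.norm_real, Real.norm_of_nonneg hr.le, mul_one]
    refine ⟨r * z, hA, fun z₁ z₂ => ?_⟩
    rw [norm_mul, norm_pow, hA, ← hzw]
    push_cast
    ring
  · have e1 := ne_zero_of_re_pos (re_one_add_I_mul_pos t)
    have e2 := sub_I_mul_ne_zero one_pos t
    have e3 := sub_I_mul_ne_zero h2 t
    have e4 := variance_root_mul h2 t
    rw [Complex.ofReal_one] at e2
    -- Since `|e^ζ| e^ζ = e^{ζ + Re ζ}`, the value `a = 2` comes from `1/(1 + t²) + 1/(1 + i t) = (2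
    -- - i t)/(1 + t²)`.
    have hexp : ((‖Complex.exp (-(m 1 / (2 * (1 + Complex.I * t))) * (x : ℂ) ^ 2)‖ : ℝ) : ℂ)
        * Complex.exp (-(m 1 / (2 * (1 + Complex.I * t))) * (x : ℂ) ^ 2)
        = Complex.exp (-(m 2 / (2 * variance 2 t)) * (x : ℂ) ^ 2) := by
      rw [Complex.norm_exp, Complex.ofReal_exp, ← Complex.exp_add, Complex.re_eq_add_conj,
        conj_gaussK_exponent, hm1, hm2, variance, one_add_sq_eq]
      congr 1
      push_cast at e3 ⊢
      field_simp
      ring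
    simp only [gaussK, ← mul_assoc]
    rw [norm_mul, ← hexp]
    simp only [invRoot]
    push_cast
    linear_combination (-(‖gain t * (1 + Complex.I * t) ^ (-(1 / 2) : ℂ)‖ * gain t
      * (1 + Complex.I * t) ^ (-(1 / 2) : ℂ)
      * ‖Complex.exp (-(m 1 / (2 * (1 + Complex.I * t))) * (x : ℂ) ^ 2)‖
      * Complex.exp (-(m 1 / (2 * (1 + Complex.I * t))) * (x : ℂ) ^ 2))) * e4
  · have h := norm_gain_mul_invRoot_le t
    rw [norm_mul, norm_mul, Complex.norm_real, norm_norm, mul_assoc, norm_variance_root_mul h2,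
      mul_one, neg_zero, Real.rpow_zero, norm_mul]
    nlinarith [mul_nonneg (norm_nonneg (gain t)) (norm_nonneg (invRoot t))]
  · have l := tendsto_gain.mul tendsto_invRoot
    refine ((((hcn.tendsto _).comp l).mul l).mul (tendsto_variance_root h2)).congr' ?_
    filter_upwards [eventually_gt_atTop 0] with t ht
    have := rpow_half_ne_zero ht
    have e : ((t ^ (1 / 2 : ℝ) : ℝ) : ℂ)⁻¹ * gain t * (((t ^ (1 / 2 : ℝ) : ℝ) : ℂ) * invRoot t)
        = gain t * invRoot t := by field_simp
    rw [zero_sub, Real.rpow_neg ht.le, Complex.ofReal_inv, Function.comp, e]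
    ring
  · have hne : (-2 * Complex.I ^ (1 / 2 : ℂ)) * Complex.I ^ (-(1 / 2) : ℂ) ≠ 0 :=
      mul_ne_zero (mul_ne_zero (by norm_num) (I_cpow_ne_zero _)) (I_cpow_ne_zero _)
    refine mul_ne_zero (mul_ne_zero ?_ hne) (I_cpow_ne_zero _)
    exact_mod_cast (norm_pos_iff.2 hne).ne'

end

theorem theorem1 (m : Fin 3 → ℝ) (hm : ∀ j, 0 < m j) :
    -- (1) `Q = u₂²`, masses `1 : 2 : 4`
    (m 1 = 2 * m 0 → m 2 = 4 * m 0 → ∀ s : ℕ, 1 ≤ s →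
      ∃ κ K : ℝ, 0 < κ ∧ 0 < K ∧ ∀ ε : ℝ, 0 < ε → ε ≤ 1 →
        ∃ φ : ℝ → EuclideanSpace ℂ (Fin 3), MemHs s φ ∧ normHs s φ = ε ∧
          ∃ T : ℝ, κ / ε ^ 4 < T ∧ T < K / ε ^ 4 ∧
            SolutionBlowsUpAt s m (fun _ z₂ => z₂ ^ 2) φ T) ∧
    -- (2) `Q = u₁ u₂`, masses `1 : 2 : 3`
    (m 1 = 2 * m 0 → m 2 = 3 * m 0 → ∀ s : ℕ, 1 ≤ s →
      ∃ κ K : ℝ, 0 < κ ∧ 0 < K ∧ ∀ ε : ℝ, 0 < ε → ε ≤ 1 →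
        ∃ φ : ℝ → EuclideanSpace ℂ (Fin 3), MemHs s φ ∧ normHs s φ = ε ∧
          ∃ T : ℝ, κ / ε ^ 6 < T ∧ T < K / ε ^ 6 ∧
            SolutionBlowsUpAt s m (fun z₁ z₂ => z₁ * z₂) φ T) ∧
    -- (3) `Q = conj u₁ * u₂`, masses `1 : 2 : 1`
    (m 1 = 2 * m 0 → m 2 = m 0 → ∀ s : ℕ, 1 ≤ s →
      ∃ κ K : ℝ, 0 < κ ∧ 0 < K ∧ ∀ ε : ℝ, 0 < ε → ε ≤ 1 →
        ∃ φ : ℝ → EuclideanSpace ℂ (Fin 3), MemHs s φ ∧ normHs s φ = ε ∧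
          ∃ T : ℝ, κ / ε ^ 6 < T ∧ T < K / ε ^ 6 ∧
            SolutionBlowsUpAt s m (fun z₁ z₂ => (starRingEnd ℂ) z₁ * z₂) φ T) ∧
    -- (4) `Q = |u₂| u₂`, masses `1 : 2 : 2`, in `H¹`
    (m 1 = 2 * m 0 → m 2 = 2 * m 0 →
      ∃ κ K : ℝ, 0 < κ ∧ 0 < K ∧ ∀ ε : ℝ, 0 < ε → ε ≤ 1 →
        ∃ φ : ℝ → EuclideanSpace ℂ (Fin 3), MemHs 1 φ ∧ normHs 1 φ = ε ∧
          ∃ T : ℝ, κ / ε ^ 4 < T ∧ T < K / ε ^ 4 ∧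
            SolutionBlowsUpAt 1 m (fun _ z₂ => (‖z₂‖ : ℂ) * z₂) φ T) := by
  refine ⟨fun h1 h2 s hs => exists_blowUp_sq hs hm h1 h2, fun h1 h2 s hs => exists_blowUp_mul hs hm h1 h2,
    fun h1 h2 s hs => exists_blowUp_conj_mul hs hm h1 h2, fun h1 h2 =>
      exists_blowUp_norm_mul le_rfl hm h1 h2⟩
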